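/- Let $n\ge 0$, let $(i_1,\dots,i_k)$ be positive integers with $i_1+\dots+i_k=n$, let $\lambda_1<\dots<\lambda_k$ be real numbers and let $\Lambda$ be the diagonal $n\times n$ matrix with diagonal entries $\lambda_1$ ($i_1$ times), …, $\lambda_k$ ($i_k$ times), in this order. Let $\mathrm{Fl}=\mathrm{Fl}_{i_1,\dots,i_k}(\mathbb R)$ be the manifold of flags $0=V_0\subset V_1\subset\dots\subset V_k=\mathbb R^n$ with $\dim V_l=i_1+\dots+i_l$, with the smooth structure of a quotient of $GL(n,\mathbb R)$, and let $\pi\colon SO(n,\mathbb R)\to \mathrm{Fl}$ send $\Psi$ to the flag whose $V_l$ is spanned by the first $i_1+\dots+i_l$ columns of $\Psi$; its fibres are the orbits of right multiplication by $G=SO(n,\mathbb R)\cap(O(i_1)\times\dots\times O(i_k))$. Let $\mathcal S_\Lambda$ be the set of real symmetric $n\times n$ matrices with eigenvalues $\lambda_1,\dots,\lambda_k$ of multiplicities $i_1,\dots,i_k$. For a matrix $L$ let $B(L)$ be its strictly lower triangular part minus its strictly upper triangular part. The full symmetric Toda system is $\dot L=\varepsilon[B(L),L]$ on symmetric matrices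 and $\dot\Psi=\varepsilon B(\Psi\Lambda\Psi^T)\Psi$ on $SO(n,\mathbb R)$, where $\varepsilon\in\{1,-1\}$ is a fixed sign (the two usual sign conventions, which differ by time reversal). Let $F(\Psi)=\operatorname{Tr}(\Psi\Lambda\Psi^TN)$ with $N=\operatorname{diag}(0,1,\dots,n-1)$, and give $SO(n,\mathbb R)$ the right-invariant Riemannian metric $\langle A\Psi,C\Psi\rangle=\langle A,C\rangle_J=-\operatorname{Tr}(A\,J^{-1}(C))$ for $A,C\in\mathfrak{so}_n$, where $J^{-1}(C)_{ab}=|a-b|\,C_{ab}$. Then the following hold. (1) The map that sends $L\in\mathcal S_\Lambda$, with eigenspaces $L_1,\dots,L_k$ for $\lambda_1,\dots,\lambda_k$, to the flag $V_l=L_1\oplus\dots\oplus L_l$ is a bijection $\mathcal S_\Lambda\to\mathrm{Fl}$, and for $\Psi\in SO(n,\mathbb R)$ it sends $\Psi\Lambda\Psi^T$ to $\pi(\Psi)$. (2) The Toda field descends to a smooth vector field $\widetilde M$ on $\mathrm{Fl}$, $\;d\pi_\Psi\big(\varepsilon B(\Psi\Lambda\Psi^T)\Psi\big)=\widetilde M(\pi(\Psi))$.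 It has a global flow $(\varphi_t)_{t\in\mathbb R}$ on $\mathrm{Fl}$, and under the bijection in (1) this flow is the Toda system on $\mathcal S_\Lambda$: for each $L_0\in\mathcal S_\Lambda$ the equation $\dot L=\varepsilon[B(L),L]$, $L(0)=L_0$, has a solution for all $t\in\mathbb R$, and every such solution stays in $\mathcal S_\Lambda$ and has as its flags $\varphi_t$ applied to the flag of $L_0$. (3) The function $\varepsilon F$ descends to a Morse function $\widetilde F$ on $\mathrm{Fl}$ (smooth, with non-degenerate Hessian at each critical point): $\widetilde F(\pi(\Psi))=\varepsilon F(\Psi)$. The metric descends to a smooth Riemannian metric $\widetilde g$ on $\mathrm{Fl}$: if the tangent vectors $A\Psi$, $C\Psi$ ($A,C\in\mathfrak{so}_n$) are orthogonal to the orbit $\Psi G$, then $\widetilde g(d\pi_\Psi(A\Psi),d\pi_\Psi(C\Psi))=\langle A,C\rangle_J$. (4) The induced system is the gradient system of this Morse function: $\widetilde M=\operatorname{grad}_{\widetilde g}\widetilde F$. -/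

import Mathlib

open scoped Matrix.Norms.Operator Manifold ContDiff Topology

namespace FSToda

/-! ### Partial flags

An ordered tuple `(i₁, …, i_k)` of positive integers with sum `n` is a `c : Composition n`:
`c.length = k`, `c.blocksFun j` is the `j`-th part, `c.sizeUpTo l = i₁ + ⋯ + i_l`, and
`c.index a` is the block that contains the index `a`. -/

/-- The partial flag space `Fl_{i₁,…,i_k}(ℝ)`: chains `0 = V₀ ⊂ V₁ ⊂ ⋯ ⊂ V_k = ℝⁿ` of subspaces
with `dim V_l = i₁ + ⋯ + i_l`. -/
@[ext]
structure PartialFlag {n : ℕ} (c : Composition n) where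
  V : Fin (c.length + 1) → Submodule ℝ (Fin n → ℝ)
  mono : Monotone V
  finrank_eq : ∀ l, Module.finrank ℝ (V l) = c.sizeUpTo l

/-- The span of the first `i₁ + ⋯ + i_l` standard basis vectors. -/
def stdSub {n : ℕ} (c : Composition n) (l : ℕ) : Submodule ℝ (Fin n → ℝ) where
  carrier := {v | ∀ a : Fin n, c.sizeUpTo l ≤ a → v a = 0}
  add_mem' hv hw a ha := by simp [hv a ha, hw a ha]
  zero_mem' a _ := rfl
  smul_mem' r v hv a ha := by simp [hv a ha]

theorem mem_stdSub {n : ℕ} (c : Composition n) (l : ℕ) (v : Fin n → ℝ) :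
    v ∈ stdSub c l ↔ ∀ a : Fin n, c.sizeUpTo l ≤ a → v a = 0 := Iff.rfl

theorem stdSub_mono {n : ℕ} (c : Composition n) : Monotone (stdSub c) :=
  fun _ _ h _ hv a ha => hv a ((c.monotone_sizeUpTo h).trans ha)

theorem finrank_stdSub {n : ℕ} (c : Composition n) (l : ℕ) :
    Module.finrank ℝ (stdSub c l) = c.sizeUpTo l := by
  classical
  let I : Set (Fin n) := {a | (a : ℕ) < c.sizeUpTo l}
  let J : Set (Fin n) := {a | c.sizeUpTo l ≤ (a : ℕ)}
  have hIJ : Disjoint I J := by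
    rw [Set.disjoint_left]
    intro a ha hb
    simp only [I, J, Set.mem_ofPred_eq] at ha hb
    omega
  have hu : Set.univ ⊆ I ∪ J := fun a _ => lt_or_ge (a : ℕ) (c.sizeUpTo l)
  have e := LinearMap.iInfKerProjEquiv ℝ (fun _ : Fin n => ℝ) hIJ hu
  have hs : stdSub c l
      = ⨅ i ∈ J, (LinearMap.proj i : (Fin n → ℝ) →ₗ[ℝ] ℝ).ker := by
    ext v
    simp [mem_stdSub, J]
  rw [hs, e.finrank_eq, Module.finrank_fintype_fun_eq_card]
  have hle := c.sizeUpTo_le l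
  have : I = ((Finset.univ.filter fun a : Fin n => (a : ℕ) < c.sizeUpTo l : Finset (Fin n)) :
      Set (Fin n)) := by ext; simp [I]
  rw [← Nat.card_eq_fintype_card, Nat.card_coe_set_eq, this, Set.ncard_coe_finset,
    Fin.card_filter_val_lt]
  omega

theorem sizeUpTo_le_iff {n : ℕ} (c : Composition n) (l : ℕ) (a : Fin n) :
    c.sizeUpTo l ≤ a ↔ l ≤ (c.index a : ℕ) := by
  constructor
  · intro h
    by_contra hl
    have h1 : ((c.index a).succ : ℕ) ≤ l := by simp; omega
    have h2 := c.monotone_sizeUpTo h1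
    have h3 := c.lt_sizeUpTo_index_succ a
    omega
  · exact fun h => (c.monotone_sizeUpTo h).trans (c.sizeUpTo_index_le a)

/-- The standard flag. -/
def stdFlag {n : ℕ} (c : Composition n) : PartialFlag c where
  V l := stdSub c l
  mono _ _ h := stdSub_mono c h
  finrank_eq l := finrank_stdSub c l

open Classical in
/-- The flag `g · (standard flag)` of an invertible matrix `g`: its `l`-th subspace is spanned by
the first `i₁ + ⋯ + i_l` columns of `g`. (The value at a singular matrix is irrelevant.) Restricted
to `SO(n)` it is the projection `π : SO(n) → Fl_{i₁,…,i_k}(ℝ)`. -/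
noncomputable def flagOfMatrix {n : ℕ} (c : Composition n) (g : Matrix (Fin n) (Fin n) ℝ) :
    PartialFlag c :=
  if h : IsUnit g.det then
    { V := fun l => (stdSub c l).map g.mulVecLin
      mono := fun _ _ hl => Submodule.map_mono (stdSub_mono c hl)
      finrank_eq := fun l => by
        have hinj : Function.Injective g.mulVecLin :=
          Matrix.mulVec_injective_of_isUnit ((Matrix.isUnit_iff_isUnit_det g).mpr h)
        rw [← (Submodule.equivMapOfInjective _ hinj _).finrank_eq, finrank_stdSub] }
  else stdFlag c

theorem flagOfMatrix_V {n : ℕ} (c : Composition n) {g : Matrix (Fin n) (Fin n) ℝ}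
    (h : IsUnit g.det) (l : Fin (c.length + 1)) :
    (flagOfMatrix c g).V l = (stdSub c l).map g.mulVecLin := by
  rw [flagOfMatrix, dif_pos h]

theorem exists_equiv_fix {W : Type*} [AddCommGroup W] [Module ℝ W] [FiniteDimensional ℝ W]
    {A B B' : Submodule ℝ W} (hB : A ≤ B) (hB' : A ≤ B')
    (h : Module.finrank ℝ B = Module.finrank ℝ B') :
    ∃ S : W ≃ₗ[ℝ] W, (∀ a ∈ A, S a = a) ∧ B.map S.toLinearMap = B' := by
  let e0 : B ≃ₗ[ℝ] B' := LinearEquiv.ofFinrankEq B B' h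
  let f := (e0.submoduleMap (A.submoduleOf B)).symm ≪≫ₗ
    Submodule.submoduleOfEquivOfLe hB ≪≫ₗ (Submodule.submoduleOfEquivOfLe hB').symm
  obtain ⟨G, hG⟩ := Submodule.exists_linearEquiv_restrict_eq f
  obtain ⟨S, hS⟩ := Submodule.exists_linearEquiv_restrict_eq (e0 ≪≫ₗ G)
  refine ⟨S, fun a ha => ?_, ?_⟩
  · have h1 := hS ⟨a, hB ha⟩
    simp only [LinearEquiv.trans_apply] at h1
    rw [← h1]
    have h2 := hG ((e0.submoduleMap (A.submoduleOf B)) ⟨⟨a, hB ha⟩, ha⟩)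
    have h3 : ((e0.submoduleMap (A.submoduleOf B)) ⟨⟨a, hB ha⟩, ha⟩ : B') = e0 ⟨a, hB ha⟩ := rfl
    rw [h3] at h2
    rw [← h2]
    simp only [f, LinearEquiv.trans_apply, LinearEquiv.symm_apply_apply]
    rfl
  · apply Submodule.eq_of_le_of_finrank_eq
    · rintro _ ⟨b, hb, rfl⟩
      have := hS ⟨b, hb⟩
      simp only [LinearEquiv.coe_coe]
      change S b ∈ B'
      rw [show S b = S ((⟨b, hb⟩ : B) : W) from rfl, ← this]
      exact Subtype.property _
    · rw [LinearEquiv.finrank_map_eq, h]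

/-- The linear group acts transitively on partial flags. -/
theorem exists_flagOfMatrix_eq {n : ℕ} (c : Composition n) (x : PartialFlag c) :
    ∃ g : Matrix (Fin n) (Fin n) ℝ, IsUnit g.det ∧ flagOfMatrix c g = x := by
  have key : ∀ m : ℕ, m ≤ c.length → ∃ T : (Fin n → ℝ) ≃ₗ[ℝ] (Fin n → ℝ),
      ∀ l : Fin (c.length + 1), (l : ℕ) ≤ m → (stdSub c l).map T.toLinearMap = x.V l := by
    intro m
    induction m with
    | zero =>
      intro _
      refine ⟨LinearEquiv.refl _ _, fun l hl => ?_⟩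
      have h0 : (l : ℕ) = 0 := by omega
      have h1 := finrank_stdSub c l
      have h2 := x.finrank_eq l
      rw [h0] at h1 h2
      simp only [Composition.sizeUpTo_zero] at h1 h2
      rw [Submodule.finrank_eq_zero.mp h2, h0, Submodule.finrank_eq_zero.mp h1]
      simp
    | succ m ih =>
      intro hm
      obtain ⟨T, hT⟩ := ih (by omega)
      let lm : Fin (c.length + 1) := ⟨m, by omega⟩
      let ls : Fin (c.length + 1) := ⟨m + 1, by omega⟩
      have hA : x.V lm ≤ (stdSub c (m + 1)).map T.toLinearMap := by
        rw [← hT lm le_rfl]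
        exact Submodule.map_mono (stdSub_mono c (Nat.le_succ m))
      have hA' : x.V lm ≤ x.V ls := x.mono (by simp [lm, ls, Fin.le_def])
      obtain ⟨S, hS1, hS2⟩ := exists_equiv_fix hA hA' (by
        rw [LinearEquiv.finrank_map_eq, finrank_stdSub, x.finrank_eq])
      refine ⟨T ≪≫ₗ S, fun l hl => ?_⟩
      rcases Nat.lt_or_ge m l with hlt | hle
      · have : l = ls := Fin.ext (by simp [ls]; omega)
        subst this
        rw [← hS2, ← Submodule.map_comp]
        rfl
      · have hl' := hT l hle
        have : (stdSub c l).map (T ≪≫ₗ S).toLinearMap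
            = ((stdSub c l).map T.toLinearMap).map S.toLinearMap := by
          rw [← Submodule.map_comp]; rfl
        rw [this, hl']
        have hle' : x.V l ≤ x.V lm := x.mono (by simpa [lm, Fin.le_def] using hle)
        ext v
        constructor
        · rintro ⟨w, hw, rfl⟩
          simpa [hS1 w (hle' hw)] using hw
        · intro hv
          exact ⟨v, hv, hS1 v (hle' hv)⟩
  obtain ⟨T, hT⟩ := key c.length le_rfl
  let g := LinearMap.toMatrix' T.toLinearMap
  have hg : IsUnit g.det := by
    rw [LinearMap.det_toMatrix']
    exact LinearEquiv.isUnit_det' T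
  refine ⟨g, hg, PartialFlag.ext (funext fun l => ?_)⟩
  rw [flagOfMatrix_V c hg, ← hT l (by omega)]
  congr 1
  exact Matrix.toLin'_toMatrix' _

/-! ### The smooth structure -/

/-- Invertible matrices, an open subset of the space of matrices. -/
abbrev InvMatrix (n : ℕ) : Type := {g : Matrix (Fin n) (Fin n) ℝ // IsUnit g.det}

/-- The quotient topology for `GL(n, ℝ) → Fl_{i₁,…,i_k}(ℝ)`. -/
noncomputable instance {n : ℕ} (c : Composition n) : TopologicalSpace (PartialFlag c) :=
  TopologicalSpace.coinduced (fun g : InvMatrix n => flagOfMatrix c g.1) inferInstance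

theorem isOpen_isUnit_det (n : ℕ) : IsOpen {g : Matrix (Fin n) (Fin n) ℝ | IsUnit g.det} := by
  have hc : Continuous fun g : Matrix (Fin n) (Fin n) ℝ => g.det := by fun_prop
  simpa [isUnit_iff_ne_zero] using isOpen_ne.preimage hc

theorem isQuotientMap_flag {n : ℕ} (c : Composition n) :
    Topology.IsQuotientMap (fun g : InvMatrix n => flagOfMatrix c g.1) :=
  ⟨⟨rfl⟩, fun x => by
    obtain ⟨g, hg, h⟩ := exists_flagOfMatrix_eq c x
    exact ⟨⟨g, hg⟩, h⟩⟩

/-- The model space of `Fl_{i₁,…,i_k}(ℝ)`: strictly lower block-triangular matrices. -/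
abbrev Cell {n : ℕ} (c : Composition n) : Type :=
  {p : Fin n × Fin n // c.index p.2 < c.index p.1} → ℝ

/-- The strictly lower block-triangular matrix with the given entries. -/
noncomputable def lower {n : ℕ} (c : Composition n) :
    Cell c →L[ℝ] Matrix (Fin n) (Fin n) ℝ :=
  LinearMap.toContinuousLinearMap
    { toFun := fun X => Matrix.of fun a b =>
        if h : c.index b < c.index a then X ⟨(a, b), h⟩ else 0
      map_add' := fun X Y => by ext a b; by_cases h : c.index b < c.index a <;> simp [h]
      map_smul' := fun r X => by ext a b; by_cases h : c.index b < c.index a <;> simp [h] }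

theorem lower_apply {n : ℕ} (c : Composition n) (X : Cell c) (a b : Fin n) :
    lower c X a b = if h : c.index b < c.index a then X ⟨(a, b), h⟩ else 0 := rfl

/-- The strictly lower block-triangular entries of a matrix. -/
noncomputable def coords {n : ℕ} (c : Composition n) :
    Matrix (Fin n) (Fin n) ℝ →L[ℝ] Cell c :=
  LinearMap.toContinuousLinearMap
    { toFun := fun g p => g p.1.1 p.1.2
      map_add' := fun _ _ => rfl
      map_smul' := fun _ _ => rfl }

theorem coords_apply {n : ℕ} (c : Composition n) (g : Matrix (Fin n) (Fin n) ℝ)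
    (p : {p : Fin n × Fin n // c.index p.2 < c.index p.1}) : coords c g p = g p.1.1 p.1.2 := rfl

/-- The lower block-unipotent matrix `1 + X`. -/
noncomputable def unip {n : ℕ} (c : Composition n) (X : Cell c) : Matrix (Fin n) (Fin n) ℝ :=
  1 + lower c X

theorem index_mono {n : ℕ} (c : Composition n) {a b : Fin n} (h : a ≤ b) :
    c.index a ≤ c.index b := by
  rw [Fin.le_def, ← sizeUpTo_le_iff]
  exact (c.sizeUpTo_index_le a).trans h

theorem unip_apply_of_le {n : ℕ} (c : Composition n) (X : Cell c) {a b : Fin n}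
    (h : c.index a ≤ c.index b) : unip c X a b = (1 : Matrix (Fin n) (Fin n) ℝ) a b := by
  simp [unip, lower_apply, not_lt.mpr h]

theorem isUnit_det_unip {n : ℕ} (c : Composition n) (X : Cell c) : IsUnit (unip c X).det := by
  rw [Matrix.det_of_isLowerTriangular]
  · simp [unip_apply_of_le]
  · intro a b hab
    have hab' : a < b := hab
    rw [unip_apply_of_le c X (index_mono c hab'.le), Matrix.one_apply_ne hab'.ne]

theorem isUnit_det_mul_unip {n : ℕ} (c : Composition n) {g : Matrix (Fin n) (Fin n) ℝ}
    (hg : IsUnit g.det) (X : Cell c) : IsUnit (g * unip c X).det := by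
  rw [Matrix.det_mul]
  exact hg.mul (isUnit_det_unip c X)

/-- Block upper triangular invertible matrices fix the standard flag. -/
theorem flagOfMatrix_mul {n : ℕ} (c : Composition n) {g p : Matrix (Fin n) (Fin n) ℝ}
    (hg : IsUnit g.det) (hp : IsUnit p.det) (hb : p.BlockTriangular c.index) :
    flagOfMatrix c (g * p) = flagOfMatrix c g := by
  have hgp : IsUnit (g * p).det := by rw [Matrix.det_mul]; exact hg.mul hp
  refine PartialFlag.ext (funext fun l => ?_)
  rw [flagOfMatrix_V c hgp, flagOfMatrix_V c hg, Matrix.mulVecLin_mul, Submodule.map_comp]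
  congr 1
  have hinj : Function.Injective p.mulVecLin :=
    Matrix.mulVec_injective_of_isUnit ((Matrix.isUnit_iff_isUnit_det p).mpr hp)
  apply Submodule.eq_of_le_of_finrank_eq
  · rintro _ ⟨v, hv, rfl⟩ a ha
    simp only [Matrix.mulVecLin_apply, Matrix.mulVec, dotProduct]
    refine Finset.sum_eq_zero fun b _ => ?_
    rcases le_or_gt (c.sizeUpTo l) b with h | h
    · rw [hv b h, mul_zero]
    · rw [hb, zero_mul]
      rw [sizeUpTo_le_iff] at ha
      rw [← not_le, sizeUpTo_le_iff, not_le] at h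
      rw [Fin.lt_def]
      omega
  · rw [← (Submodule.equivMapOfInjective _ hinj _).finrank_eq]

theorem blockTriangular_of_flagOfMatrix_eq {n : ℕ} (c : Composition n)
    {g h : Matrix (Fin n) (Fin n) ℝ} (hg : IsUnit g.det) (hh : IsUnit h.det)
    (e : flagOfMatrix c g = flagOfMatrix c h) : (g⁻¹ * h).BlockTriangular c.index := by
  intro a b hab
  have hl : (c.index b : ℕ) + 1 < c.length + 1 := by have := (c.index b).2; omega
  let l : Fin (c.length + 1) := ⟨(c.index b : ℕ) + 1, hl⟩
  have hV : (flagOfMatrix c h).V l ≤ (flagOfMatrix c g).V l := by rw [e]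
  rw [flagOfMatrix_V c hg, flagOfMatrix_V c hh] at hV
  have hmem : Pi.single b (1 : ℝ) ∈ stdSub c l := by
    intro d hd
    rw [sizeUpTo_le_iff] at hd
    have : d ≠ b := by
      rintro rfl
      simp [l] at hd
    simp [this]
  obtain ⟨w, hw, hw'⟩ := hV ⟨_, hmem, rfl⟩
  have h1 : (g⁻¹ * h).mulVec (Pi.single b 1) = w := by
    rw [← Matrix.mulVec_mulVec]
    simp only [Matrix.mulVecLin_apply] at hw'
    rw [← hw', Matrix.mulVec_mulVec, Matrix.nonsing_inv_mul _ hg, Matrix.one_mulVec]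
  have h2 : (g⁻¹ * h) a b = w a := by
    rw [← h1]
    simp
  rw [h2]
  apply hw
  rw [sizeUpTo_le_iff]
  simp only [l]
  rw [Fin.lt_def] at hab
  omega

theorem unip_injective {n : ℕ} (c : Composition n) {g : Matrix (Fin n) (Fin n) ℝ}
    (hg : IsUnit g.det) : Function.Injective fun X : Cell c => flagOfMatrix c (g * unip c X) := by
  intro X Y hXY
  have hb := blockTriangular_of_flagOfMatrix_eq c (isUnit_det_mul_unip c hg X)
    (isUnit_det_mul_unip c hg Y) hXY
  set q := (g * unip c X)⁻¹ * (g * unip c Y) with hq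
  have hq' : unip c Y = unip c X * q := by
    have h1 : g * unip c Y = g * (unip c X * q) := by
      rw [hq, ← Matrix.mul_assoc, Matrix.mul_nonsing_inv_cancel_left _ _
        (isUnit_det_mul_unip c hg X)]
    have h2 := congrArg (g⁻¹ * ·) h1
    simpa [Matrix.nonsing_inv_mul_cancel_left _ _ hg] using h2
  -- above the block diagonal, by induction on the row block
  have hup : ∀ m : ℕ, ∀ a b : Fin n, (c.index a : ℕ) = m → c.index a ≤ c.index b →
      q a b = (1 : Matrix (Fin n) (Fin n) ℝ) a b := by
    intro m
    induction m using Nat.strong_induction_on with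
    | _ m ih =>
      intro a b ham hab
      have h1 := congrFun (congrFun hq' a) b
      rw [unip_apply_of_le c Y hab, Matrix.mul_apply] at h1
      rw [h1]
      have h2 : ∑ d, unip c X a d * q d b
          = ∑ d, (1 : Matrix (Fin n) (Fin n) ℝ) a d * q d b := by
        refine Finset.sum_congr rfl fun d _ => ?_
        rcases le_or_gt (c.index a) (c.index d) with h | h
        · rw [unip_apply_of_le c X h]
        · have hdb := ih (c.index d) (by rw [← ham]; exact h) d b rfl (h.le.trans hab)
          have hne : d ≠ b := by
            rintro rfl
            exact absurd hab (not_le.mpr h)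
          rw [hdb, Matrix.one_apply_ne hne]
          simp
      rw [h2, ← Matrix.mul_apply, Matrix.one_mul]
  have hone : q = 1 := by
    ext a b
    rcases le_or_gt (c.index a) (c.index b) with h | h
    · exact hup _ a b rfl h
    · rw [hb h, Matrix.one_apply_ne]
      rintro rfl
      exact lt_irrefl _ h
  rw [hone, Matrix.mul_one] at hq'
  funext p
  have := congrFun (congrFun hq' p.1.1) p.1.2
  simp only [unip, Matrix.add_apply, lower_apply, p.2, dite_true] at this
  linarith

/-- Near the identity, matrices factor smoothly as (lower block-unipotent) times
(block upper triangular). -/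
theorem exists_local_factor {n : ℕ} (c : Composition n) :
    ∃ ζ : Matrix (Fin n) (Fin n) ℝ → Matrix (Fin n) (Fin n) ℝ, ContDiffAt ℝ ∞ ζ 1 ∧
      ∀ᶠ h in 𝓝 (1 : Matrix (Fin n) (Fin n) ℝ),
        h = unip c (coords c (ζ h)) * (1 + (ζ h - lower c (coords c (ζ h)))) := by
  let f : Matrix (Fin n) (Fin n) ℝ → Matrix (Fin n) (Fin n) ℝ :=
    fun Z => (1 + lower c (coords c Z)) * (1 + (Z - lower c (coords c Z)))
  have hL : ContDiff ℝ ∞ fun Z : Matrix (Fin n) (Fin n) ℝ => lower c (coords c Z) :=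
    (lower c).contDiff.comp (coords c).contDiff
  have hf : ContDiff ℝ ∞ f :=
    (contDiff_const.add hL).mul (contDiff_const.add (contDiff_id.sub hL))
  have hd : HasFDerivAt f
      ((ContinuousLinearEquiv.refl ℝ (Matrix (Fin n) (Fin n) ℝ) :
        Matrix (Fin n) (Fin n) ℝ →L[ℝ] Matrix (Fin n) (Fin n) ℝ)) 0 := by
    have hL' : HasFDerivAt (fun Z : Matrix (Fin n) (Fin n) ℝ => lower c (coords c Z))
        ((lower c).comp (coords c)) 0 := ((lower c).comp (coords c)).hasFDerivAt
    have h1 := (hL'.const_add 1).mul' (((hasFDerivAt_id (𝕜 := ℝ)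
      (0 : Matrix (Fin n) (Fin n) ℝ)).sub hL').const_add 1)
    refine HasFDerivAt.congr_fderiv (f' := _) h1 ?_
    ext1 Z
    change (1 + lower c (coords c 0)) * (Z - lower c (coords c Z))
      + lower c (coords c Z) * (1 + (0 - lower c (coords c 0))) = Z
    simp
  have h0 : f 0 = 1 := by simp [f]
  have hn : (∞ : WithTop ℕ∞) ≠ 0 := by simp
  refine ⟨hf.contDiffAt.localInverse hd hn, ?_, ?_⟩
  · have := hf.contDiffAt.to_localInverse hd hn
    rwa [h0] at this
  · have := (hf.contDiffAt.hasStrictFDerivAt' hd hn).eventually_right_inverse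
    rw [h0] at this
    filter_upwards [this] with h hh
    exact hh.symm

/-- The cell coordinate is a smooth function of the matrix. -/
theorem exists_local_coord {n : ℕ} (c : Composition n) {g g₀ : Matrix (Fin n) (Fin n) ℝ}
    (hg : IsUnit g.det) (hg₀ : IsUnit g₀.det) (X : Cell c)
    (hX : flagOfMatrix c (g * unip c X) = flagOfMatrix c g₀) :
    ∃ σ : Matrix (Fin n) (Fin n) ℝ → Cell c, ContDiffAt ℝ ∞ σ g₀ ∧
      ∀ᶠ h in 𝓝 g₀, flagOfMatrix c (g * unip c (σ h)) = flagOfMatrix c h := by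
  obtain ⟨ζ, hζ, hev⟩ := exists_local_factor c
  have hu := isUnit_det_mul_unip c hg X
  set u := g * unip c X with hu_def
  set p := u⁻¹ * g₀ with hp_def
  have hb : p.BlockTriangular c.index := blockTriangular_of_flagOfMatrix_eq c hu hg₀ hX
  have hup : u * p = g₀ := Matrix.mul_nonsing_inv_cancel_left _ _ hu
  have hp : IsUnit p.det := by
    rw [hp_def, Matrix.det_mul]
    exact (Matrix.isUnit_nonsing_inv_det _ hu).mul hg₀
  let κ : Matrix (Fin n) (Fin n) ℝ → Matrix (Fin n) (Fin n) ℝ := fun h => u⁻¹ * h * p⁻¹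
  have hκ : ContDiff ℝ ∞ κ := (contDiff_const.mul contDiff_id).mul contDiff_const
  have hκ1 : κ g₀ = 1 := by
    simp only [κ]
    rw [← hp_def, Matrix.mul_nonsing_inv _ hp]
  have hκ2 : ∀ h, h = u * κ h * p := by
    intro h
    simp only [κ]
    rw [Matrix.mul_assoc u⁻¹, Matrix.mul_nonsing_inv_cancel_left _ _ hu,
      Matrix.nonsing_inv_mul_cancel_right _ _ hp]
  let σ : Matrix (Fin n) (Fin n) ℝ → Cell c :=
    fun h => coords c (unip c X * unip c (coords c (ζ (κ h))))
  have hσ : ∀ h, unip c (σ h) = unip c X * unip c (coords c (ζ (κ h))) := by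
    intro h
    set Y := coords c (ζ (κ h)) with hY
    have hσY : σ h = coords c (unip c X * unip c Y) := rfl
    ext a b
    rcases le_or_gt (c.index a) (c.index b) with hab | hab
    · rw [unip_apply_of_le c _ hab, Matrix.mul_apply]
      have : ∑ d, unip c X a d * unip c Y d b
          = ∑ d, (1 : Matrix (Fin n) (Fin n) ℝ) a d * (1 : Matrix (Fin n) (Fin n) ℝ) d b := by
        refine Finset.sum_congr rfl fun d _ => ?_
        rcases le_or_gt (c.index a) (c.index d) with h1 | h1
        · rw [unip_apply_of_le c X h1]
          by_cases had : a = d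
          · subst had
            rw [unip_apply_of_le c Y hab]
          · rw [Matrix.one_apply_ne had]; simp
        · have hdb : c.index d < c.index b := h1.trans_le hab
          rw [unip_apply_of_le c Y hdb.le]
          have hne : d ≠ b := by rintro rfl; exact lt_irrefl _ hdb
          rw [Matrix.one_apply_ne hne]; simp
      rw [this, ← Matrix.mul_apply, Matrix.mul_one]
    · have hne : a ≠ b := by rintro rfl; exact lt_irrefl _ hab
      rw [hσY]
      simp only [unip, Matrix.add_apply, lower_apply, hab, dite_true, coords_apply,
        Matrix.one_apply_ne hne, zero_add]
  refine ⟨σ, ?_, ?_⟩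
  · have h1 : ContDiffAt ℝ ∞ (fun h => ζ (κ h)) g₀ := by
      have h2 : ContDiffAt ℝ ∞ ζ (κ g₀) := by rw [hκ1]; exact hζ
      exact h2.comp g₀ hκ.contDiffAt
    have h2 : ContDiffAt ℝ ∞ (fun h => unip c (coords c (ζ (κ h)))) g₀ :=
      contDiffAt_const.add ((lower c).contDiff.contDiffAt.comp g₀
        ((coords c).contDiff.contDiffAt.comp g₀ h1))
    exact (coords c).contDiff.contDiffAt.comp g₀ (contDiffAt_const.mul h2)
  · have ht : Filter.Tendsto κ (𝓝 g₀) (𝓝 1) := by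
      rw [← hκ1]
      exact hκ.continuous.continuousAt
    filter_upwards [ht.eventually hev, (isOpen_isUnit_det n).mem_nhds hg₀] with h h1 h2
    have h2' : IsUnit h.det := h2
    set Z := ζ (κ h) with hZ
    set q := (1 : Matrix (Fin n) (Fin n) ℝ) + (Z - lower c (coords c Z)) with hq
    have h3 : h = (g * unip c (σ h)) * (q * p) := by
      conv_lhs => rw [hκ2 h, h1]
      rw [hσ h, hu_def]
      simp only [Matrix.mul_assoc]
      rfl
    have hqb : q.BlockTriangular c.index := by
      intro a b hab
      have hne : a ≠ b := by rintro rfl; exact lt_irrefl _ hab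
      simp [hq, lower_apply, hab, coords_apply, Matrix.one_apply_ne hne]
    have h4 : IsUnit (q * p).det := by
      have h5 : IsUnit ((g * unip c (σ h)).det * (q * p).det) := by
        rw [← Matrix.det_mul, ← h3]; exact h2'
      exact isUnit_of_mul_isUnit_right h5
    conv_rhs => rw [h3]
    exact (flagOfMatrix_mul c (isUnit_det_mul_unip c hg _) h4 (hqb.mul hb)).symm

/-- The big-cell chart centred at the flag of `g`; its inverse is `X ↦ g (1 + X) · (standard flag)`,
where `X` runs over the strictly lower block-triangular matrices. -/
noncomputable def cellChart {n : ℕ} (c : Composition n) (g : Matrix (Fin n) (Fin n) ℝ)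
    (hg : IsUnit g.det) : OpenPartialHomeomorph (PartialFlag c) (Cell c) where
  toFun := Function.invFun fun X => flagOfMatrix c (g * unip c X)
  invFun X := flagOfMatrix c (g * unip c X)
  source := Set.range fun X => flagOfMatrix c (g * unip c X)
  target := Set.univ
  map_source' _ _ := Set.mem_univ _
  map_target' X _ := ⟨X, rfl⟩
  left_inv' x hx := Function.invFun_eq hx
  right_inv' X _ := Function.leftInverse_invFun (unip_injective c hg) X
  open_source := by
    rw [← (isQuotientMap_flag c).isOpen_preimage, isOpen_iff_mem_nhds]
    rintro ⟨g₀, hg₀⟩ ⟨X, hX⟩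
    obtain ⟨σ, -, hev⟩ := exists_local_coord c hg hg₀ X hX
    filter_upwards [continuous_subtype_val.continuousAt.eventually hev] with h hh
    exact ⟨_, hh⟩
  open_target := isOpen_univ
  continuousOn_toFun := by
    have hopen : IsOpen (Set.range fun X => flagOfMatrix c (g * unip c X)) := by
      rw [← (isQuotientMap_flag c).isOpen_preimage, isOpen_iff_mem_nhds]
      rintro ⟨g₀, hg₀⟩ ⟨X, hX⟩
      obtain ⟨σ, -, hev⟩ := exists_local_coord c hg hg₀ X hX
      filter_upwards [continuous_subtype_val.continuousAt.eventually hev] with h hh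
      exact ⟨_, hh⟩
    rw [(isQuotientMap_flag c).continuousOn_isOpen_iff hopen]
    rintro ⟨g₀, hg₀⟩ ⟨X, hX⟩
    obtain ⟨σ, hσ, hev⟩ := exists_local_coord c hg hg₀ X hX
    apply ContinuousAt.continuousWithinAt
    have h1 : ContinuousAt (fun h : InvMatrix n => σ h.1) ⟨g₀, hg₀⟩ :=
      ContinuousAt.comp (f := Subtype.val) hσ.continuousAt continuous_subtype_val.continuousAt
    refine h1.congr ?_
    filter_upwards [continuous_subtype_val.continuousAt.eventually hev] with h hh
    simp only [Function.comp]
    rw [← hh]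
    exact (Function.leftInverse_invFun (unip_injective c hg) _).symm
  continuousOn_invFun := by
    apply Continuous.continuousOn
    have h1 : Continuous fun X : Cell c =>
        (⟨g * unip c X, isUnit_det_mul_unip c hg X⟩ : InvMatrix n) :=
      Continuous.subtype_mk (continuous_const.mul (continuous_const.add (lower c).continuous)) _
    exact (isQuotientMap_flag c).continuous.comp h1

/-- A chart belongs to the smooth structure of `GL(n, ℝ)/P = Fl_{i₁,…,i_k}(ℝ)` if its pull-back to
the open set of invertible matrices is smooth and its inverse lifts locally to smooth maps into the
invertible matrices. -/
def IsSmoothChart {n : ℕ} (c : Composition n)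
    (e : OpenPartialHomeomorph (PartialFlag c) (Cell c)) : Prop :=
  (∀ g : Matrix (Fin n) (Fin n) ℝ, IsUnit g.det → flagOfMatrix c g ∈ e.source →
    ContDiffAt ℝ ∞ (fun h => e (flagOfMatrix c h)) g) ∧
  ∀ y ∈ e.target, ∃ s : Cell c → Matrix (Fin n) (Fin n) ℝ, ContDiffAt ℝ ∞ s y ∧
    ∀ᶠ z in 𝓝 y, IsUnit (s z).det ∧ flagOfMatrix c (s z) = e.symm z

theorem isSmoothChart_cellChart {n : ℕ} (c : Composition n) (g : Matrix (Fin n) (Fin n) ℝ)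
    (hg : IsUnit g.det) : IsSmoothChart c (cellChart c g hg) := by
  refine ⟨?_, ?_⟩
  · rintro g₀ hg₀ ⟨X, hX⟩
    obtain ⟨σ, hσ, hev⟩ := exists_local_coord c hg hg₀ X hX
    refine hσ.congr_of_eventuallyEq ?_
    filter_upwards [hev] with h hh
    rw [← hh]
    exact Function.leftInverse_invFun (unip_injective c hg) _
  · intro y _
    refine ⟨fun X => g * unip c X, ?_, ?_⟩
    · exact contDiffAt_const.mul (contDiffAt_const.add (lower c).contDiff.contDiffAt)
    · exact Filter.Eventually.of_forall fun z => ⟨isUnit_det_mul_unip c hg z, rfl⟩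

/-- The standard smooth atlas of the partial flag manifold. -/
noncomputable instance {n : ℕ} (c : Composition n) :
    ChartedSpace (Cell c) (PartialFlag c) where
  atlas := {e | IsSmoothChart c e}
  chartAt x := cellChart c (exists_flagOfMatrix_eq c x).choose
    (exists_flagOfMatrix_eq c x).choose_spec.1
  mem_chart_source x := ⟨0, by
    have := (exists_flagOfMatrix_eq c x).choose_spec.2
    simpa [unip] using this⟩
  chart_mem_atlas x := isSmoothChart_cellChart c _ _

instance {n : ℕ} (c : Composition n) : IsManifold 𝓘(ℝ, Cell c) ∞ (PartialFlag c) := by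
  apply isManifold_of_contDiffOn
  intro e e' he he'
  simp only [modelWithCornersSelf_coe, modelWithCornersSelf_coe_symm, Function.id_comp,
    Function.comp_id, Set.preimage_id, Set.range_id, Set.inter_univ]
  intro y hy
  apply ContDiffAt.contDiffWithinAt
  simp only [OpenPartialHomeomorph.trans_source, OpenPartialHomeomorph.symm_source,
    Set.mem_inter_iff, Set.mem_preimage] at hy
  obtain ⟨s, hs, hev⟩ := he.2 y hy.1
  have h0 := hev.self_of_nhds
  have h1 : ContDiffAt ℝ ∞ (fun h => e' (flagOfMatrix c h)) (s y) :=
    he'.1 (s y) h0.1 (by rw [h0.2]; exact hy.2)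
  refine (h1.comp y hs).congr_of_eventuallyEq ?_
  filter_upwards [hev] with z hz
  simp [hz.2]

/-- The differential of the projection `g ↦ flagOfMatrix c g` at an invertible matrix `g`, applied
to `W`: the velocity at `t = 0` of the curve `t ↦ flagOfMatrix c (g + t W)`. -/
noncomputable def dflag {n : ℕ} (c : Composition n) (g W : Matrix (Fin n) (Fin n) ℝ) :
    TangentSpace 𝓘(ℝ, Cell c) (flagOfMatrix c g) :=
  (mfderiv 𝓘(ℝ, ℝ) 𝓘(ℝ, Cell c) (fun t : ℝ => flagOfMatrix c (g + t • W)) 0 : ℝ →L[ℝ] Cell c) 1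

/-! ### Morse functions -/

/-- A Morse function on a (boundaryless) manifold: a smooth function whose Hessian, computed in a
chart, is non-degenerate at each critical point. -/
def IsMorse {E : Type*} [NormedAddCommGroup E] [NormedSpace ℝ E] {X : Type*} [TopologicalSpace X]
    [ChartedSpace E X] (f : X → ℝ) : Prop :=
  ContMDiff 𝓘(ℝ, E) 𝓘(ℝ, ℝ) ∞ f ∧
  ∀ x : X, mfderiv 𝓘(ℝ, E) 𝓘(ℝ, ℝ) f x = 0 →
    ∀ v : E, (∀ w : E, fderiv ℝ (fderiv ℝ (f ∘ (chartAt E x).symm)) (chartAt E x x) v w = 0) →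
      v = 0

/-! ### The full symmetric Toda system -/

/-- The skew-symmetric Lax partner of `L`: the strictly lower triangular part of `L` minus its
strictly upper triangular part. -/
def laxB {n : ℕ} (L : Matrix (Fin n) (Fin n) ℝ) : Matrix (Fin n) (Fin n) ℝ :=
  Matrix.of fun a b => if b < a then L a b else if a < b then -L a b else 0

/-- The eigenvalue matrix `Λ = diag(λ₁, …, λ₁, λ₂, …, λ₂, …)`, with `λ_j` repeated `i_j` times. -/
def eigMatrix {n : ℕ} (c : Composition n) (lam : Fin c.length → ℝ) :
    Matrix (Fin n) (Fin n) ℝ :=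
  Matrix.diagonal fun a => lam (c.index a)

/-- The Toda vector field `Ψ ↦ B(ΨΛΨᵀ) Ψ` on `SO(n)`. -/
def todaField {n : ℕ} (Λ Ψ : Matrix (Fin n) (Fin n) ℝ) : Matrix (Fin n) (Fin n) ℝ :=
  laxB (Ψ * Λ * Ψ.transpose) * Ψ

/-- The function `F(Ψ) = Tr(Ψ Λ Ψᵀ N)`, `N = diag(0, 1, …, n - 1)`. -/
def todaF {n : ℕ} (Λ Ψ : Matrix (Fin n) (Fin n) ℝ) : ℝ :=
  (Ψ * Λ * Ψ.transpose * Matrix.diagonal fun a : Fin n => ((a : ℕ) : ℝ)).trace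

/-- The inverse of the isomorphism `J` of `so(n)` that divides the entry `(a, b)` by `|a - b|`. -/
def invJ {n : ℕ} (A : Matrix (Fin n) (Fin n) ℝ) : Matrix (Fin n) (Fin n) ℝ :=
  Matrix.of fun a b => |((a : ℕ) : ℝ) - ((b : ℕ) : ℝ)| * A a b

/-- The inner product `⟨A, C⟩_J = -Tr(A J⁻¹(C))` on `so(n)`. It gives a right-invariant Riemannian
metric on `SO(n)`, with `T_Ψ SO(n) = {AΨ | A ∈ so(n)}`. -/
def innerJ {n : ℕ} (A C : Matrix (Fin n) (Fin n) ℝ) : ℝ := -(A * invJ C).trace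

/-- `A ∈ so(n)`. -/
def IsSkew {n : ℕ} (A : Matrix (Fin n) (Fin n) ℝ) : Prop := A.transpose = -A

/-- The Lie algebra of `SO(n) ∩ (O(i₁) × ⋯ × O(i_k))`: block-diagonal skew-symmetric matrices. -/
def IsBlockSkew {n : ℕ} (c : Composition n) (Y : Matrix (Fin n) (Fin n) ℝ) : Prop :=
  IsSkew Y ∧ ∀ a b, c.index a ≠ c.index b → Y a b = 0

/-- `A ∈ so(n)` such that the tangent vector `AΨ` of `SO(n)` is orthogonal to the orbit of `Ψ` under
right multiplication by `SO(n) ∩ (O(i₁) × ⋯ × O(i_k))`. (The vertical vector `ΨY` is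
`(ΨYΨᵀ)Ψ`.) -/
def IsHorizontal {n : ℕ} (c : Composition n) (Ψ A : Matrix (Fin n) (Fin n) ℝ) : Prop :=
  IsSkew A ∧ ∀ Y, IsBlockSkew c Y → innerJ A (Ψ * Y * Ψ.transpose) = 0

/-- The symmetric matrices with eigenvalues `λ_j` of multiplicities `i_j`, `j = 1, …, k`. -/
def IsospectralSymm {n : ℕ} (c : Composition n) (lam : Fin c.length → ℝ) :
    Set (Matrix (Fin n) (Fin n) ℝ) :=
  {L | L.IsSymm ∧
    ∀ j, Module.finrank ℝ (Module.End.eigenspace (Matrix.toLin' L) (lam j)) = c.blocksFun j}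

/-- `L₁ ⊕ ⋯ ⊕ L_l`, the sum of the eigenspaces of `L` for the first `l` eigenvalues. -/
def eigSub {n k : ℕ} (lam : Fin k → ℝ) (L : Matrix (Fin n) (Fin n) ℝ) (l : ℕ) :
    Submodule ℝ (Fin n → ℝ) :=
  ⨆ j : Fin k, ⨆ _ : (j : ℕ) < l, Module.End.eigenspace (Matrix.toLin' L) (lam j)

theorem finrank_eigSub {n : ℕ} (c : Composition n) {lam : Fin c.length → ℝ}
    (hlam : Function.Injective lam) {L : Matrix (Fin n) (Fin n) ℝ}
    (hL : L ∈ IsospectralSymm c lam) (l : ℕ) (hl : l ≤ c.length) :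
    Module.finrank ℝ (eigSub lam L l) = c.sizeUpTo l := by
  induction l with
  | zero =>
    have h0 : eigSub lam L 0 = ⊥ := by simp [eigSub]
    rw [h0, finrank_bot, Composition.sizeUpTo_zero]
  | succ l ih =>
    let j : Fin c.length := ⟨l, hl⟩
    have hind : iSupIndep fun i => Module.End.eigenspace (Matrix.toLin' L) (lam i) :=
      (Module.End.eigenspaces_iSupIndep (Matrix.toLin' L)).comp hlam
    have hdis : Disjoint (eigSub lam L l)
        (Module.End.eigenspace (Matrix.toLin' L) (lam j)) := by
      have h1 := hind j
      refine (h1.mono_right ?_).symm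
      refine iSup_mono fun i => iSup_mono' fun hi => ⟨?_, le_rfl⟩
      rintro rfl
      simp [j] at hi
    have hsup : eigSub lam L (l + 1)
        = eigSub lam L l ⊔ Module.End.eigenspace (Matrix.toLin' L) (lam j) := by
      apply le_antisymm
      · refine iSup_le fun i => iSup_le fun hi => ?_
        rcases Nat.lt_succ_iff_lt_or_eq.mp hi with h | h
        · exact le_sup_of_le_left (le_iSup₂_of_le i h le_rfl)
        · have : i = j := Fin.ext h
          rw [this]
          exact le_sup_right
      · refine sup_le (iSup_le fun i => iSup_le fun hi => ?_) ?_
        · exact le_iSup₂_of_le i (Nat.lt_succ_of_lt hi) le_rfl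
        · exact le_iSup₂_of_le j (Nat.lt_succ_self l) le_rfl
    have h2 := Submodule.finrank_sup_add_finrank_inf_eq (eigSub lam L l)
      (Module.End.eigenspace (Matrix.toLin' L) (lam j))
    rw [hdis.eq_bot, finrank_bot, add_zero, ih (by omega), hL.2 j] at h2
    rw [hsup, h2]
    exact (c.sizeUpTo_succ' j).symm

/-- The identification of the isospectral symmetric matrices with partial flags:
`V_l = L₁ ⊕ ⋯ ⊕ L_l`, where `L_j` is the eigenspace for `λ_j`. -/
def eigenFlag {n : ℕ} (c : Composition n) {lam : Fin c.length → ℝ}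
    (hlam : StrictMono lam) (L : IsospectralSymm c lam) : PartialFlag c where
  V l := eigSub lam L.1 l
  mono _ _ h := iSup_mono fun _ => iSup_mono' fun hj => ⟨lt_of_lt_of_le hj h, le_rfl⟩
  finrank_eq l := finrank_eigSub c hlam.injective L.2 l (by omega)

end FSToda

namespace FSToda

/-! ### Orthogonal representatives of flags -/

/-! The flag manifold is embedded into the space of matrices by x ↦ L = ΨΛΨᵀ, where Ψ is any
orthogonal frame of x (`spec c lam`), and every object of the theorem is read off from L. Two
orthogonal frames of one flag differ by a block-diagonal matrix, which commutes with Λ, so L is well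
defined. It is smooth because the projections onto the V_l are rational functions of an arbitrary
frame (`spec_firstBlocks`). It is injective because the flag is recovered from the eigenspaces, and
it is an immersion because a tangent vector killed by dL is killed by the differential of every
spectral projection (`dspec_injective`).

The vector obtained by moving a flag with a skew matrix A is sent by dL to [A, L]. With P the
orthogonal projection onto the centralizer of L, a horizontal C satisfies P(J⁻¹C) = 0, hence J⁻¹C =
[S, L] for a unique S with PS = 0 (`exists_ad_eq`). Then dL(C) = [J[S, L], L] = K S for K = [J[·,
L], L] + P, which is symmetric and positive definite. Setting g(v, w) = ⟨dL v, K⁻¹ dL w⟩ with the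
Frobenius product gives ⟨[A, L], S⟩ = ⟨A, J⁻¹C⟩ on horizontal vectors, which is the prescribed value
(`flagMetric_horizontal`).

The gradient property rests on J⁻¹B(L) = [N, L] (`invJ_laxB`). It gives dL(M) = εK(N − PN), so g(M,
v) = ε⟨N − PN, dL v⟩. Since P dL v = 0, this is ε⟨N, dL v⟩ = dF(v).

For the Morse property, a critical point has [N, L] = 0, so L is diagonal. Differentiating the
action of A on F along v turns degeneracy of the Hessian into [N, dL v] = 0, so dL v is diagonal too
and commutes with L. As dL v is also orthogonal to the centralizer of L, it vanishes, and so does v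
(`isMorse_flagF`).

The flow is lifted to orthogonal matrices, where solutions are bounded and hence global
(`exists_todaCurve`). The group law and continuity are checked after embedding by L, by uniqueness
and Grönwall's inequality for the Toda equation. -/

theorem isUnit_det_of_transpose_mul {n : ℕ} {Ψ : Matrix (Fin n) (Fin n) ℝ}
    (h : Ψ.transpose * Ψ = 1) : IsUnit Ψ.det :=
  Matrix.isUnit_det_of_left_inverse h

theorem inv_eq_transpose {n : ℕ} {Ψ : Matrix (Fin n) (Fin n) ℝ}
    (h : Ψ.transpose * Ψ = 1) : Ψ⁻¹ = Ψ.transpose :=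
  Matrix.inv_eq_left_inv h

theorem transpose_mul_self_of_mem {n : ℕ} {Ψ : Matrix (Fin n) (Fin n) ℝ}
    (h : Ψ ∈ Matrix.specialOrthogonalGroup (Fin n) ℝ) : Ψ.transpose * Ψ = 1 :=
  (Matrix.mem_orthogonalGroup_iff' _ _).mp (Matrix.mem_specialOrthogonalGroup_iff.mp h).1

/-- QR decomposition, in the form: an invertible matrix becomes upper triangular after
multiplication by an orthogonal matrix. -/
theorem exists_orthogonal_blockTriangular {n : ℕ} (g : Matrix (Fin n) (Fin n) ℝ) :
    ∃ Ψ : Matrix (Fin n) (Fin n) ℝ, Ψ.transpose * Ψ = 1 ∧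
      (Ψ.transpose * g).BlockTriangular id := by
  let f : Fin n → EuclideanSpace ℝ (Fin n) := fun i => WithLp.toLp 2 fun a => g a i
  let b := InnerProductSpace.gramSchmidtOrthonormalBasis (𝕜 := ℝ) (by simp) f
  refine ⟨Matrix.of fun a i => b i a, ?_, ?_⟩
  · ext i j
    have := orthonormal_iff_ite.mp b.orthonormal i j
    rw [Matrix.one_apply, ← this, PiLp.inner_apply]
    simp [Matrix.mul_apply, mul_comm]
  · intro i j hij
    have := InnerProductSpace.gramSchmidtOrthonormalBasis_inv_triangular (𝕜 := ℝ)
      (by simp) f (i := j) (j := i) hij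
    rw [PiLp.inner_apply] at this
    rw [← this]
    simp [Matrix.mul_apply, mul_comm, b, f]

theorem exists_specialOrthogonal_eq {n : ℕ} (c : Composition n) (x : PartialFlag c) :
    ∃ Ψ ∈ Matrix.specialOrthogonalGroup (Fin n) ℝ, flagOfMatrix c Ψ = x := by
  obtain ⟨g, hg, rfl⟩ := exists_flagOfMatrix_eq c x
  obtain ⟨Ψ, hΨ, ht⟩ := exists_orthogonal_blockTriangular g
  have hu := isUnit_det_of_transpose_mul hΨ
  have hΨ' : Ψ * Ψ.transpose = 1 := mul_eq_one_comm.mp hΨ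
  have hp : IsUnit (Ψ.transpose * g).det := by
    rw [Matrix.det_mul, Matrix.det_transpose]; exact hu.mul hg
  have hfl : flagOfMatrix c g = flagOfMatrix c Ψ := by
    rw [← flagOfMatrix_mul c hu hp (fun a b hab => ht (lt_of_not_ge fun h =>
      absurd (index_mono c h) (not_le.mpr hab))), ← Matrix.mul_assoc, hΨ', Matrix.one_mul]
  have hdet : Ψ.det * Ψ.det = 1 := by
    have := congrArg Matrix.det hΨ
    simpa [Matrix.det_mul] using this
  rcases mul_self_eq_one_iff.mp hdet with h1 | h1
  · exact ⟨Ψ, Matrix.mem_specialOrthogonalGroup_iff.mpr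
      ⟨(Matrix.mem_orthogonalGroup_iff' _ _).mpr hΨ, h1⟩, hfl.symm⟩
  -- Negating one column repairs determinant −1 without moving the flag, since a diagonal sign
  -- matrix is block triangular. A column exists because the empty determinant is 1.
  · obtain ⟨i⟩ : Nonempty (Fin n) := by
      by_contra hne
      rw [not_nonempty_iff] at hne
      rw [Matrix.det_isEmpty] at h1
      norm_num at h1
    let d : Fin n → ℝ := Function.update 1 i (-1)
    have hd : Matrix.diagonal d * Matrix.diagonal d = 1 := by
      rw [Matrix.diagonal_mul_diagonal, ← Matrix.diagonal_one]
      congr 1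
      funext a
      by_cases h : a = i
      · subst h; simp [d]
      · simp [d, h]
    have hdd : (Matrix.diagonal d).det = -1 := by
      rw [Matrix.det_diagonal, Finset.prod_update_of_mem (Finset.mem_univ i)]
      simp
    refine ⟨Ψ * Matrix.diagonal d, Matrix.mem_specialOrthogonalGroup_iff.mpr
      ⟨(Matrix.mem_orthogonalGroup_iff' _ _).mpr ?_, ?_⟩, ?_⟩
    · change (Ψ * Matrix.diagonal d).transpose * (Ψ * Matrix.diagonal d) = 1
      rw [Matrix.transpose_mul, Matrix.diagonal_transpose, Matrix.mul_assoc,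
        ← Matrix.mul_assoc _ Ψ, hΨ, Matrix.one_mul, hd]
    · rw [Matrix.det_mul, h1, hdd]; norm_num
    · rw [flagOfMatrix_mul c hu (by rw [hdd]; simp) (Matrix.blockTriangular_diagonal d), hfl]

/-- The transition matrix ΨᵀΦ is block upper triangular, and so is its inverse, which is its
transpose. Only the diagonal blocks survive both conditions. -/
theorem blockDiagonal_of_flagOfMatrix_eq {n : ℕ} (c : Composition n)
    {Ψ Φ : Matrix (Fin n) (Fin n) ℝ} (hΨ : Ψ.transpose * Ψ = 1) (hΦ : Φ.transpose * Φ = 1)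
    (h : flagOfMatrix c Ψ = flagOfMatrix c Φ) {a b : Fin n} (hab : c.index a ≠ c.index b) :
    (Ψ.transpose * Φ) a b = 0 := by
  have hu := isUnit_det_of_transpose_mul hΨ
  have hv := isUnit_det_of_transpose_mul hΦ
  have h1 := blockTriangular_of_flagOfMatrix_eq c hu hv h
  have h2 := blockTriangular_of_flagOfMatrix_eq c hv hu h.symm
  rw [inv_eq_transpose hΨ] at h1
  rw [inv_eq_transpose hΦ] at h2
  rcases lt_or_gt_of_ne hab with h3 | h3
  · have := h2 h3
    rwa [show Φ.transpose * Ψ = (Ψ.transpose * Φ).transpose by simp] at this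
  · exact h1 h3

/-! ### Spectral matrices of a flag -/

/-- The block-scalar diagonal matrix with the given value on each block. -/
abbrev blockDiag {n : ℕ} (c : Composition n) (f : Fin c.length → ℝ) :
    Matrix (Fin n) (Fin n) ℝ := Matrix.diagonal fun a => f (c.index a)

/-- The transition matrix between the two frames is block diagonal and so commutes with block-scalar
matrices. This makes the arbitrary choice of `frame` in `spec` harmless. -/
theorem conj_blockDiag_eq {n : ℕ} (c : Composition n) (f : Fin c.length → ℝ)
    {Ψ Φ : Matrix (Fin n) (Fin n) ℝ} (hΨ : Ψ.transpose * Ψ = 1) (hΦ : Φ.transpose * Φ = 1)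
    (h : flagOfMatrix c Ψ = flagOfMatrix c Φ) :
    Ψ * blockDiag c f * Ψ.transpose = Φ * blockDiag c f * Φ.transpose := by
  have hΨ' : Ψ * Ψ.transpose = 1 := mul_eq_one_comm.mp hΨ
  have hΦ' : Φ * Φ.transpose = 1 := mul_eq_one_comm.mp hΦ
  have h1 : blockDiag c f * (Ψ.transpose * Φ) = (Ψ.transpose * Φ) * blockDiag c f := by
    ext a b
    rw [Matrix.diagonal_mul, Matrix.mul_diagonal]
    by_cases hab : c.index a = c.index b
    · rw [hab, mul_comm]
    · rw [blockDiagonal_of_flagOfMatrix_eq c hΨ hΦ h hab]; simp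
  calc Ψ * blockDiag c f * Ψ.transpose
      = Ψ * (blockDiag c f * (Ψ.transpose * Φ)) * Φ.transpose := by
        simp only [Matrix.mul_assoc, hΦ', Matrix.mul_one]
    _ = (Ψ * Ψ.transpose) * Φ * blockDiag c f * Φ.transpose := by
        rw [h1]; simp only [Matrix.mul_assoc]
    _ = _ := by rw [hΨ', Matrix.one_mul]

/-- An orthogonal frame of a flag. -/
noncomputable def frame {n : ℕ} (c : Composition n) (x : PartialFlag c) :
    Matrix (Fin n) (Fin n) ℝ := (exists_specialOrthogonal_eq c x).choose

theorem frame_mem {n : ℕ} (c : Composition n) (x : PartialFlag c) :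
    frame c x ∈ Matrix.specialOrthogonalGroup (Fin n) ℝ :=
  (exists_specialOrthogonal_eq c x).choose_spec.1

theorem frame_orth {n : ℕ} (c : Composition n) (x : PartialFlag c) :
    (frame c x).transpose * frame c x = 1 := transpose_mul_self_of_mem (frame_mem c x)

@[simp]
theorem flagOfMatrix_frame {n : ℕ} (c : Composition n) (x : PartialFlag c) :
    flagOfMatrix c (frame c x) = x := (exists_specialOrthogonal_eq c x).choose_spec.2

/-- The symmetric matrix with eigenvalue `f j` on the orthogonal complement of `V_j` in `V_{j+1}`,
where `V` is the given flag. -/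
noncomputable def spec {n : ℕ} (c : Composition n) (f : Fin c.length → ℝ) (x : PartialFlag c) :
    Matrix (Fin n) (Fin n) ℝ :=
  frame c x * blockDiag c f * (frame c x).transpose

theorem spec_flagOfMatrix {n : ℕ} (c : Composition n) (f : Fin c.length → ℝ)
    {Ψ : Matrix (Fin n) (Fin n) ℝ} (hΨ : Ψ.transpose * Ψ = 1) :
    spec c f (flagOfMatrix c Ψ) = Ψ * blockDiag c f * Ψ.transpose :=
  conj_blockDiag_eq c f (frame_orth c _) hΨ (by simp)

theorem spec_mul {n : ℕ} (c : Composition n) (f h : Fin c.length → ℝ) (x : PartialFlag c) :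
    spec c f x * spec c h x = spec c (f * h) x := by
  have h1 := frame_orth c x
  simp only [spec, Matrix.mul_assoc]
  rw [← Matrix.mul_assoc (frame c x).transpose (frame c x), h1, Matrix.one_mul,
    ← Matrix.mul_assoc (blockDiag c f), Matrix.diagonal_mul_diagonal]
  rfl

theorem spec_one {n : ℕ} (c : Composition n) (x : PartialFlag c) :
    spec c 1 x = 1 := by
  have h1 : frame c x * (frame c x).transpose = 1 := mul_eq_one_comm.mp (frame_orth c x)
  have h2 : blockDiag c 1 = 1 := by simp [blockDiag]
  rw [spec, h2, Matrix.mul_one, h1]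

theorem spec_transpose {n : ℕ} (c : Composition n) (f : Fin c.length → ℝ) (x : PartialFlag c) :
    (spec c f x).transpose = spec c f x := by
  simp [spec, Matrix.mul_assoc]

theorem spec_add {n : ℕ} (c : Composition n) (f h : Fin c.length → ℝ) (x : PartialFlag c) :
    spec c (f + h) x = spec c f x + spec c h x := by
  have : blockDiag c (f + h) = blockDiag c f + blockDiag c h := by simp [blockDiag]
  rw [spec, this, Matrix.mul_add, Matrix.add_mul]; rfl

theorem spec_smul {n : ℕ} (c : Composition n) (r : ℝ) (f : Fin c.length → ℝ)
    (x : PartialFlag c) : spec c (r • f) x = r • spec c f x := by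
  have : blockDiag c (r • f) = r • blockDiag c f := by
    ext a b; simp [blockDiag, Matrix.diagonal_apply]
  rw [spec, this, Matrix.mul_smul, Matrix.smul_mul]; rfl

/-- `spec` as a linear map. -/
noncomputable def specₗ {n : ℕ} (c : Composition n) (x : PartialFlag c) :
    (Fin c.length → ℝ) →ₗ[ℝ] Matrix (Fin n) (Fin n) ℝ where
  toFun f := spec c f x
  map_add' f h := spec_add c f h x
  map_smul' r f := spec_smul c r f x

theorem spec_sum {n : ℕ} (c : Composition n) {ι : Type*} (s : Finset ι)
    (f : ι → Fin c.length → ℝ) (x : PartialFlag c) :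
    spec c (∑ i ∈ s, f i) x = ∑ i ∈ s, spec c (f i) x := map_sum (specₗ c x) f s

theorem spec_sub {n : ℕ} (c : Composition n) (f h : Fin c.length → ℝ) (x : PartialFlag c) :
    spec c (f - h) x = spec c f x - spec c h x := map_sub (specₗ c x) f h

/-- The orthogonal projections to the summands of the orthogonal decomposition given by a flag. -/
noncomputable abbrev eproj {n : ℕ} (c : Composition n) (j : Fin c.length) (x : PartialFlag c) :
    Matrix (Fin n) (Fin n) ℝ := spec c (Pi.single j 1) x

theorem spec_eq_sum {n : ℕ} (c : Composition n) (f : Fin c.length → ℝ) (x : PartialFlag c) :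
    spec c f x = ∑ j, f j • eproj c j x := by
  simp only [eproj, ← spec_smul, ← spec_sum]
  congr 1
  funext i
  simp [Finset.sum_apply, Pi.single_apply]

theorem sum_eproj {n : ℕ} (c : Composition n) (x : PartialFlag c) :
    ∑ j, eproj c j x = 1 := by
  have := spec_eq_sum c 1 x
  rw [spec_one] at this
  simpa using this.symm

theorem spec_mul_eproj {n : ℕ} (c : Composition n) (f : Fin c.length → ℝ) (j : Fin c.length)
    (x : PartialFlag c) : spec c f x * eproj c j x = f j • eproj c j x := by
  rw [spec_mul, ← spec_smul]
  congr 1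
  funext i
  by_cases h : i = j
  · subst h; simp
  · simp [h]

theorem eproj_mul_spec {n : ℕ} (c : Composition n) (f : Fin c.length → ℝ) (j : Fin c.length)
    (x : PartialFlag c) : eproj c j x * spec c f x = f j • eproj c j x := by
  rw [spec_mul, mul_comm, ← spec_mul, spec_mul_eproj]

theorem eproj_mul_self {n : ℕ} (c : Composition n) (j : Fin c.length) (x : PartialFlag c) :
    eproj c j x * eproj c j x = eproj c j x := by
  rw [spec_mul_eproj]; simp

theorem eproj_mul_of_ne {n : ℕ} (c : Composition n) {i j : Fin c.length} (h : i ≠ j)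
    (x : PartialFlag c) : eproj c i x * eproj c j x = 0 := by
  rw [spec_mul_eproj]; simp [h.symm]

theorem exp_skew_orth {n : ℕ} {A : Matrix (Fin n) (Fin n) ℝ} (hA : IsSkew A) (t : ℝ) :
    (NormedSpace.exp (t • A)).transpose * NormedSpace.exp (t • A) = 1 := by
  have hA' : A.transpose = -A := hA
  rw [← Matrix.exp_transpose, Matrix.transpose_smul, hA', smul_neg, Matrix.exp_neg]
  exact Matrix.nonsing_inv_mul _ ((Matrix.isUnit_iff_isUnit_det _).mp (Matrix.isUnit_exp _))

/-- The topology of the operator norm (the product topology), preferred over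
`instTopologicalSpaceMatrix` to agree with the norm at instance transparency. -/
noncomputable local instance (priority := 5000) normTopology (n : ℕ) :
    TopologicalSpace (Matrix (Fin n) (Fin n) ℝ) :=
  PseudoMetricSpace.toUniformSpace.toTopologicalSpace

/-! ### Smoothness of the spectral matrices -/

theorem contDiffAt_matrix_inv {n : ℕ} {A : Matrix (Fin n) (Fin n) ℝ} (hA : IsUnit A.det) :
    ContDiffAt ℝ ∞ (fun B : Matrix (Fin n) (Fin n) ℝ => B⁻¹) A := by
  have h := (Matrix.isUnit_iff_isUnit_det A).mpr hA
  have := contDiffAt_ringInverse ℝ (n := ∞) h.unit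
  rw [h.unit_spec] at this
  exact this.congr_of_eventuallyEq
    (Filter.Eventually.of_forall fun B => Matrix.nonsing_inv_eq_ringInverse B)

/-- Matrix transposition as a continuous linear map. -/
noncomputable def transposeL (n : ℕ) :
    Matrix (Fin n) (Fin n) ℝ →L[ℝ] Matrix (Fin n) (Fin n) ℝ :=
  LinearMap.toContinuousLinearMap (Matrix.transposeLinearEquiv (Fin n) (Fin n) ℝ ℝ).toLinearMap

@[simp]
theorem transposeL_apply {n : ℕ} (A : Matrix (Fin n) (Fin n) ℝ) :
    transposeL n A = A.transpose := rfl

theorem contDiff_transpose {n : ℕ} :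
    ContDiff ℝ ∞ (fun A : Matrix (Fin n) (Fin n) ℝ => A.transpose) := (transposeL n).contDiff

/-- The indicator function of the first `l` blocks. -/
def firstBlocks {n : ℕ} (c : Composition n) (l : ℕ) (j : Fin c.length) : ℝ :=
  if (j : ℕ) < l then 1 else 0

theorem blockDiag_firstBlocks_mul_self {n : ℕ} (c : Composition n) (l : ℕ) :
    blockDiag c (firstBlocks c l) * blockDiag c (firstBlocks c l)
      = blockDiag c (firstBlocks c l) := by
  rw [Matrix.diagonal_mul_diagonal]
  congr 1
  funext a
  simp [firstBlocks]

theorem blockDiag_firstBlocks_mul {n : ℕ} (c : Composition n) (l : ℕ)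
    {p : Matrix (Fin n) (Fin n) ℝ} (hp : p.BlockTriangular c.index) :
    blockDiag c (firstBlocks c l) * (p * blockDiag c (firstBlocks c l))
      = p * blockDiag c (firstBlocks c l) := by
  ext a b
  rw [Matrix.diagonal_mul, Matrix.mul_diagonal]
  by_cases hb : (c.index b : ℕ) < l
  · by_cases ha : (c.index a : ℕ) < l
    · simp [firstBlocks, ha]
    · rw [hp (show c.index b < c.index a by rw [Fin.lt_def]; omega)]; simp
  · simp [firstBlocks, hb]

/-- A formula for the orthogonal projection onto `V_l` in terms of any frame. -/
theorem spec_firstBlocks {n : ℕ} (c : Composition n) (l : ℕ) {g : Matrix (Fin n) (Fin n) ℝ}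
    (hg : IsUnit g.det) :
    let E := blockDiag c (firstBlocks c l)
    IsUnit (E * g.transpose * g * E + (1 - E)).det ∧
    spec c (firstBlocks c l) (flagOfMatrix c g)
      = g * E * (E * g.transpose * g * E + (1 - E))⁻¹ * E * g.transpose := by
  intro E
  set Ψ := frame c (flagOfMatrix c g) with hΨdef
  have hΨ : Ψ.transpose * Ψ = 1 := frame_orth c _
  have hΨ' : Ψ * Ψ.transpose = 1 := mul_eq_one_comm.mp hΨ
  have hu := isUnit_det_of_transpose_mul hΨ
  have hfl : flagOfMatrix c Ψ = flagOfMatrix c g := flagOfMatrix_frame c _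
  set p := Ψ⁻¹ * g with hp
  set q := g⁻¹ * Ψ with hq
  have hpq : p * q = 1 := by
    rw [hp, hq, Matrix.mul_assoc, Matrix.mul_nonsing_inv_cancel_left _ _ hg,
      Matrix.nonsing_inv_mul _ hu]
  have hgp : g = Ψ * p := (Matrix.mul_nonsing_inv_cancel_left _ _ hu).symm
  have hE : E * E = E := blockDiag_firstBlocks_mul_self c l
  have hEt : E.transpose = E := Matrix.diagonal_transpose _
  have hpE : E * (p * E) = p * E :=
    blockDiag_firstBlocks_mul c l (blockTriangular_of_flagOfMatrix_eq c hu hg hfl)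
  have hqE : E * (q * E) = q * E :=
    blockDiag_firstBlocks_mul c l (blockTriangular_of_flagOfMatrix_eq c hg hu hfl.symm)
  have hpE' : E * (p.transpose * E) = E * p.transpose := by
    have := congrArg Matrix.transpose hpE
    simpa only [Matrix.transpose_mul, hEt, Matrix.mul_assoc] using this
  -- `r` is the part of `p` on the first `l` blocks, completed by the identity. Block triangularity
  -- of `p` and `q` makes the analogous `r'` its inverse.
  set r := p * E + (1 - E) with hr
  set r' := q * E + (1 - E) with hr'
  have hrr' : r * r' = 1 := by
    have h1 : p * (q * E) = E := by rw [← Matrix.mul_assoc, hpq, Matrix.one_mul]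
    simp only [hr, hr', mul_add, add_mul, mul_sub, sub_mul, Matrix.mul_assoc, hE, hqE, h1,
      Matrix.mul_one, Matrix.one_mul]
    abel
  -- The Gram matrix of the first columns of `g` is singular on ℝⁿ in general; the summand 1 − E
  -- makes it invertible without affecting the final product, which is flanked by E.
  have hM : E * g.transpose * g * E + (1 - E) = r.transpose * r := by
    have h1 : g.transpose * (g * E) = p.transpose * (p * E) := by
      rw [hgp, Matrix.transpose_mul]
      simp only [Matrix.mul_assoc]
      rw [← Matrix.mul_assoc Ψ.transpose Ψ, hΨ, Matrix.one_mul]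
    simp only [hr, Matrix.transpose_add, Matrix.transpose_sub, Matrix.transpose_mul,
      Matrix.transpose_one, hEt, mul_add, add_mul, mul_sub, sub_mul, Matrix.mul_assoc, hE, hpE,
      hpE', h1, Matrix.mul_one, Matrix.one_mul]
    abel
  have hinv : (E * g.transpose * g * E + (1 - E)) * (r' * r'.transpose) = 1 := by
    rw [hM, Matrix.mul_assoc, ← Matrix.mul_assoc r, hrr', Matrix.one_mul, ← Matrix.transpose_mul,
      mul_eq_one_comm.mp hrr', Matrix.transpose_one]
  refine ⟨Matrix.isUnit_det_of_right_inverse hinv, ?_⟩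
  have hgE : g * E = Ψ * E * r := by
    simp only [hr, mul_add, mul_sub, Matrix.mul_assoc, hE, hpE, Matrix.mul_one, sub_self,
      add_zero]
    rw [← Matrix.mul_assoc, ← hgp]
  have hgE' : E * g.transpose = r.transpose * (E * Ψ.transpose) := by
    have := congrArg Matrix.transpose hgE
    simpa only [Matrix.transpose_mul, hEt, Matrix.mul_assoc] using this
  rw [Matrix.inv_eq_right_inv hinv, Matrix.mul_assoc _ E, hgE, hgE']
  have h2 : r'.transpose * r.transpose = 1 := by
    rw [← Matrix.transpose_mul, hrr', Matrix.transpose_one]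
  calc spec c (firstBlocks c l) (flagOfMatrix c g) = Ψ * (E * E) * Ψ.transpose := by
        rw [hE]; rfl
    _ = Ψ * E * (r * r') * (r'.transpose * r.transpose) * (E * Ψ.transpose) := by
        rw [hrr', h2]; simp only [Matrix.mul_assoc, Matrix.mul_one]
    _ = _ := by simp only [Matrix.mul_assoc]

/-- `frame` is chosen without any continuity, so smoothness has to come from the Gram formula, which
involves only products, a transpose and one matrix inverse. -/
theorem contDiffAt_spec_firstBlocks {n : ℕ} (c : Composition n) (l : ℕ)
    {g : Matrix (Fin n) (Fin n) ℝ} (hg : IsUnit g.det) :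
    ContDiffAt ℝ ∞ (fun h => spec c (firstBlocks c l) (flagOfMatrix c h)) g := by
  set E := blockDiag c (firstBlocks c l)
  have h1 : ContDiff ℝ ∞ fun h : Matrix (Fin n) (Fin n) ℝ =>
      E * h.transpose * h * E + (1 - E) :=
    (((contDiff_const.mul contDiff_transpose).mul contDiff_id).mul contDiff_const).add
      contDiff_const
  have h2 : ContDiffAt ℝ ∞ (fun h : Matrix (Fin n) (Fin n) ℝ =>
      (E * h.transpose * h * E + (1 - E))⁻¹) g :=
    (contDiffAt_matrix_inv (spec_firstBlocks c l hg).1).comp g h1.contDiffAt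
  have h3 : ContDiffAt ℝ ∞ (fun h : Matrix (Fin n) (Fin n) ℝ =>
      h * E * (E * h.transpose * h * E + (1 - E))⁻¹ * E * h.transpose) g :=
    (((contDiffAt_id.mul contDiffAt_const).mul h2).mul contDiffAt_const).mul
      contDiff_transpose.contDiffAt
  refine h3.congr_of_eventuallyEq ?_
  filter_upwards [(isOpen_isUnit_det n).mem_nhds hg] with h hh
  exact (spec_firstBlocks c l hh).2

/-- The projection onto one summand is the difference of the projections onto consecutive V_l, so
smoothness of the latter is enough. -/
theorem single_eq_firstBlocks_sub {n : ℕ} (c : Composition n) (j : Fin c.length) :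
    (Pi.single j 1 : Fin c.length → ℝ) = firstBlocks c (j + 1) - firstBlocks c j := by
  funext i
  simp only [Pi.sub_apply, firstBlocks, Pi.single_apply, Fin.ext_iff]
  split_ifs <;> first | omega | simp

theorem contDiffAt_spec {n : ℕ} (c : Composition n) (f : Fin c.length → ℝ)
    {g : Matrix (Fin n) (Fin n) ℝ} (hg : IsUnit g.det) :
    ContDiffAt ℝ ∞ (fun h => spec c f (flagOfMatrix c h)) g := by
  simp only [fun x => spec_eq_sum c f x, eproj, single_eq_firstBlocks_sub, spec_sub]
  exact ContDiffAt.sum fun j _ => ((contDiffAt_spec_firstBlocks c _ hg).sub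
    (contDiffAt_spec_firstBlocks c _ hg)).const_smul _

/-! ### Smoothness of the projection from GL(n) and of its local sections -/

theorem contMDiffAt_flagOfMatrix {n : ℕ} (c : Composition n) {g : Matrix (Fin n) (Fin n) ℝ}
    (hg : IsUnit g.det) :
    ContMDiffAt 𝓘(ℝ, Matrix (Fin n) (Fin n) ℝ) 𝓘(ℝ, Cell c) ∞ (flagOfMatrix c) g := by
  rw [contMDiffAt_iff]
  have hc : ContinuousOn (flagOfMatrix c) {g | IsUnit g.det} := by
    rw [continuousOn_iff_continuous_domRestrict]
    exact (isQuotientMap_flag c).continuous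
  refine ⟨hc.continuousAt ((isOpen_isUnit_det n).mem_nhds hg), ?_⟩
  have := (isSmoothChart_cellChart c (exists_flagOfMatrix_eq c (flagOfMatrix c g)).choose
    (exists_flagOfMatrix_eq c (flagOfMatrix c g)).choose_spec.1).1 g hg
    (mem_chart_source (Cell c) (flagOfMatrix c g))
  simp only [mfld_simps, Function.comp_def]
  exact this.contDiffWithinAt

/-- The centre of the preferred chart at a flag. -/
noncomputable def chartBase {n : ℕ} (c : Composition n) (x : PartialFlag c) :
    Matrix (Fin n) (Fin n) ℝ := (exists_flagOfMatrix_eq c x).choose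

theorem isUnit_chartBase {n : ℕ} (c : Composition n) (x : PartialFlag c) :
    IsUnit (chartBase c x).det := (exists_flagOfMatrix_eq c x).choose_spec.1

theorem contDiff_unip {n : ℕ} (c : Composition n) : ContDiff ℝ ∞ (unip c) :=
  contDiff_const.add (lower c).contDiff

/-- The local section of `GL(n) → Fl` given by the preferred chart. -/
noncomputable def chartSection {n : ℕ} (c : Composition n) (x y : PartialFlag c) :
    Matrix (Fin n) (Fin n) ℝ := chartBase c x * unip c (chartAt (Cell c) x y)

theorem isUnit_chartSection {n : ℕ} (c : Composition n) (x y : PartialFlag c) :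
    IsUnit (chartSection c x y).det := isUnit_det_mul_unip c (isUnit_chartBase c x) _

theorem flagOfMatrix_chartSection {n : ℕ} (c : Composition n) {x y : PartialFlag c}
    (hy : y ∈ (chartAt (Cell c) x).source) : flagOfMatrix c (chartSection c x y) = y :=
  (chartAt (Cell c) x).left_inv hy

theorem contMDiffAt_chartSection {n : ℕ} (c : Composition n) (x : PartialFlag c) :
    ContMDiffAt 𝓘(ℝ, Cell c) 𝓘(ℝ, Matrix (Fin n) (Fin n) ℝ) ∞ (chartSection c x) x := by
  have h1 : ContMDiffAt 𝓘(ℝ, Cell c) 𝓘(ℝ, Cell c) ∞ (chartAt (Cell c) x) x :=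
    contMDiffAt_extChartAt
  have h2 : ContDiff ℝ ∞ fun X : Cell c => chartBase c x * unip c X :=
    contDiff_const.mul (contDiff_unip c)
  exact h2.contMDiff.contMDiffAt.comp x h1

theorem eventually_flagOfMatrix_chartSection {n : ℕ} (c : Composition n) (x : PartialFlag c) :
    ∀ᶠ y in 𝓝 x, flagOfMatrix c (chartSection c x y) = y := by
  filter_upwards [(chartAt (Cell c) x).open_source.mem_nhds (mem_chart_source _ x)] with y hy
  exact flagOfMatrix_chartSection c hy

/-- A function on the flag manifold is smooth if its pull-back to `GL(n)` is. -/
theorem contMDiff_of_comp_flagOfMatrix {n : ℕ} (c : Composition n) {V : Type*}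
    [NormedAddCommGroup V] [NormedSpace ℝ V] {f : PartialFlag c → V}
    (hf : ∀ g : Matrix (Fin n) (Fin n) ℝ, IsUnit g.det →
      ContDiffAt ℝ ∞ (fun h => f (flagOfMatrix c h)) g) :
    ContMDiff 𝓘(ℝ, Cell c) 𝓘(ℝ, V) ∞ f := by
  intro x
  have h1 := (hf _ (isUnit_chartSection c x x)).contMDiffAt.comp x (contMDiffAt_chartSection c x)
  refine h1.congr_of_eventuallyEq ?_
  filter_upwards [eventually_flagOfMatrix_chartSection c x] with y hy
  simp [hy]

theorem contMDiff_spec {n : ℕ} (c : Composition n) (f : Fin c.length → ℝ) :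
    ContMDiff 𝓘(ℝ, Cell c) 𝓘(ℝ, Matrix (Fin n) (Fin n) ℝ) ∞ (spec c f) :=
  contMDiff_of_comp_flagOfMatrix c fun _ hg => contDiffAt_spec c f hg

/-! ### Isospectral symmetric matrices and flags -/

/-- The span of the standard basis vectors of one block. -/
def blockSub {n : ℕ} (c : Composition n) (j : Fin c.length) : Submodule ℝ (Fin n → ℝ) where
  carrier := {v | ∀ a : Fin n, c.index a ≠ j → v a = 0}
  add_mem' hv hw a ha := by simp [hv a ha, hw a ha]
  zero_mem' a _ := rfl
  smul_mem' r v hv a ha := by simp [hv a ha]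

theorem finrank_blockSub {n : ℕ} (c : Composition n) (j : Fin c.length) :
    Module.finrank ℝ (blockSub c j) = c.blocksFun j := by
  classical
  let I : Set (Fin n) := {a | c.index a = j}
  let J : Set (Fin n) := {a | c.index a ≠ j}
  have hIJ : Disjoint I J := Set.disjoint_left.mpr fun a ha hb => hb ha
  have hu : Set.univ ⊆ I ∪ J := fun a _ => em (c.index a = j)
  have e := LinearMap.iInfKerProjEquiv ℝ (fun _ : Fin n => ℝ) hIJ hu
  have hs : blockSub c j = ⨅ i ∈ J, (LinearMap.proj i : (Fin n → ℝ) →ₗ[ℝ] ℝ).ker := by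
    ext v
    simp [blockSub, J]
  rw [hs, e.finrank_eq, Module.finrank_fintype_fun_eq_card]
  have hI : I = Set.range (c.embedding j) := by
    ext a
    rw [c.mem_range_embedding_iff']
    exact eq_comm
  rw [← Nat.card_eq_fintype_card, hI, Nat.card_range_of_injective (c.embedding j).injective]
  simp

theorem eigenspace_conj {n : ℕ} (c : Composition n) {lam : Fin c.length → ℝ}
    (hlam : Function.Injective lam) {Ψ : Matrix (Fin n) (Fin n) ℝ} (hΨ : Ψ.transpose * Ψ = 1)
    (j : Fin c.length) :
    Module.End.eigenspace (Matrix.toLin' (Ψ * eigMatrix c lam * Ψ.transpose)) (lam j)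
      = (blockSub c j).map Ψ.mulVecLin := by
  have hΨ' : Ψ * Ψ.transpose = 1 := mul_eq_one_comm.mp hΨ
  ext v
  rw [Module.End.mem_eigenspace_iff, Matrix.toLin'_apply]
  constructor
  · intro hv
    refine ⟨Ψ.transpose.mulVec v, fun a ha => ?_, ?_⟩
    · have h1 := congrArg Ψ.transpose.mulVec hv
      rw [Matrix.mulVec_mulVec, Matrix.mul_assoc, ← Matrix.mul_assoc, hΨ, Matrix.one_mul,
        ← Matrix.mulVec_mulVec, Matrix.mulVec_smul] at h1
      have h2 := congrFun h1 a
      rw [eigMatrix, Matrix.mulVec_diagonal, Pi.smul_apply, smul_eq_mul] at h2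
      by_contra h0
      exact ha (hlam (mul_right_cancel₀ h0 h2))
    · rw [Matrix.mulVecLin_apply, Matrix.mulVec_mulVec, hΨ', Matrix.one_mulVec]
  · rintro ⟨w, hw, rfl⟩
    rw [Matrix.mulVecLin_apply, Matrix.mulVec_mulVec, Matrix.mul_assoc, hΨ, Matrix.mul_one,
      ← Matrix.mulVec_mulVec, ← Matrix.mulVec_smul]
    congr 1
    funext a
    rw [eigMatrix, Matrix.mulVec_diagonal, Pi.smul_apply, smul_eq_mul]
    by_cases ha : c.index a = j
    · rw [ha]
    · rw [hw a ha]; simp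

theorem conj_mem_isospectralSymm {n : ℕ} (c : Composition n) {lam : Fin c.length → ℝ}
    (hlam : Function.Injective lam) {Ψ : Matrix (Fin n) (Fin n) ℝ}
    (hΨ : Ψ.transpose * Ψ = 1) :
    Ψ * eigMatrix c lam * Ψ.transpose ∈ IsospectralSymm c lam := by
  refine ⟨?_, fun j => ?_⟩
  · rw [Matrix.IsSymm]
    simp [eigMatrix, Matrix.mul_assoc]
  · have hinj : Function.Injective Ψ.mulVecLin := Matrix.mulVec_injective_of_isUnit
      ((Matrix.isUnit_iff_isUnit_det Ψ).mpr (isUnit_det_of_transpose_mul hΨ))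
    rw [eigenspace_conj c hlam hΨ, ← (Submodule.equivMapOfInjective _ hinj _).finrank_eq,
      finrank_blockSub]

theorem stdSub_eq_iSup {n : ℕ} (c : Composition n) (l : ℕ) :
    stdSub c l ≤ ⨆ j : Fin c.length, ⨆ _ : (j : ℕ) < l, blockSub c j := by
  intro v hv
  rw [pi_eq_sum_univ' v]
  refine Submodule.sum_mem _ fun a _ => ?_
  by_cases ha : (c.index a : ℕ) < l
  · refine Submodule.smul_mem _ _ (Submodule.mem_iSup_of_mem (c.index a)
      (Submodule.mem_iSup_of_mem ha ?_))
    intro b hb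
    have : a ≠ b := by rintro rfl; exact hb rfl
    simp [this]
  · rw [hv a ((sizeUpTo_le_iff c l a).mpr (not_lt.mp ha)), zero_smul]
    exact Submodule.zero_mem _

/-- One inclusion is checked; the prescribed dimensions turn it into an equality. -/
theorem eigenFlag_conj {n : ℕ} (c : Composition n) {lam : Fin c.length → ℝ}
    (hlam : StrictMono lam) {Ψ : Matrix (Fin n) (Fin n) ℝ} (hΨ : Ψ.transpose * Ψ = 1)
    (h : Ψ * eigMatrix c lam * Ψ.transpose ∈ IsospectralSymm c lam) :
    eigenFlag c hlam ⟨Ψ * eigMatrix c lam * Ψ.transpose, h⟩ = flagOfMatrix c Ψ := by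
  refine PartialFlag.ext (funext fun l => Eq.symm (Submodule.eq_of_le_of_finrank_eq ?_ ?_))
  · rw [flagOfMatrix_V c (isUnit_det_of_transpose_mul hΨ)]
    refine (Submodule.map_mono (stdSub_eq_iSup c l)).trans ?_
    simp only [Submodule.map_iSup, eigenFlag, eigSub, eigenspace_conj c hlam.injective hΨ, le_refl]
  · rw [PartialFlag.finrank_eq, PartialFlag.finrank_eq]

/-- `L - λ_j` maps `V_{j+1}` to `V_j`. -/
theorem mulVec_sub_mem_eigSub {n k : ℕ} (lam : Fin k → ℝ) (L : Matrix (Fin n) (Fin n) ℝ)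
    (j : Fin k) {v : Fin n → ℝ} (hv : v ∈ eigSub lam L (j + 1)) :
    L.mulVec v - lam j • v ∈ eigSub lam L j := by
  have h : eigSub lam L (j + 1) ≤
      (eigSub lam L j).comap (L.mulVecLin - lam j • LinearMap.id) := by
    refine iSup_le fun i => iSup_le fun hi v hv => ?_
    have hv' : L.mulVec v = lam i • v := Module.End.mem_eigenspace_iff.mp hv
    rw [Submodule.mem_comap]
    simp only [LinearMap.sub_apply, Matrix.mulVecLin_apply, LinearMap.smul_apply,
      LinearMap.id_coe, id_eq, hv']
    rcases Nat.lt_succ_iff_lt_or_eq.mp hi with h1 | h1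
    · rw [← sub_smul]
      exact Submodule.smul_mem _ _ (Submodule.mem_iSup_of_mem i (Submodule.mem_iSup_of_mem h1 hv))
    · rw [Fin.ext h1, sub_self]
      exact Submodule.zero_mem _
  exact h hv

/-- In the frame Ψ, the inclusions (L − λ_j)V_{j+1} ⊂ V_j determine the entries of ΨᵀLΨ on and below
the block diagonal, where it agrees with Λ. Symmetry determines the rest. -/
theorem eq_conj_of_flagOfMatrix_eq_eigenFlag {n : ℕ} (c : Composition n)
    {lam : Fin c.length → ℝ} (hlam : StrictMono lam) (L : IsospectralSymm c lam)
    {Ψ : Matrix (Fin n) (Fin n) ℝ} (hΨ : Ψ.transpose * Ψ = 1)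
    (h : flagOfMatrix c Ψ = eigenFlag c hlam L) :
    L.1 = Ψ * eigMatrix c lam * Ψ.transpose := by
  have hΨ' : Ψ * Ψ.transpose = 1 := mul_eq_one_comm.mp hΨ
  set T := Ψ.transpose * L.1 * Ψ with hT
  have hsymm : T.transpose = T := by
    have : L.1.transpose = L.1 := L.2.1
    simp [hT, this, Matrix.mul_assoc]
  have hV : ∀ l < c.length + 1, eigSub lam L.1 l = (stdSub c l).map Ψ.mulVecLin := by
    intro l hl
    rw [← flagOfMatrix_V c (isUnit_det_of_transpose_mul hΨ) ⟨l, hl⟩, h]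
    rfl
  have hle : ∀ a b : Fin n, c.index b ≤ c.index a → T a b = eigMatrix c lam a b := by
    intro a b hab
    set j := c.index b
    have hb : Pi.single b (1 : ℝ) ∈ stdSub c (j + 1) := by
      intro d hd
      rw [sizeUpTo_le_iff] at hd
      have : d ≠ b := by rintro rfl; simp [j] at hd
      simp [this]
    have h1 := mulVec_sub_mem_eigSub lam L.1 j (v := Ψ.mulVec (Pi.single b 1)) (by
      rw [hV (j + 1) (by omega)]; exact ⟨_, hb, rfl⟩)
    rw [hV j (by omega)] at h1
    obtain ⟨w, hw, hw'⟩ := h1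
    have h2 : w = T.mulVec (Pi.single b 1) - lam j • Pi.single b 1 := by
      have := congrArg Ψ.transpose.mulVec hw'
      rw [Matrix.mulVecLin_apply, Matrix.mulVec_mulVec, hΨ, Matrix.one_mulVec, Matrix.mulVec_sub,
        Matrix.mulVec_smul, Matrix.mulVec_mulVec, Matrix.mulVec_mulVec, Matrix.mulVec_mulVec, hΨ,
        Matrix.one_mulVec] at this
      exact this
    have h3 := hw a ((sizeUpTo_le_iff c _ a).mpr hab)
    rw [h2] at h3
    simp only [Matrix.mulVec_single_one, Pi.sub_apply, Matrix.col_apply, Pi.smul_apply,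
      smul_eq_mul, Pi.single_apply] at h3
    rw [sub_eq_zero.mp h3, eigMatrix, Matrix.diagonal_apply]
    by_cases hab' : a = b
    · subst hab'; simp [j]
    · simp [hab']
  have hTΛ : T = eigMatrix c lam := by
    ext a b
    rcases le_total (c.index b) (c.index a) with h1 | h1
    · exact hle a b h1
    · rw [← hsymm, Matrix.transpose_apply, hle b a h1, eigMatrix, Matrix.diagonal_apply,
        Matrix.diagonal_apply]
      by_cases hab : a = b
      · subst hab; rfl
      · simp [hab, Ne.symm hab]
  rw [← hTΛ, hT]
  calc L.1 = (Ψ * Ψ.transpose) * L.1 * (Ψ * Ψ.transpose) := by rw [hΨ']; simp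
    _ = _ := by simp only [Matrix.mul_assoc]

theorem spec_eigenFlag {n : ℕ} (c : Composition n) {lam : Fin c.length → ℝ}
    (hlam : StrictMono lam) (L : IsospectralSymm c lam) :
    spec c lam (eigenFlag c hlam L) = L.1 :=
  (eq_conj_of_flagOfMatrix_eq_eigenFlag c hlam L (frame_orth c _) (flagOfMatrix_frame c _)).symm

theorem spec_mem_isospectralSymm {n : ℕ} (c : Composition n) {lam : Fin c.length → ℝ}
    (hlam : Function.Injective lam) (x : PartialFlag c) :
    spec c lam x ∈ IsospectralSymm c lam := conj_mem_isospectralSymm c hlam (frame_orth c x)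

theorem eigenFlag_spec {n : ℕ} (c : Composition n) {lam : Fin c.length → ℝ}
    (hlam : StrictMono lam) (x : PartialFlag c) :
    eigenFlag c hlam ⟨spec c lam x, spec_mem_isospectralSymm c hlam.injective x⟩ = x :=
  (eigenFlag_conj c hlam (frame_orth c x) _).trans (flagOfMatrix_frame c x)

theorem spec_injective {n : ℕ} (c : Composition n) {lam : Fin c.length → ℝ}
    (hlam : StrictMono lam) : Function.Injective (spec c lam) := by
  intro x y h
  rw [← eigenFlag_spec c hlam x, ← eigenFlag_spec c hlam y]
  congr 2

theorem eigenFlag_bijective {n : ℕ} (c : Composition n) {lam : Fin c.length → ℝ}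
    (hlam : StrictMono lam) : Function.Bijective (eigenFlag c hlam) := by
  refine ⟨fun L L' h => Subtype.ext ?_, fun x => ⟨_, eigenFlag_spec c hlam x⟩⟩
  rw [← spec_eigenFlag c hlam L, ← spec_eigenFlag c hlam L', h]

/-! ### Differentials on the flag manifold -/

theorem mdifferentiableAt_flagOfMatrix {n : ℕ} (c : Composition n)
    {g : Matrix (Fin n) (Fin n) ℝ} (hg : IsUnit g.det) :
    MDifferentiableAt 𝓘(ℝ, Matrix (Fin n) (Fin n) ℝ) 𝓘(ℝ, Cell c) (flagOfMatrix c) g :=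
  (contMDiffAt_flagOfMatrix c hg).mdifferentiableAt (by simp)

/-- The differential of the projection `GL(n) → Fl`. -/
noncomputable def mflag {n : ℕ} (c : Composition n) (g : Matrix (Fin n) (Fin n) ℝ) :
    Matrix (Fin n) (Fin n) ℝ →L[ℝ] Cell c :=
  mfderiv 𝓘(ℝ, Matrix (Fin n) (Fin n) ℝ) 𝓘(ℝ, Cell c) (flagOfMatrix c) g

theorem hasMFDerivAt_flagOfMatrix {n : ℕ} (c : Composition n)
    {g : Matrix (Fin n) (Fin n) ℝ} (hg : IsUnit g.det) :
    HasMFDerivAt 𝓘(ℝ, Matrix (Fin n) (Fin n) ℝ) 𝓘(ℝ, Cell c) (flagOfMatrix c) g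
      (mflag c g) := (mdifferentiableAt_flagOfMatrix c hg).hasMFDerivAt

theorem hasMFDerivAt_flagOfMatrix_comp {n : ℕ} (c : Composition n)
    {γ : ℝ → Matrix (Fin n) (Fin n) ℝ} {W : Matrix (Fin n) (Fin n) ℝ} {t : ℝ}
    (hγ : HasDerivAt γ W t) (hu : IsUnit (γ t).det) :
    HasMFDerivAt 𝓘(ℝ, ℝ) 𝓘(ℝ, Cell c) (fun s => flagOfMatrix c (γ s)) t
      ((1 : ℝ →L[ℝ] ℝ).smulRight (mflag c (γ t) W : Cell c)) := by
  have h1 := (hasMFDerivAt_flagOfMatrix c hu).comp t hγ.hasFDerivAt.hasMFDerivAt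
  refine h1.congr_mfderiv ?_
  have h2 : ∀ r : ℝ, mflag c (γ t) (r • W) = r • mflag c (γ t) W := fun r => map_smul _ r W
  exact ContinuousLinearMap.ext fun r => h2 r

theorem dflag_eq_mflag {n : ℕ} (c : Composition n) {g : Matrix (Fin n) (Fin n) ℝ}
    (hg : IsUnit g.det) (W : Matrix (Fin n) (Fin n) ℝ) :
    (dflag c g W : Cell c) = mflag c g W := by
  have h0 : g + (0 : ℝ) • W = g := by simp
  have h1 : HasDerivAt (fun t : ℝ => g + t • W) W 0 := by
    simpa using ((hasDerivAt_id (0 : ℝ)).smul_const W).const_add g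
  have h2 := (hasMFDerivAt_flagOfMatrix_comp c h1 (by rw [h0]; exact hg)).mfderiv
  have h3 : (dflag c g W : Cell c) = ((1 : ℝ →L[ℝ] ℝ).smulRight
      (mflag c (g + (0 : ℝ) • W) W : Cell c)) 1 := congrArg (fun T : ℝ →L[ℝ] Cell c => T 1) h2
  rw [h3, h0]
  exact one_smul ℝ (mflag c g W)

theorem flagOfMatrix_mul_left {n : ℕ} (c : Composition n) {g h u : Matrix (Fin n) (Fin n) ℝ}
    (hg : IsUnit g.det) (hh : IsUnit h.det) (hu : IsUnit u.det)
    (e : flagOfMatrix c g = flagOfMatrix c h) :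
    flagOfMatrix c (u * g) = flagOfMatrix c (u * h) := by
  refine PartialFlag.ext (funext fun l => ?_)
  have h1 : (flagOfMatrix c g).V l = (flagOfMatrix c h).V l := by rw [e]
  rw [flagOfMatrix_V c hg, flagOfMatrix_V c hh] at h1
  rw [flagOfMatrix_V c (by rw [Matrix.det_mul]; exact hu.mul hg),
    flagOfMatrix_V c (by rw [Matrix.det_mul]; exact hu.mul hh), Matrix.mulVecLin_mul,
    Matrix.mulVecLin_mul, Submodule.map_comp, Submodule.map_comp, h1]

/-- The vector field on `Fl` generated by the left action of a matrix is well-defined. -/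
theorem mflag_mul_left {n : ℕ} (c : Composition n) {g h : Matrix (Fin n) (Fin n) ℝ}
    (hg : IsUnit g.det) (hh : IsUnit h.det) (e : flagOfMatrix c g = flagOfMatrix c h)
    (B : Matrix (Fin n) (Fin n) ℝ) : mflag c g (B * g) = mflag c h (B * h) := by
  have key : ∀ k : Matrix (Fin n) (Fin n) ℝ, IsUnit k.det → mflag c k (B * k)
      = (mfderiv 𝓘(ℝ, ℝ) 𝓘(ℝ, Cell c) (fun t : ℝ => flagOfMatrix c ((1 + t • B) * k)) 0 :
        ℝ →L[ℝ] Cell c) 1 := by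
    intro k hk
    rw [← dflag_eq_mflag c hk]
    have e : (fun t : ℝ => flagOfMatrix c (k + t • (B * k)))
        = fun t : ℝ => flagOfMatrix c ((1 + t • B) * k) := by
      simp only [add_mul, one_mul, Matrix.smul_mul]
    exact congrArg (fun γ : ℝ → PartialFlag c =>
      (mfderiv 𝓘(ℝ, ℝ) 𝓘(ℝ, Cell c) γ 0 : ℝ →L[ℝ] Cell c) 1) e
  rw [key g hg, key h hh]
  -- For small `t` the matrix 1 + tB is invertible and so carries equal flags to equal flags; the
  -- two curves have the same germ and the same velocity.
  have hev : (fun t : ℝ => flagOfMatrix c ((1 + t • B) * g)) =ᶠ[𝓝 0]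
      fun t : ℝ => flagOfMatrix c ((1 + t • B) * h) := by
    have hc : Continuous fun t : ℝ => 1 + t • B := by fun_prop
    have : ∀ᶠ t in 𝓝 (0 : ℝ), IsUnit (1 + t • B).det :=
      hc.continuousAt.eventually ((isOpen_isUnit_det n).mem_nhds (by simp))
    filter_upwards [this] with t ht
    exact flagOfMatrix_mul_left c hg hh ht e
  exact congrArg (fun T : ℝ →L[ℝ] Cell c => T 1) hev.mfderiv_eq

/-- The differential of `spec`. -/
noncomputable def dspec {n : ℕ} (c : Composition n) (f : Fin c.length → ℝ) (x : PartialFlag c) :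
    Cell c →L[ℝ] Matrix (Fin n) (Fin n) ℝ :=
  mfderiv 𝓘(ℝ, Cell c) 𝓘(ℝ, Matrix (Fin n) (Fin n) ℝ) (spec c f) x

theorem hasMFDerivAt_spec {n : ℕ} (c : Composition n) (f : Fin c.length → ℝ)
    (x : PartialFlag c) :
    HasMFDerivAt 𝓘(ℝ, Cell c) 𝓘(ℝ, Matrix (Fin n) (Fin n) ℝ) (spec c f) x (dspec c f x) :=
  ((contMDiff_spec c f).mdifferentiable (by simp) x).hasMFDerivAt

theorem hasFDerivAt_of_hasMFDerivAt {n : ℕ} {c : Composition n} {V : Type*}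
    [NormedAddCommGroup V] [NormedSpace ℝ V] {f : PartialFlag c → V} {x : PartialFlag c}
    {f' : Cell c →L[ℝ] V} (h : HasMFDerivAt 𝓘(ℝ, Cell c) 𝓘(ℝ, V) f x f') :
    HasFDerivAt (fun X => f ((chartAt (Cell c) x).symm X)) f' (chartAt (Cell c) x x) := by
  have := h.2
  simp only [mfld_simps, writtenInExtChartAt] at this
  exact hasFDerivWithinAt_univ.mp this

theorem hasFDerivAt_spec {n : ℕ} (c : Composition n) (f : Fin c.length → ℝ)
    (x : PartialFlag c) :
    HasFDerivAt (fun X => spec c f ((chartAt (Cell c) x).symm X)) (dspec c f x)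
      (chartAt (Cell c) x x) := hasFDerivAt_of_hasMFDerivAt (hasMFDerivAt_spec c f x)

theorem chartAt_symm_chartAt {n : ℕ} (c : Composition n) (x : PartialFlag c) :
    (chartAt (Cell c) x).symm (chartAt (Cell c) x x) = x :=
  (chartAt (Cell c) x).left_inv (mem_chart_source _ x)

/-- Leibniz rule for the identity `spec_mul`. It lets the algebraic relations between L and its
spectral projections be differentiated. -/
theorem dspec_mul {n : ℕ} (c : Composition n) (f h : Fin c.length → ℝ) (x : PartialFlag c)
    (v : Cell c) :
    dspec c (f * h) x v = dspec c f x v * spec c h x + spec c f x * dspec c h x v := by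
  have h1 := (hasFDerivAt_spec c f x).mul' (hasFDerivAt_spec c h x)
  have h2 := hasFDerivAt_spec c (f * h) x
  simp only [← spec_mul] at h2
  have := congrArg (fun T : Cell c →L[ℝ] Matrix (Fin n) (Fin n) ℝ => T v) (h2.unique h1)
  simp only [chartAt_symm_chartAt] at this
  rw [this, add_comm]
  rfl

theorem dspec_smul {n : ℕ} (c : Composition n) (r : ℝ) (f : Fin c.length → ℝ)
    (x : PartialFlag c) (v : Cell c) : dspec c (r • f) x v = r • dspec c f x v := by
  have h1 := (hasFDerivAt_spec c f x).const_smul r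
  have h2 := hasFDerivAt_spec c (r • f) x
  simp only [spec_smul] at h2
  exact congrArg (fun T : Cell c →L[ℝ] Matrix (Fin n) (Fin n) ℝ => T v) (h2.unique h1)

theorem dspec_transpose {n : ℕ} (c : Composition n) (f : Fin c.length → ℝ)
    (x : PartialFlag c) (v : Cell c) : (dspec c f x v).transpose = dspec c f x v := by
  have h1 := (transposeL n).hasFDerivAt.comp _ (hasFDerivAt_spec c f x)
  have h2 : (transposeL n) ∘ (fun X => spec c f ((chartAt (Cell c) x).symm X))
      = fun X => spec c f ((chartAt (Cell c) x).symm X) := by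
    funext X; exact spec_transpose c f _
  rw [h2] at h1
  exact congrArg (fun T : Cell c →L[ℝ] Matrix (Fin n) (Fin n) ℝ => T v)
    (h1.unique (hasFDerivAt_spec c f x))

theorem mul_single_one {k : ℕ} (f : Fin k → ℝ) (j : Fin k) :
    f * Pi.single j 1 = f j • (Pi.single j 1 : Fin k → ℝ) := by
  funext i
  by_cases h : i = j
  · subst h; simp
  · simp [h]

/-- `dL` is orthogonal to the centralizer of `L`. -/
theorem eproj_mul_dspec_mul_eproj {n : ℕ} (c : Composition n) (f : Fin c.length → ℝ)
    (j : Fin c.length) (x : PartialFlag c) (v : Cell c) :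
    eproj c j x * dspec c f x v * eproj c j x = 0 := by
  -- Let P_j be the spectral projection. Differentiating L P_j = f_j P_j and multiplying by P_j on
  -- the left produces f_j P_j dP_j on both sides; what remains is P_j dL P_j = 0.
  have h := dspec_mul c f (Pi.single j 1) x v
  rw [mul_single_one, dspec_smul] at h
  have h1 := congrArg (eproj c j x * ·) h
  simp only [mul_add, ← Matrix.mul_assoc, eproj_mul_spec, Matrix.mul_smul,
    Matrix.smul_mul] at h1
  exact right_eq_add.mp h1

theorem sandwich_eq_zero {n : ℕ} (c : Composition n) (x : PartialFlag c)
    {S : Matrix (Fin n) (Fin n) ℝ} (h : ∀ i j, eproj c i x * S * eproj c j x = 0) : S = 0 := by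
  calc S = (∑ i, eproj c i x) * S * ∑ j, eproj c j x := by rw [sum_eproj]; simp
    _ = 0 := by simp only [Finset.sum_mul, Finset.mul_sum, h, Finset.sum_const_zero]

/-- Every `spec c f` commutes with L. If dL v = 0, differentiating this relation shows that the
derivative of `spec c f` commutes with L, so its off-diagonal spectral blocks vanish because the
eigenvalues are distinct. The diagonal blocks always vanish. -/
theorem dspec_eq_zero_of {n : ℕ} (c : Composition n) {lam : Fin c.length → ℝ}
    (hlam : Function.Injective lam) {x : PartialFlag c} {v : Cell c}
    (h : dspec c lam x v = 0) (f : Fin c.length → ℝ) : dspec c f x v = 0 := by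
  refine sandwich_eq_zero c x fun i j => ?_
  by_cases hij : i = j
  · subst hij; exact eproj_mul_dspec_mul_eproj c f i x v
  · have h1 := dspec_mul c lam f x v
    have h2 := dspec_mul c f lam x v
    rw [mul_comm f lam, h1, h, zero_mul, mul_zero, zero_add, add_zero] at h2
    have h3 := congrArg (fun T => eproj c i x * T * eproj c j x) h2
    rw [← Matrix.mul_assoc, eproj_mul_spec, Matrix.mul_assoc _ (dspec c f x v * _),
      Matrix.mul_assoc _ (spec c lam x), spec_mul_eproj] at h3
    simp only [Matrix.smul_mul, Matrix.mul_smul, ← Matrix.mul_assoc] at h3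
    have h4 : (lam i - lam j) • (eproj c i x * dspec c f x v * eproj c j x) = 0 := by
      rw [sub_smul, h3, sub_self]
    exact (smul_eq_zero.mp h4).resolve_left (sub_ne_zero.mpr fun h => hij (hlam h))

/-! ### A section built from the projections, and the immersion property -/

/-- A local section of `GL(n) → Fl` that depends on the flag only through the projections. -/
noncomputable def projSection {n : ℕ} (c : Composition n) (g : Matrix (Fin n) (Fin n) ℝ)
    (x : PartialFlag c) : Matrix (Fin n) (Fin n) ℝ :=
  ∑ j : Fin c.length, spec c (firstBlocks c (j + 1)) x * (g * blockDiag c (Pi.single j 1))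

/-- Projecting the column block `j` of `g` onto V_{j+1} erases, in frame coordinates, its entries
below the block diagonal. What is left is block upper triangular, so when invertible it represents
`x`; and nothing is erased when `x` is the flag of `g`. -/
theorem frame_transpose_mul_projSection {n : ℕ} (c : Composition n)
    (g : Matrix (Fin n) (Fin n) ℝ) (x : PartialFlag c) (a b : Fin n) :
    ((frame c x).transpose * projSection c g x) a b
      = if c.index a ≤ c.index b then ((frame c x).transpose * g) a b else 0 := by
  have h : (frame c x).transpose * projSection c g x
      = ∑ j : Fin c.length, blockDiag c (firstBlocks c (j + 1)) * ((frame c x).transpose * g) *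
          blockDiag c (Pi.single j 1) := by
    rw [projSection, Finset.mul_sum]
    refine Finset.sum_congr rfl fun j _ => ?_
    simp only [spec, ← Matrix.mul_assoc]
    rw [frame_orth, Matrix.one_mul]
  rw [h, Matrix.sum_apply]
  simp only [Matrix.mul_diagonal, Matrix.diagonal_mul, Pi.single_apply, firstBlocks, mul_ite,
    mul_one, mul_zero, Finset.sum_ite_eq, Finset.mem_univ, if_true, Order.lt_add_one_iff,
    Fin.val_fin_le, ite_mul, one_mul, zero_mul]

theorem flagOfMatrix_projSection {n : ℕ} (c : Composition n) {g : Matrix (Fin n) (Fin n) ℝ}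
    {x : PartialFlag c} (h : IsUnit (projSection c g x).det) :
    flagOfMatrix c (projSection c g x) = x := by
  have hu := isUnit_det_of_transpose_mul (frame_orth c x)
  have h1 : projSection c g x = frame c x * ((frame c x).transpose * projSection c g x) := by
    rw [← Matrix.mul_assoc, mul_eq_one_comm.mp (frame_orth c x), Matrix.one_mul]
  rw [h1, flagOfMatrix_mul c hu, flagOfMatrix_frame]
  · rw [Matrix.det_mul, Matrix.det_transpose]
    exact hu.mul h
  · intro a b hab
    rw [frame_transpose_mul_projSection, if_neg (not_le.mpr hab)]

theorem flagOfMatrix_chartBase {n : ℕ} (c : Composition n) (x : PartialFlag c) :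
    flagOfMatrix c (chartBase c x) = x := (exists_flagOfMatrix_eq c x).choose_spec.2

theorem projSection_self {n : ℕ} (c : Composition n) {g : Matrix (Fin n) (Fin n) ℝ}
    (hg : IsUnit g.det) : projSection c g (flagOfMatrix c g) = g := by
  set x := flagOfMatrix c g
  have hu := isUnit_det_of_transpose_mul (frame_orth c x)
  have h2 := blockTriangular_of_flagOfMatrix_eq c hu hg (flagOfMatrix_frame c x)
  rw [inv_eq_transpose (frame_orth c x)] at h2
  have h1 : (frame c x).transpose * projSection c g x = (frame c x).transpose * g := by
    ext a b
    rw [frame_transpose_mul_projSection]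
    split_ifs with h
    · rfl
    · exact (h2 (not_le.mp h)).symm
  have h3 := congrArg (frame c x * ·) h1
  simpa only [← Matrix.mul_assoc, mul_eq_one_comm.mp (frame_orth c x), Matrix.one_mul] using h3

theorem hasMFDerivAt_projSection {n : ℕ} (c : Composition n) (g : Matrix (Fin n) (Fin n) ℝ)
    (x : PartialFlag c) :
    HasMFDerivAt 𝓘(ℝ, Cell c) 𝓘(ℝ, Matrix (Fin n) (Fin n) ℝ) (projSection c g) x
      (∑ j : Fin c.length, ((ContinuousLinearMap.mul ℝ (Matrix (Fin n) (Fin n) ℝ)).flip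
        (g * blockDiag c (Pi.single j 1))).comp (dspec c (firstBlocks c (j + 1)) x)) := by
  have h : ∀ j : Fin c.length, HasMFDerivAt 𝓘(ℝ, Cell c) 𝓘(ℝ, Matrix (Fin n) (Fin n) ℝ)
      (fun y => spec c (firstBlocks c (j + 1)) y * (g * blockDiag c (Pi.single j 1))) x
      (((ContinuousLinearMap.mul ℝ (Matrix (Fin n) (Fin n) ℝ)).flip
        (g * blockDiag c (Pi.single j 1))).comp (dspec c (firstBlocks c (j + 1)) x)) := fun j =>
    (((ContinuousLinearMap.mul ℝ (Matrix (Fin n) (Fin n) ℝ)).flip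
      (g * blockDiag c (Pi.single j 1))).hasFDerivAt.hasMFDerivAt).comp x (hasMFDerivAt_spec c _ x)
  have e : projSection c g = ∑ j : Fin c.length, fun y =>
      spec c (firstBlocks c (j + 1)) y * (g * blockDiag c (Pi.single j 1)) := by
    funext y
    rw [Finset.sum_apply, projSection]
  rw [e]
  exact HasMFDerivAt.sum fun j _ => h j

/-- The map `x ↦ L` is an immersion. -/
theorem dspec_injective {n : ℕ} (c : Composition n) {lam : Fin c.length → ℝ}
    (hlam : Function.Injective lam) {x : PartialFlag c} {v : Cell c}
    (h : dspec c lam x v = 0) : v = 0 := by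
  have hp : projSection c (chartBase c x) x = chartBase c x := by
    have := projSection_self c (isUnit_chartBase c x)
    rwa [flagOfMatrix_chartBase] at this
  have h1 := hasMFDerivAt_projSection c (chartBase c x) x
  have hev : ∀ᶠ y in 𝓝 x, flagOfMatrix c (projSection c (chartBase c x) y) = y := by
    have : ∀ᶠ y in 𝓝 x, IsUnit (projSection c (chartBase c x) y).det :=
      h1.1.eventually ((isOpen_isUnit_det n).mem_nhds (by rw [hp]; exact isUnit_chartBase c x))
    filter_upwards [this] with y hy
    exact flagOfMatrix_projSection c hy
  have h2 := (hasMFDerivAt_flagOfMatrix c (g := projSection c (chartBase c x) x)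
    (by rw [hp]; exact isUnit_chartBase c x)).comp x h1
  -- The section followed by the projection is the identity near `x`, so its differential fixes `v`.
  -- The same differential factors through the differentials of the spectral projections, which all
  -- kill `v`.
  have h3 : HasMFDerivAt 𝓘(ℝ, Cell c) 𝓘(ℝ, Cell c)
      (flagOfMatrix c ∘ projSection c (chartBase c x)) x
      (ContinuousLinearMap.id ℝ (TangentSpace 𝓘(ℝ, Cell c) x)) :=
    (hasMFDerivAt_id x).congr_of_eventuallyEq hev
  have h4 := hasMFDerivAt_unique h2 h3
  have h5 := congrArg (fun T : Cell c →L[ℝ] Cell c => T v) h4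
  refine (Eq.symm h5).trans ?_
  change mflag c _ ((∑ j : Fin c.length, ((ContinuousLinearMap.mul ℝ
    (Matrix (Fin n) (Fin n) ℝ)).flip (chartBase c x * blockDiag c (Pi.single j 1))).comp
      (dspec c (firstBlocks c (j + 1)) x)) v) = 0
  simp [dspec_eq_zero_of c hlam h]

/-! ### Equivariance under orthogonal matrices -/

/-- An orthogonal U carries an orthogonal frame of a flag to an orthogonal frame of the image flag.
-/
theorem spec_orth_mul {n : ℕ} (c : Composition n) (f : Fin c.length → ℝ)
    {U g : Matrix (Fin n) (Fin n) ℝ} (hU : U.transpose * U = 1) (hg : IsUnit g.det) :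
    spec c f (flagOfMatrix c (U * g)) = U * spec c f (flagOfMatrix c g) * U.transpose := by
  have h1 := frame_orth c (flagOfMatrix c g)
  rw [flagOfMatrix_mul_left c hg (isUnit_det_of_transpose_mul h1)
    (isUnit_det_of_transpose_mul hU) (flagOfMatrix_frame c _).symm, spec_flagOfMatrix c f]
  · simp [spec, Matrix.mul_assoc]
  · rw [Matrix.transpose_mul, Matrix.mul_assoc, ← Matrix.mul_assoc _ U, hU, Matrix.one_mul, h1]

theorem hasDerivAt_spec_comp {n : ℕ} (c : Composition n) (f : Fin c.length → ℝ)
    {γ : ℝ → Matrix (Fin n) (Fin n) ℝ} {W : Matrix (Fin n) (Fin n) ℝ} {t : ℝ}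
    (hγ : HasDerivAt γ W t) (hu : IsUnit (γ t).det) :
    HasDerivAt (fun s => spec c f (flagOfMatrix c (γ s)))
      (dspec c f (flagOfMatrix c (γ t)) (mflag c (γ t) W)) t := by
  have h1 := (hasMFDerivAt_spec c f (flagOfMatrix c (γ t))).comp t
    (hasMFDerivAt_flagOfMatrix_comp c hγ hu)
  have h2 : HasFDerivAt (fun s => spec c f (flagOfMatrix c (γ s)))
      ((dspec c f (flagOfMatrix c (γ t))).comp
        ((1 : ℝ →L[ℝ] ℝ).smulRight (mflag c (γ t) W))) t := h1.hasFDerivAt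
  refine h2.hasDerivAt.congr_deriv ?_
  exact congrArg (dspec c f (flagOfMatrix c (γ t))) (one_smul ℝ (mflag c (γ t) W))

/-- The differential of `L` along the left action of a skew-symmetric matrix. -/
theorem dspec_mflag_skew {n : ℕ} (c : Composition n) (f : Fin c.length → ℝ)
    {g A : Matrix (Fin n) (Fin n) ℝ} (hg : IsUnit g.det) (hA : IsSkew A) :
    dspec c f (flagOfMatrix c g) (mflag c g (A * g))
      = A * spec c f (flagOfMatrix c g) - spec c f (flagOfMatrix c g) * A := by
  set S := spec c f (flagOfMatrix c g)
  -- The exponential curve stays orthogonal, unlike 1 + tA, so along it L changes exactly by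
  -- conjugation.
  have he : HasDerivAt (fun t : ℝ => NormedSpace.exp (t • A)) A 0 := by
    simpa using hasDerivAt_exp_smul_const (𝕂 := ℝ) A (0 : ℝ)
  have h1 : HasDerivAt (fun t : ℝ => NormedSpace.exp (t • A) * g) (A * g) 0 := he.mul_const g
  have h3 := hasDerivAt_spec_comp c f h1 (by simpa using hg)
  have h4 : HasDerivAt (fun t : ℝ => NormedSpace.exp (t • A) * S *
      (NormedSpace.exp (t • A)).transpose) (A * S - S * A) 0 := by
    have ht : HasDerivAt (fun t : ℝ => (NormedSpace.exp (t • A)).transpose) A.transpose 0 :=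
      (transposeL n).hasFDerivAt.comp_hasDerivAt 0 he
    have := (he.mul_const S).mul ht
    have hA' : A.transpose = -A := hA
    refine this.congr_deriv ?_
    simp [hA', sub_eq_add_neg]
  have h5 : (fun t : ℝ => spec c f (flagOfMatrix c (NormedSpace.exp (t • A) * g)))
      = fun t : ℝ => NormedSpace.exp (t • A) * S * (NormedSpace.exp (t • A)).transpose := by
    funext t
    exact spec_orth_mul c f (exp_skew_orth hA t) hg
  rw [h5] at h3
  simpa using h3.unique h4

/-! ### The operators that define the metric -/

/-- The trace as a continuous linear map. -/
noncomputable def traceL (n : ℕ) : Matrix (Fin n) (Fin n) ℝ →L[ℝ] ℝ :=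
  LinearMap.toContinuousLinearMap (Matrix.traceLinearMap (Fin n) ℝ ℝ)

/-- The Frobenius inner product `Tr(AᵀB)`. -/
noncomputable def frob (n : ℕ) :
    Matrix (Fin n) (Fin n) ℝ →L[ℝ] Matrix (Fin n) (Fin n) ℝ →L[ℝ] ℝ :=
  ((ContinuousLinearMap.compL ℝ (Matrix (Fin n) (Fin n) ℝ) (Matrix (Fin n) (Fin n) ℝ) ℝ)
    (traceL n)).comp ((ContinuousLinearMap.mul ℝ (Matrix (Fin n) (Fin n) ℝ)).comp (transposeL n))

theorem frob_apply {n : ℕ} (A B : Matrix (Fin n) (Fin n) ℝ) :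
    frob n A B = (A.transpose * B).trace := rfl

theorem frob_eq_sum {n : ℕ} (A B : Matrix (Fin n) (Fin n) ℝ) :
    frob n A B = ∑ a, ∑ b, A a b * B a b := by
  rw [frob_apply, Matrix.trace, Finset.sum_comm]
  simp [Matrix.mul_apply]

theorem frob_comm {n : ℕ} (A B : Matrix (Fin n) (Fin n) ℝ) : frob n A B = frob n B A := by
  simp only [frob_eq_sum, mul_comm]

theorem eq_zero_of_sum_sq {n : ℕ} (w A : Matrix (Fin n) (Fin n) ℝ) (hw : ∀ a b, 0 < w a b)
    (h : ∑ a, ∑ b, w a b * (A a b * A a b) ≤ 0) : A = 0 := by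
  have h0 : ∀ a b, 0 ≤ w a b * (A a b * A a b) := fun a b =>
    mul_nonneg (hw a b).le (mul_self_nonneg _)
  have h1 := le_antisymm h (Finset.sum_nonneg fun a _ => Finset.sum_nonneg fun b _ => h0 a b)
  rw [Finset.sum_eq_zero_iff_of_nonneg fun a _ => Finset.sum_nonneg fun b _ => h0 a b] at h1
  ext a b
  have h2 := h1 a (Finset.mem_univ a)
  rw [Finset.sum_eq_zero_iff_of_nonneg fun b _ => h0 a b] at h2
  have h3 := h2 b (Finset.mem_univ b)
  simpa using (mul_eq_zero.mp h3).resolve_left (hw a b).ne'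

theorem frob_self_nonneg {n : ℕ} (A : Matrix (Fin n) (Fin n) ℝ) : 0 ≤ frob n A A := by
  rw [frob_eq_sum]
  exact Finset.sum_nonneg fun a _ => Finset.sum_nonneg fun b _ => mul_self_nonneg _

theorem eq_zero_of_frob_self {n : ℕ} {A : Matrix (Fin n) (Fin n) ℝ} (h : frob n A A ≤ 0) :
    A = 0 := by
  rw [frob_eq_sum] at h
  exact eq_zero_of_sum_sq (fun _ _ => 1) A (by simp) (by simpa using h)

theorem frob_mul_left {n : ℕ} (C A B : Matrix (Fin n) (Fin n) ℝ) :
    frob n (C * A) B = frob n A (C.transpose * B) := by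
  simp [frob_apply, Matrix.mul_assoc]

theorem frob_mul_right {n : ℕ} (C A B : Matrix (Fin n) (Fin n) ℝ) :
    frob n (A * C) B = frob n A (B * C.transpose) := by
  rw [frob_apply, frob_apply, Matrix.transpose_mul, Matrix.mul_assoc, Matrix.trace_mul_comm,
    Matrix.mul_assoc]

/-- The commutator `S ↦ [S, L]`. -/
noncomputable def ad {n : ℕ} (L : Matrix (Fin n) (Fin n) ℝ) :
    Matrix (Fin n) (Fin n) ℝ →L[ℝ] Matrix (Fin n) (Fin n) ℝ :=
  (ContinuousLinearMap.mul ℝ (Matrix (Fin n) (Fin n) ℝ)).flip L -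
    ContinuousLinearMap.mul ℝ (Matrix (Fin n) (Fin n) ℝ) L

theorem ad_apply {n : ℕ} (L S : Matrix (Fin n) (Fin n) ℝ) : ad L S = S * L - L * S := rfl

/-- Left and right multiplication by a symmetric matrix are self-adjoint for the Frobenius product,
hence so is their difference. -/
theorem frob_ad {n : ℕ} {L : Matrix (Fin n) (Fin n) ℝ} (hL : L.transpose = L)
    (S T : Matrix (Fin n) (Fin n) ℝ) : frob n (ad L S) T = frob n S (ad L T) := by
  rw [ad_apply, ad_apply, map_sub, map_sub, sub_apply, frob_mul_right,
    frob_mul_left, hL]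

/-- The weights `1 / |a - b|` of the operator `J`, extended by `1` to the diagonal. -/
noncomputable def jWeight {n : ℕ} (a b : Fin n) : ℝ :=
  if a = b then 1 else |((a : ℕ) : ℝ) - ((b : ℕ) : ℝ)|⁻¹

theorem jWeight_pos {n : ℕ} (a b : Fin n) : 0 < jWeight a b := by
  unfold jWeight
  split_ifs with h
  · exact one_pos
  · have : ((a : ℕ) : ℝ) ≠ ((b : ℕ) : ℝ) := fun e => h (Fin.ext (by exact_mod_cast e))
    exact inv_pos.mpr (abs_pos.mpr (sub_ne_zero.mpr this))

/-- The operator `J` on matrices. -/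
noncomputable def jOp (n : ℕ) : Matrix (Fin n) (Fin n) ℝ →L[ℝ] Matrix (Fin n) (Fin n) ℝ :=
  LinearMap.toContinuousLinearMap
    { toFun := fun A => Matrix.of fun a b => jWeight a b * A a b
      map_add' := fun A B => by ext; simp [mul_add]
      map_smul' := fun r A => by ext; simp; ring }

theorem jOp_apply {n : ℕ} (A : Matrix (Fin n) (Fin n) ℝ) (a b : Fin n) :
    jOp n A a b = jWeight a b * A a b := rfl

theorem frob_jOp {n : ℕ} (S T : Matrix (Fin n) (Fin n) ℝ) :
    frob n (jOp n S) T = frob n S (jOp n T) := by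
  simp only [frob_eq_sum, jOp_apply]
  exact Finset.sum_congr rfl fun a _ => Finset.sum_congr rfl fun b _ => by ring

theorem frob_jOp_self {n : ℕ} (S : Matrix (Fin n) (Fin n) ℝ) :
    frob n S (jOp n S) = ∑ a, ∑ b, jWeight a b * (S a b * S a b) := by
  simp only [frob_eq_sum, jOp_apply]
  exact Finset.sum_congr rfl fun a _ => Finset.sum_congr rfl fun b _ => by ring

theorem frob_jOp_self_nonneg {n : ℕ} (S : Matrix (Fin n) (Fin n) ℝ) :
    0 ≤ frob n S (jOp n S) := by
  rw [frob_jOp_self]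
  exact Finset.sum_nonneg fun a _ => Finset.sum_nonneg fun b _ =>
    mul_nonneg (jWeight_pos a b).le (mul_self_nonneg _)

/-- `invJ` erases the diagonal, but a skew matrix has none, so the conventional diagonal weight 1 in
`jWeight` plays no role here. That weight only serves to make `jOp` positive definite on all
matrices. -/
theorem jOp_invJ {n : ℕ} {A : Matrix (Fin n) (Fin n) ℝ} (hA : IsSkew A) :
    jOp n (invJ A) = A := by
  have hA' : A.transpose = -A := hA
  ext a b
  rw [jOp_apply, invJ, Matrix.of_apply, jWeight]
  split_ifs with h
  · subst h
    have := congrFun (congrFun hA' a) a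
    simp only [Matrix.transpose_apply, Matrix.neg_apply] at this
    have h0 : A a a = 0 := by linarith
    simp [h0]
  · have : ((a : ℕ) : ℝ) ≠ ((b : ℕ) : ℝ) := fun e => h (Fin.ext (by exact_mod_cast e))
    rw [← mul_assoc, inv_mul_cancel₀ (abs_ne_zero.mpr (sub_ne_zero.mpr this)), one_mul]

theorem innerJ_eq_frob {n : ℕ} {A : Matrix (Fin n) (Fin n) ℝ} (hA : IsSkew A)
    (C : Matrix (Fin n) (Fin n) ℝ) : innerJ A C = frob n A (invJ C) := by
  have hA' : A.transpose = -A := hA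
  rw [innerJ, frob_apply, hA', Matrix.neg_mul, Matrix.trace_neg]

/-- The orthogonal projection onto the centralizer of `L`. -/
noncomputable def centProj {n : ℕ} (c : Composition n) (x : PartialFlag c) :
    Matrix (Fin n) (Fin n) ℝ →L[ℝ] Matrix (Fin n) (Fin n) ℝ :=
  ∑ j, (ContinuousLinearMap.mul ℝ (Matrix (Fin n) (Fin n) ℝ) (eproj c j x)).comp
    ((ContinuousLinearMap.mul ℝ (Matrix (Fin n) (Fin n) ℝ)).flip (eproj c j x))

theorem centProj_apply {n : ℕ} (c : Composition n) (x : PartialFlag c)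
    (S : Matrix (Fin n) (Fin n) ℝ) :
    centProj c x S = ∑ j, eproj c j x * S * eproj c j x := by
  simp [centProj, Matrix.mul_assoc]

theorem eproj_mul_centProj {n : ℕ} (c : Composition n) (x : PartialFlag c)
    (S : Matrix (Fin n) (Fin n) ℝ) (j : Fin c.length) :
    eproj c j x * centProj c x S = eproj c j x * S * eproj c j x := by
  rw [centProj_apply, Finset.mul_sum, Finset.sum_eq_single j]
  · rw [← Matrix.mul_assoc, ← Matrix.mul_assoc, eproj_mul_self]
  · intro i _ hi
    rw [← Matrix.mul_assoc, ← Matrix.mul_assoc, eproj_mul_of_ne c hi.symm, Matrix.zero_mul,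
      Matrix.zero_mul]
  · simp

theorem centProj_centProj {n : ℕ} (c : Composition n) (x : PartialFlag c)
    (S : Matrix (Fin n) (Fin n) ℝ) : centProj c x (centProj c x S) = centProj c x S := by
  rw [centProj_apply c x (centProj c x S), centProj_apply c x S]
  refine Finset.sum_congr rfl fun j _ => ?_
  rw [← centProj_apply, eproj_mul_centProj, Matrix.mul_assoc, eproj_mul_self]

theorem frob_centProj {n : ℕ} (c : Composition n) (x : PartialFlag c)
    (S T : Matrix (Fin n) (Fin n) ℝ) :
    frob n (centProj c x S) T = frob n S (centProj c x T) := by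
  rw [centProj_apply, centProj_apply, map_sum, map_sum, sum_apply]
  refine Finset.sum_congr rfl fun j _ => ?_
  rw [frob_mul_right, frob_mul_left, spec_transpose, ← Matrix.mul_assoc]

theorem centProj_dspec {n : ℕ} (c : Composition n) (f : Fin c.length → ℝ) (x : PartialFlag c)
    (v : Cell c) : centProj c x (dspec c f x v) = 0 := by
  rw [centProj_apply]
  exact Finset.sum_eq_zero fun j _ => eproj_mul_dspec_mul_eproj c f j x v

theorem ad_centProj {n : ℕ} (c : Composition n) (f : Fin c.length → ℝ) (x : PartialFlag c)
    (S : Matrix (Fin n) (Fin n) ℝ) : ad (spec c f x) (centProj c x S) = 0 := by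
  rw [ad_apply, centProj_apply, Finset.sum_mul, Finset.mul_sum, sub_eq_zero]
  refine Finset.sum_congr rfl fun j _ => ?_
  rw [Matrix.mul_assoc, eproj_mul_spec, ← Matrix.mul_assoc, ← Matrix.mul_assoc, spec_mul_eproj]
  simp

/-- Commuting with L kills the off-diagonal spectral blocks, because the eigenvalues are distinct;
`centProj` records exactly the diagonal ones. -/
theorem eq_zero_of_ad_of_centProj {n : ℕ} (c : Composition n) {lam : Fin c.length → ℝ}
    (hlam : Function.Injective lam) {x : PartialFlag c} {S : Matrix (Fin n) (Fin n) ℝ}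
    (h1 : ad (spec c lam x) S = 0) (h2 : centProj c x S = 0) : S = 0 := by
  refine sandwich_eq_zero c x fun i j => ?_
  by_cases hij : i = j
  · subst hij
    rw [← eproj_mul_centProj, h2, Matrix.mul_zero]
  · rw [ad_apply] at h1
    have h3 : eproj c i x * (S * spec c lam x - spec c lam x * S) * eproj c j x = 0 := by
      rw [h1]; simp
    rw [Matrix.mul_sub, Matrix.sub_mul, ← Matrix.mul_assoc, Matrix.mul_assoc _ (spec c lam x),
      spec_mul_eproj, ← Matrix.mul_assoc _ (spec c lam x), eproj_mul_spec, Matrix.mul_smul,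
      Matrix.smul_mul, Matrix.smul_mul, ← sub_smul] at h3
    exact (smul_eq_zero.mp h3).resolve_left (sub_ne_zero.mpr fun h => hij (hlam h).symm)

/-! ### The operator that inverts the metric -/

/-- The inverse metric `[J[·, L], L]`, made invertible on the centralizer. -/
noncomputable def kOp {n : ℕ} (c : Composition n) (lam : Fin c.length → ℝ) (x : PartialFlag c) :
    Matrix (Fin n) (Fin n) ℝ →L[ℝ] Matrix (Fin n) (Fin n) ℝ :=
  (ad (spec c lam x)).comp ((jOp n).comp (ad (spec c lam x))) + centProj c x

theorem kOp_apply {n : ℕ} (c : Composition n) (lam : Fin c.length → ℝ) (x : PartialFlag c)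
    (S : Matrix (Fin n) (Fin n) ℝ) :
    kOp c lam x S = ad (spec c lam x) (jOp n (ad (spec c lam x) S)) + centProj c x S := rfl

theorem frob_kOp {n : ℕ} (c : Composition n) (lam : Fin c.length → ℝ) (x : PartialFlag c)
    (S T : Matrix (Fin n) (Fin n) ℝ) : frob n (kOp c lam x S) T = frob n S (kOp c lam x T) := by
  have hL := spec_transpose c lam x
  rw [kOp_apply, kOp_apply, map_add, map_add, add_apply, frob_centProj,
    frob_ad hL, frob_jOp, frob_ad hL]

/-- The first summand vanishes only on the centralizer of L and the second only off it, in the sense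
of zero projection. Positive definiteness of `kOp` follows. -/
theorem frob_kOp_self {n : ℕ} (c : Composition n) (lam : Fin c.length → ℝ) (x : PartialFlag c)
    (S : Matrix (Fin n) (Fin n) ℝ) :
    frob n S (kOp c lam x S)
      = frob n (ad (spec c lam x) S) (jOp n (ad (spec c lam x) S)) +
        frob n (centProj c x S) (centProj c x S) := by
  rw [kOp_apply, map_add, ← frob_ad (spec_transpose c lam x), frob_centProj, centProj_centProj]

theorem frob_kOp_self_pos {n : ℕ} (c : Composition n) {lam : Fin c.length → ℝ}
    (hlam : Function.Injective lam) (x : PartialFlag c)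
    {S : Matrix (Fin n) (Fin n) ℝ} (hS : S ≠ 0) : 0 < frob n S (kOp c lam x S) := by
  by_contra! h
  rw [frob_kOp_self] at h
  have h1 := frob_jOp_self_nonneg (ad (spec c lam x) S)
  have h2 := frob_self_nonneg (centProj c x S)
  refine hS (eq_zero_of_ad_of_centProj c hlam ?_ (eq_zero_of_frob_self (by linarith)))
  have h3 : frob n (ad (spec c lam x) S) (jOp n (ad (spec c lam x) S)) ≤ 0 := by linarith
  rw [frob_jOp_self] at h3
  exact eq_zero_of_sum_sq jWeight _ jWeight_pos h3

theorem kOp_injective {n : ℕ} (c : Composition n) {lam : Fin c.length → ℝ}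
    (hlam : Function.Injective lam) (x : PartialFlag c) :
    Function.Injective (kOp c lam x) := by
  rw [injective_iff_map_eq_zero]
  intro S hS
  by_contra h0
  have := frob_kOp_self_pos c hlam x h0
  rw [hS, map_zero] at this
  exact lt_irrefl _ this

/-- `kOp` as an equivalence. -/
noncomputable def kEquiv {n : ℕ} (c : Composition n) {lam : Fin c.length → ℝ}
    (hlam : Function.Injective lam) (x : PartialFlag c) :
    Matrix (Fin n) (Fin n) ℝ ≃L[ℝ] Matrix (Fin n) (Fin n) ℝ :=
  (LinearEquiv.ofInjectiveEndo (kOp c lam x).toLinearMap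
    (kOp_injective c hlam x)).toContinuousLinearEquiv

theorem kEquiv_coe {n : ℕ} (c : Composition n) {lam : Fin c.length → ℝ}
    (hlam : Function.Injective lam) (x : PartialFlag c) :
    (kEquiv c hlam x : Matrix (Fin n) (Fin n) ℝ →L[ℝ] Matrix (Fin n) (Fin n) ℝ)
      = kOp c lam x := by
  ext1 S
  rfl

/-- The inverse of `kOp`. -/
noncomputable def rOp {n : ℕ} (c : Composition n) (lam : Fin c.length → ℝ) (x : PartialFlag c) :
    Matrix (Fin n) (Fin n) ℝ →L[ℝ] Matrix (Fin n) (Fin n) ℝ :=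
  ContinuousLinearMap.inverse (kOp c lam x)

theorem rOp_eq {n : ℕ} (c : Composition n) {lam : Fin c.length → ℝ}
    (hlam : Function.Injective lam) (x : PartialFlag c) (S : Matrix (Fin n) (Fin n) ℝ) :
    rOp c lam x S = (kEquiv c hlam x).symm S := by
  rw [rOp, ← kEquiv_coe c hlam x, ContinuousLinearMap.inverse_equiv]
  rfl

theorem rOp_kOp {n : ℕ} (c : Composition n) {lam : Fin c.length → ℝ}
    (hlam : Function.Injective lam) (x : PartialFlag c) (S : Matrix (Fin n) (Fin n) ℝ) :
    rOp c lam x (kOp c lam x S) = S := by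
  rw [rOp_eq c hlam]
  exact (kEquiv c hlam x).symm_apply_apply S

theorem kOp_rOp {n : ℕ} (c : Composition n) {lam : Fin c.length → ℝ}
    (hlam : Function.Injective lam) (x : PartialFlag c) (S : Matrix (Fin n) (Fin n) ℝ) :
    kOp c lam x (rOp c lam x S) = S := by
  rw [rOp_eq c hlam]
  exact (kEquiv c hlam x).apply_symm_apply S

theorem frob_rOp {n : ℕ} (c : Composition n) {lam : Fin c.length → ℝ}
    (hlam : Function.Injective lam) (x : PartialFlag c) (S T : Matrix (Fin n) (Fin n) ℝ) :
    frob n (rOp c lam x S) T = frob n S (rOp c lam x T) := by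
  conv_lhs => rw [← kOp_rOp c hlam x T]
  rw [← frob_kOp, kOp_rOp c hlam]

theorem frob_rOp_self_pos {n : ℕ} (c : Composition n) {lam : Fin c.length → ℝ}
    (hlam : Function.Injective lam) (x : PartialFlag c)
    {S : Matrix (Fin n) (Fin n) ℝ} (hS : S ≠ 0) : 0 < frob n S (rOp c lam x S) := by
  have h0 : rOp c lam x S ≠ 0 := by
    intro h
    apply hS
    rw [← kOp_rOp c hlam x S, h, map_zero]
  have := frob_kOp_self_pos c hlam x h0
  rwa [kOp_rOp c hlam, frob_comm] at this

theorem contDiffAt_kOp {n : ℕ} (c : Composition n) (lam : Fin c.length → ℝ)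
    {g : Matrix (Fin n) (Fin n) ℝ} (hg : IsUnit g.det) :
    ContDiffAt ℝ ∞ (fun h => kOp c lam (flagOfMatrix c h)) g := by
  have h1 : ∀ f, ContDiffAt ℝ ∞ (fun h => ContinuousLinearMap.mul ℝ
      (Matrix (Fin n) (Fin n) ℝ) (spec c f (flagOfMatrix c h))) g := fun f =>
    (ContinuousLinearMap.mul ℝ (Matrix (Fin n) (Fin n) ℝ)).contDiff.contDiffAt.comp g
      (contDiffAt_spec c f hg)
  have h2 : ∀ f, ContDiffAt ℝ ∞ (fun h => (ContinuousLinearMap.mul ℝ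
      (Matrix (Fin n) (Fin n) ℝ)).flip (spec c f (flagOfMatrix c h))) g := fun f =>
    (ContinuousLinearMap.mul ℝ (Matrix (Fin n) (Fin n) ℝ)).flip.contDiff.contDiffAt.comp g
      (contDiffAt_spec c f hg)
  have h3 := (h2 lam).sub (h1 lam)
  exact (h3.clm_comp (contDiffAt_const.clm_comp h3)).add
    (ContDiffAt.sum fun j _ => (h1 _).clm_comp (h2 _))

/-- Inversion of continuous linear maps is smooth at an invertible map, and `kOp` is polynomial in
the spectral matrices. -/
theorem contMDiff_rOp {n : ℕ} (c : Composition n) {lam : Fin c.length → ℝ}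
    (hlam : Function.Injective lam) :
    ContMDiff 𝓘(ℝ, Cell c) 𝓘(ℝ, Matrix (Fin n) (Fin n) ℝ →L[ℝ] Matrix (Fin n) (Fin n) ℝ) ∞
      (rOp c lam) := by
  refine contMDiff_of_comp_flagOfMatrix c fun g hg => ?_
  have h1 := contDiffAt_map_inverse (𝕜 := ℝ) (n := ∞) (kEquiv c hlam (flagOfMatrix c g))
  rw [kEquiv_coe] at h1
  exact h1.comp g (contDiffAt_kOp c lam hg)

/-! ### Pull-backs of bilinear forms along immersions -/

theorem contDiff_clm_flip {E V : Type*} [NormedAddCommGroup E] [NormedSpace ℝ E]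
    [NormedAddCommGroup V] [NormedSpace ℝ V] :
    ContDiff ℝ ∞ fun S : E →L[ℝ] V →L[ℝ] ℝ => S.flip :=
  IsBoundedLinearMap.contDiff ⟨⟨fun _ _ => rfl, fun _ _ => rfl⟩, 1, one_pos, fun S => by simp⟩

section Pullback

variable {E : Type*} [NormedAddCommGroup E] [NormedSpace ℝ E] {X : Type*} [TopologicalSpace X]
  [ChartedSpace E X] [IsManifold 𝓘(ℝ, E) ∞ X] {V : Type*} [NormedAddCommGroup V] [NormedSpace ℝ V]

/-- Smoothness of a bundle metric is tested in the trivialization at a point, where the differential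
of L becomes a smooth family `T` of maps between fixed vector spaces. The form is then a composite
of `B` and `T`. -/
theorem contMDiff_pullback_form {L : X → V} (hL : ContMDiff 𝓘(ℝ, E) 𝓘(ℝ, V) ∞ L)
    {B : X → V →L[ℝ] V →L[ℝ] ℝ} (hB : ContMDiff 𝓘(ℝ, E) 𝓘(ℝ, V →L[ℝ] V →L[ℝ] ℝ) ∞ B)
    (g : ∀ x : X, TangentSpace 𝓘(ℝ, E) x →L[ℝ] TangentSpace 𝓘(ℝ, E) x →L[ℝ] ℝ)
    (hg : ∀ (x : X) (v w : TangentSpace 𝓘(ℝ, E) x), g x v w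
      = B x (mfderiv 𝓘(ℝ, E) 𝓘(ℝ, V) L x v) (mfderiv 𝓘(ℝ, E) 𝓘(ℝ, V) L x w)) :
    ContMDiff 𝓘(ℝ, E) (𝓘(ℝ, E).prod 𝓘(ℝ, E →L[ℝ] E →L[ℝ] ℝ)) ∞
      (fun x => Bundle.TotalSpace.mk' (E →L[ℝ] E →L[ℝ] ℝ) x (g x)) := by
  intro x₀
  rw [contMDiffAt_hom_bundle]
  refine ⟨contMDiffAt_id, ?_⟩
  let T : X → E →L[ℝ] V :=
    inTangentCoordinates 𝓘(ℝ, E) 𝓘(ℝ, V) id L (mfderiv 𝓘(ℝ, E) 𝓘(ℝ, V) L) x₀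
  have hT : ContMDiffAt 𝓘(ℝ, E) 𝓘(ℝ, E →L[ℝ] V) ∞ T x₀ :=
    (hL x₀).mfderiv_const (m := ∞) (by simp)
  -- The two flips insert `T` into each argument in turn: the composite sends (v, w) to B(Tv, Tw).
  have h1 : ContMDiffAt 𝓘(ℝ, E) 𝓘(ℝ, E →L[ℝ] E →L[ℝ] ℝ) ∞
      (fun x => ((((B x).comp (T x)).flip).comp (T x)).flip) x₀ := by
    exact contDiff_clm_flip.contMDiff.contMDiffAt.comp x₀
      ((contDiff_clm_flip.contMDiff.contMDiffAt.comp x₀ ((hB x₀).clm_comp hT)).clm_comp hT)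
  refine h1.congr_of_eventuallyEq ?_
  have hbase : (trivializationAt E (TangentSpace 𝓘(ℝ, E)) x₀).baseSet ∈ 𝓝 x₀ :=
    (trivializationAt E (TangentSpace 𝓘(ℝ, E)) x₀).open_baseSet.mem_nhds
      (FiberBundle.mem_baseSet_trivializationAt' x₀)
  filter_upwards [hbase] with x hx
  have hTx : ∀ v : E, T x v = mfderiv 𝓘(ℝ, E) 𝓘(ℝ, V) L x
      ((trivializationAt E (TangentSpace 𝓘(ℝ, E)) x₀).symm x v) := by
    intro v
    have h2 : L x ∈ (trivializationAt V (TangentSpace 𝓘(ℝ, V)) (L x₀)).baseSet := by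
      simp only [mfld_simps]
      exact Set.mem_univ _
    have h3 := ContinuousLinearMap.inCoordinates_eq (σ := RingHom.id ℝ)
      (ϕ := (mfderiv 𝓘(ℝ, E) 𝓘(ℝ, V) L x)) hx h2
    have h4 := congrArg (fun S : E →L[ℝ] V => S v) h3
    refine h4.trans ?_
    simp
    rfl
  ext v w
  have h5 := inCoordinates_apply_eq₂ (F₃ := ℝ) (E₃ := Bundle.Trivial X ℝ) (ϕ := g x) (v := v)
    (w := w) hx hx (Set.mem_univ x)
  refine h5.trans ?_
  simp only [Bundle.Trivial.linearMapAt_trivialization, Bundle.Trivial.fiberBundle_trivializationAt',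
    LinearMap.id_coe, id_eq]
  refine (hg x _ _).trans ?_
  rw [← hTx, ← hTx]
  rfl

end Pullback

/-- The unit ball of a positive-definite form on a finite-dimensional space is bounded. -/
theorem isVonNBounded_of_posDef {E : Type*} [NormedAddCommGroup E] [NormedSpace ℝ E]
    [FiniteDimensional ℝ E] (g : E →L[ℝ] E →L[ℝ] ℝ) (hg : ∀ v, v ≠ 0 → 0 < g v v) :
    Bornology.IsVonNBounded ℝ {v : E | g v v < 1} := by
  rw [NormedSpace.isVonNBounded_iff, isBounded_iff_forall_norm_le]
  have hcont : Continuous fun v : E => g v v := g.continuous.clm_apply continuous_id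
  -- An empty unit sphere means that the space is zero. Otherwise compactness gives a positive
  -- minimum m of the form on the sphere, and 1/√m bounds the unit ball.
  rcases (Metric.sphere (0 : E) 1).eq_empty_or_nonempty with he | hne
  · refine ⟨0, fun v _ => ?_⟩
    by_contra! h
    have : (‖v‖⁻¹ • v) ∈ Metric.sphere (0 : E) 1 := by
      rw [mem_sphere_zero_iff_norm, norm_smul, norm_inv, norm_norm, inv_mul_cancel₀ h.ne']
    rw [he] at this
    exact this
  · obtain ⟨u, hu, hmin⟩ := (isCompact_sphere (0 : E) 1).exists_isMinOn hne hcont.continuousOn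
    have hu0 : u ≠ 0 := by
      rintro rfl
      simp at hu
    have hc := hg u hu0
    refine ⟨Real.sqrt (1 / g u u), fun v hv => ?_⟩
    by_cases hv0 : v = 0
    · rw [hv0, norm_zero]; exact Real.sqrt_nonneg _
    have hn : 0 < ‖v‖ := norm_pos_iff.mpr hv0
    have hs : (‖v‖⁻¹ • v) ∈ Metric.sphere (0 : E) 1 := by
      rw [mem_sphere_zero_iff_norm, norm_smul, norm_inv, norm_norm, inv_mul_cancel₀ hn.ne']
    have h1 : g u u ≤ g (‖v‖⁻¹ • v) (‖v‖⁻¹ • v) := hmin hs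
    simp only [map_smul, smul_apply, smul_eq_mul] at h1
    have h2 : g v v < 1 := hv
    apply Real.le_sqrt_of_sq_le
    rw [le_div_iff₀ hc]
    have h3 : ‖v‖ ^ 2 * g u u ≤ ‖v‖ ^ 2 * (‖v‖⁻¹ * (‖v‖⁻¹ * g v v)) :=
      mul_le_mul_of_nonneg_left h1 (sq_nonneg _)
    have h4 : ‖v‖ ^ 2 * (‖v‖⁻¹ * (‖v‖⁻¹ * g v v)) = g v v := by
      field_simp
    linarith

/-! ### The metric on the flag manifold -/

/-- The bilinear form of the metric. -/
noncomputable def metricForm {n : ℕ} (c : Composition n) (lam : Fin c.length → ℝ)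
    (x : PartialFlag c) : Cell c →L[ℝ] Cell c →L[ℝ] ℝ :=
  (frob n).bilinearComp (dspec c lam x) ((rOp c lam x).comp (dspec c lam x))

theorem metricForm_apply {n : ℕ} (c : Composition n) (lam : Fin c.length → ℝ)
    (x : PartialFlag c) (v w : Cell c) :
    metricForm c lam x v w = frob n (dspec c lam x v) (rOp c lam x (dspec c lam x w)) := rfl

/-- The inverse of a positive definite operator is positive definite, and the immersion property
carries this over to tangent vectors. -/
theorem metricForm_pos {n : ℕ} (c : Composition n) {lam : Fin c.length → ℝ}
    (hlam : Function.Injective lam) (x : PartialFlag c) (v : Cell c) (hv : v ≠ 0) :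
    0 < metricForm c lam x v v :=
  frob_rOp_self_pos c hlam x fun h => hv (dspec_injective c hlam h)

theorem metricForm_symm {n : ℕ} (c : Composition n) {lam : Fin c.length → ℝ}
    (hlam : Function.Injective lam) (x : PartialFlag c) (v w : Cell c) :
    metricForm c lam x v w = metricForm c lam x w v := by
  rw [metricForm_apply, metricForm_apply, ← frob_rOp c hlam, frob_comm]

theorem contMDiff_metricForm {n : ℕ} (c : Composition n) {lam : Fin c.length → ℝ}
    (hlam : Function.Injective lam) :
    ContMDiff 𝓘(ℝ, Cell c) (𝓘(ℝ, Cell c).prod 𝓘(ℝ, Cell c →L[ℝ] Cell c →L[ℝ] ℝ)) ∞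
    (fun x : PartialFlag c => Bundle.TotalSpace.mk' (Cell c →L[ℝ] Cell c →L[ℝ] ℝ)
      (E := fun x : PartialFlag c => TangentSpace 𝓘(ℝ, Cell c) x →L[ℝ]
        TangentSpace 𝓘(ℝ, Cell c) x →L[ℝ] ℝ) x (metricForm c lam x)) := by
  have hB : ContMDiff 𝓘(ℝ, Cell c)
      𝓘(ℝ, Matrix (Fin n) (Fin n) ℝ →L[ℝ] Matrix (Fin n) (Fin n) ℝ →L[ℝ] ℝ) ∞
      (fun x => (frob n).comp (rOp c lam x)) := fun x =>
    contMDiffAt_const.clm_comp (contMDiff_rOp c hlam x)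
  refine contMDiff_pullback_form (contMDiff_spec c lam) hB _ fun x v w => ?_
  exact (frob_rOp c hlam x (dspec c lam x v) (dspec c lam x w)).symm

/-- The metric of the flag manifold. -/
noncomputable def flagMetric {n : ℕ} (c : Composition n) {lam : Fin c.length → ℝ}
    (hlam : Function.Injective lam) :
    Bundle.ContMDiffRiemannianMetric 𝓘(ℝ, Cell c) ∞ (Cell c)
      (fun x : PartialFlag c => TangentSpace 𝓘(ℝ, Cell c) x) where
  inner x := metricForm c lam x
  symm x v w := metricForm_symm c hlam x v w
  pos x v hv := metricForm_pos c hlam x v hv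
  isVonNBounded x := isVonNBounded_of_posDef (metricForm c lam x) (metricForm_pos c hlam x)
  contMDiff := contMDiff_metricForm c hlam

theorem flagMetric_inner {n : ℕ} (c : Composition n) {lam : Fin c.length → ℝ}
    (hlam : Function.Injective lam) (x : PartialFlag c) (v w : Cell c) :
    (flagMetric c hlam).inner x v w
      = frob n (dspec c lam x v) (rOp c lam x (dspec c lam x w)) := rfl

/-! ### Vector fields induced from a submersion -/

theorem tangentBundle_mk_eq {E : Type*} [NormedAddCommGroup E] [NormedSpace ℝ E] {X : Type*}
    [TopologicalSpace X] [ChartedSpace E X] {x y : X} (e : x = y) (u : E) :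
    (Bundle.TotalSpace.mk' E (E := fun x : X => TangentSpace 𝓘(ℝ, E) x) x u)
      = Bundle.TotalSpace.mk' E (E := fun x : X => TangentSpace 𝓘(ℝ, E) x) y u := by
  subst e
  rfl

section Push

variable {E : Type*} [NormedAddCommGroup E] [NormedSpace ℝ E] {X : Type*} [TopologicalSpace X]
  [ChartedSpace E X] [IsManifold 𝓘(ℝ, E) ∞ X] {V : Type*} [NormedAddCommGroup V] [NormedSpace ℝ V]

/-- A vector field that is locally the image of a smooth vector field along a smooth section of a
submersion is smooth. -/
theorem contMDiffAt_pushforward {f : V → X} {h W : X → V} {x₀ : X}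
    (hf : ContMDiffAt 𝓘(ℝ, V) 𝓘(ℝ, E) ∞ f (h x₀)) (hh : ContMDiffAt 𝓘(ℝ, E) 𝓘(ℝ, V) ∞ h x₀)
    (hW : ContMDiffAt 𝓘(ℝ, E) 𝓘(ℝ, V) ∞ W x₀) (hfh : ∀ᶠ y in 𝓝 x₀, f (h y) = y)
    (m : ∀ x : X, TangentSpace 𝓘(ℝ, E) x)
    (hm : ∀ᶠ y in 𝓝 x₀, (m y : E) = (mfderiv 𝓘(ℝ, V) 𝓘(ℝ, E) f (h y) : V →L[ℝ] E) (W y)) :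
    ContMDiffAt 𝓘(ℝ, E) 𝓘(ℝ, E).tangent ∞
      (fun x => (⟨x, m x⟩ : TangentBundle 𝓘(ℝ, E) X)) x₀ := by
  have hv : ContMDiffAt 𝓘(ℝ, E) 𝓘(ℝ, V).tangent ∞
      (fun y => (⟨h y, W y⟩ : TangentBundle 𝓘(ℝ, V) V)) x₀ := by
    rw [Bundle.contMDiffAt_totalSpace]
    refine ⟨hh, ?_⟩
    refine hW.congr_of_eventuallyEq (Filter.Eventually.of_forall fun y => ?_)
    simp
  have hf' : ContMDiffAt (𝓘(ℝ, E).prod 𝓘(ℝ, V)) 𝓘(ℝ, E) ∞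
      (Function.uncurry fun _ : X => f) (x₀, h x₀) :=
    ContMDiffAt.comp (I' := 𝓘(ℝ, V)) (g := f) (x₀, h x₀) hf contMDiffAt_snd
  have hϕ := ContMDiffAt.mfderiv (m := ∞) (n := ∞) (x₀ := x₀) (fun _ => f) h hf' hh (by simp)
  let ϕ : ∀ y : X, TangentSpace 𝓘(ℝ, V) (h y) →L[ℝ] TangentSpace 𝓘(ℝ, E) (f (h y)) :=
    fun y => mfderiv 𝓘(ℝ, V) 𝓘(ℝ, E) f (h y)
  have hb : ContMDiffAt 𝓘(ℝ, E) 𝓘(ℝ, E) ∞ (fun y => f (h y)) x₀ := hf.comp x₀ hh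
  have h1 : ContMDiffAt 𝓘(ℝ, E) 𝓘(ℝ, E).tangent ∞
      (fun y => (⟨f (h y), ϕ y (W y)⟩ : TangentBundle 𝓘(ℝ, E) X)) x₀ :=
    ContMDiffAt.clm_apply_of_inCoordinates (E₁ := fun y : V => TangentSpace 𝓘(ℝ, V) y)
      (E₂ := fun y : X => TangentSpace 𝓘(ℝ, E) y) (b₁ := h) (b₂ := fun y => f (h y))
      (v := fun y => W y) (ϕ := ϕ) hϕ hv hb
  refine h1.congr_of_eventuallyEq ?_
  filter_upwards [hfh, hm] with y hy1 hy2
  have h2 := tangentBundle_mk_eq (E := E) hy1.symm (m y)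
  refine h2.trans ?_
  exact congrArg (Bundle.TotalSpace.mk' E
    (E := fun x : X => TangentSpace 𝓘(ℝ, E) x) (f (h y))) hy2

end Push
/-! ### The metric on horizontal vectors -/

theorem eproj_mul_ad_mul_eproj {n : ℕ} (c : Composition n) (f : Fin c.length → ℝ)
    (x : PartialFlag c) (S : Matrix (Fin n) (Fin n) ℝ) (i j : Fin c.length) :
    eproj c i x * ad (spec c f x) S * eproj c j x
      = (f j - f i) • (eproj c i x * S * eproj c j x) := by
  rw [ad_apply, Matrix.mul_sub, Matrix.sub_mul, ← Matrix.mul_assoc,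
    Matrix.mul_assoc _ (spec c f x), spec_mul_eproj, ← Matrix.mul_assoc _ (spec c f x),
    eproj_mul_spec, Matrix.mul_smul, Matrix.smul_mul, Matrix.smul_mul, ← sub_smul]

/-- The range of `ad L` is the orthogonal complement of the centralizer of `L`. -/
theorem exists_ad_eq {n : ℕ} (c : Composition n) {lam : Fin c.length → ℝ}
    (hlam : Function.Injective lam) {x : PartialFlag c} {D : Matrix (Fin n) (Fin n) ℝ}
    (hD : centProj c x D = 0) :
    ∃ S, ad (spec c lam x) S = D ∧ centProj c x S = 0 := by
  -- Bracketing with L scales the spectral block (k, l) by λ_l − λ_k, so S divides by it. For k = l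
  -- the convention 0⁻¹ = 0 gives a zero block, which makes the centralizer part of S vanish.
  let S := ∑ k, ∑ l, (lam l - lam k)⁻¹ • (eproj c k x * D * eproj c l x)
  have hS : ∀ i j, eproj c i x * S * eproj c j x
      = (lam j - lam i)⁻¹ • (eproj c i x * D * eproj c j x) := by
    intro i j
    simp only [S, Finset.mul_sum, Finset.sum_mul, Matrix.mul_smul, Matrix.smul_mul]
    rw [Finset.sum_eq_single i, Finset.sum_eq_single j]
    · congr 1
      rw [← Matrix.mul_assoc, ← Matrix.mul_assoc, eproj_mul_self,
        Matrix.mul_assoc _ (eproj c j x) (eproj c j x), eproj_mul_self]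
    · intro l _ hl
      rw [Matrix.mul_assoc _ _ (eproj c j x), Matrix.mul_assoc _ (eproj c l x),
        eproj_mul_of_ne c hl]
      simp
    · simp
    · intro k _ hk
      refine Finset.sum_eq_zero fun l _ => ?_
      rw [← Matrix.mul_assoc (eproj c i x), ← Matrix.mul_assoc (eproj c i x),
        eproj_mul_of_ne c hk.symm]
      simp
    · simp
  refine ⟨S, ?_, ?_⟩
  · rw [← sub_eq_zero]
    refine sandwich_eq_zero c x fun i j => ?_
    rw [Matrix.mul_sub, Matrix.sub_mul, eproj_mul_ad_mul_eproj, hS, smul_smul]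
    by_cases hij : i = j
    · subst hij
      rw [← eproj_mul_centProj c x D, hD]
      simp
    · rw [mul_inv_cancel₀ (sub_ne_zero.mpr fun h => hij (hlam h).symm), one_smul, sub_self]
  · rw [centProj_apply]
    exact Finset.sum_eq_zero fun j _ => by rw [hS]; simp

theorem isSkew_invJ {n : ℕ} {A : Matrix (Fin n) (Fin n) ℝ} (hA : IsSkew A) :
    IsSkew (invJ A) := by
  have hA' : A.transpose = -A := hA
  ext a b
  have := congrFun (congrFun hA' a) b
  simp only [Matrix.transpose_apply, Matrix.neg_apply] at this
  simp only [Matrix.transpose_apply, Matrix.neg_apply, invJ, Matrix.of_apply, this, mul_neg]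
  rw [abs_sub_comm]

theorem frob_invJ {n : ℕ} (A C : Matrix (Fin n) (Fin n) ℝ) :
    frob n A (invJ C) = frob n (invJ A) C := by
  simp only [frob_eq_sum, invJ, Matrix.of_apply]
  exact Finset.sum_congr rfl fun a _ => Finset.sum_congr rfl fun b _ => by ring

theorem centProj_transpose {n : ℕ} (c : Composition n) (x : PartialFlag c)
    (S : Matrix (Fin n) (Fin n) ℝ) :
    (centProj c x S).transpose = centProj c x S.transpose := by
  simp only [centProj_apply, Matrix.transpose_sum, Matrix.transpose_mul, spec_transpose,
    Matrix.mul_assoc]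

/-- The centralizer part Z of J⁻¹A is skew and block diagonal in the frame Ψ, so it is itself an
admissible vertical direction. Testing horizontality against it yields ⟨Z, Z⟩ = 0. -/
theorem centProj_invJ_of_isHorizontal {n : ℕ} (c : Composition n)
    {Ψ A : Matrix (Fin n) (Fin n) ℝ} (hΨ : Ψ.transpose * Ψ = 1) (hA : IsHorizontal c Ψ A) :
    centProj c (flagOfMatrix c Ψ) (invJ A) = 0 := by
  have hΨ' : Ψ * Ψ.transpose = 1 := mul_eq_one_comm.mp hΨ
  set x := flagOfMatrix c Ψ
  set D := invJ A
  set Z := centProj c x D with hZ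
  have hDs : D.transpose = -D := isSkew_invJ hA.1
  have hZs : Z.transpose = -Z := by rw [hZ, centProj_transpose, hDs, map_neg]
  have hY : IsBlockSkew c (Ψ.transpose * Z * Ψ) := by
    refine ⟨?_, fun a b hab => ?_⟩
    · rw [IsSkew]
      simp [Matrix.mul_assoc, hZs]
    · have h1 : Ψ.transpose * Z * Ψ = ∑ j, blockDiag c (Pi.single j 1) *
          (Ψ.transpose * D * Ψ) * blockDiag c (Pi.single j 1) := by
        rw [hZ, centProj_apply, Finset.mul_sum, Finset.sum_mul]
        refine Finset.sum_congr rfl fun j _ => ?_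
        rw [eproj, spec_flagOfMatrix c _ hΨ]
        simp only [Matrix.mul_assoc]
        rw [hΨ, Matrix.mul_one, ← Matrix.mul_assoc Ψ.transpose Ψ, hΨ, Matrix.one_mul]
      rw [h1, Matrix.sum_apply]
      refine Finset.sum_eq_zero fun j _ => ?_
      rw [Matrix.mul_diagonal, Matrix.diagonal_mul]
      by_cases ha : c.index a = j
      · have hb : c.index b ≠ j := fun h => hab (ha.trans h.symm)
        simp [hb]
      · simp [ha]
  have h2 := hA.2 _ hY
  have h3 : Ψ * (Ψ.transpose * Z * Ψ) * Ψ.transpose = Z := by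
    simp only [Matrix.mul_assoc]
    rw [hΨ', Matrix.mul_one, ← Matrix.mul_assoc, hΨ', Matrix.one_mul]
  rw [h3, innerJ_eq_frob hA.1, frob_invJ] at h2
  apply eq_zero_of_frob_self
  rw [hZ, frob_centProj, centProj_centProj]
  exact h2.le

theorem dspec_mflag_skew_eq_ad {n : ℕ} (c : Composition n) (f : Fin c.length → ℝ)
    {g A : Matrix (Fin n) (Fin n) ℝ} (hg : IsUnit g.det) (hA : IsSkew A) :
    dspec c f (flagOfMatrix c g) (mflag c g (A * g)) = ad (spec c f (flagOfMatrix c g)) A :=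
  dspec_mflag_skew c f hg hA

/-- If A = J[S, L] and S has no centralizer part, then K S = [A, L], so the inverse of K recovers
the potential S. Both the horizontal metric and the gradient are computed this way. -/
theorem rOp_ad {n : ℕ} (c : Composition n) {lam : Fin c.length → ℝ}
    (hlam : Function.Injective lam) {x : PartialFlag c} {A S : Matrix (Fin n) (Fin n) ℝ}
    (h1 : jOp n (ad (spec c lam x) S) = A) (h2 : centProj c x S = 0) :
    rOp c lam x (ad (spec c lam x) A) = S := by
  have : kOp c lam x S = ad (spec c lam x) A := by rw [kOp_apply, h1, h2, add_zero]
  rw [← this, rOp_kOp c hlam]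

/-- Writing J⁻¹C = [S, L], the metric becomes ⟨[A, L], S⟩ = ⟨A, [S, L]⟩ = ⟨A, J⁻¹C⟩. -/
theorem flagMetric_horizontal {n : ℕ} (c : Composition n) {lam : Fin c.length → ℝ}
    (hlam : Function.Injective lam) {Ψ A C : Matrix (Fin n) (Fin n) ℝ}
    (hΨ : Ψ.transpose * Ψ = 1) (hA : IsHorizontal c Ψ A) (hC : IsHorizontal c Ψ C) :
    (flagMetric c hlam).inner (flagOfMatrix c Ψ) (dflag c Ψ (A * Ψ)) (dflag c Ψ (C * Ψ))
      = innerJ A C := by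
  have hu := isUnit_det_of_transpose_mul hΨ
  refine (flagMetric_inner c hlam (flagOfMatrix c Ψ) (dflag c Ψ (A * Ψ))
    (dflag c Ψ (C * Ψ))).trans ?_
  obtain ⟨S, hS1, hS2⟩ := exists_ad_eq c hlam (centProj_invJ_of_isHorizontal c hΨ hC)
  rw [dflag_eq_mflag c hu, dflag_eq_mflag c hu, dspec_mflag_skew_eq_ad c lam hu hA.1,
    dspec_mflag_skew_eq_ad c lam hu hC.1,
    rOp_ad c hlam (by rw [hS1, jOp_invJ hC.1]) hS2, frob_ad (spec_transpose c lam _), hS1,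
    innerJ_eq_frob hA.1]

/-! ### The Toda vector field and the Morse function on the flag manifold -/

theorem isSkew_laxB {n : ℕ} {L : Matrix (Fin n) (Fin n) ℝ} (hL : L.transpose = L) :
    IsSkew (laxB L) := by
  ext a b
  have h := congrFun (congrFun hL a) b
  simp only [Matrix.transpose_apply] at h
  simp only [Matrix.transpose_apply, Matrix.neg_apply, laxB, Matrix.of_apply, h]
  rcases lt_trichotomy a b with h1 | h1 | h1
  · simp [h1, h1.not_gt]
  · simp [h1]
  · simp [h1, h1.not_gt]

/-- The matrix `diag(0, 1, …, n - 1)`. -/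
abbrev levelMatrix (n : ℕ) : Matrix (Fin n) (Fin n) ℝ :=
  Matrix.diagonal fun a : Fin n => ((a : ℕ) : ℝ)

/-- The sign in B(L) turns the weight |a − b| into a − b, and (a − b)L_ab is the entry of the
commutator of diag(0, …, n − 1) with L. This is the identity that makes the Toda field a gradient.
-/
theorem invJ_laxB {n : ℕ} (L : Matrix (Fin n) (Fin n) ℝ) :
    invJ (laxB L) = ad L (levelMatrix n) := by
  ext a b
  rw [ad_apply, Matrix.sub_apply, Matrix.diagonal_mul, Matrix.mul_diagonal, invJ, laxB,
    Matrix.of_apply, Matrix.of_apply]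
  rcases lt_trichotomy a b with h1 | h1 | h1
  · have : ((a : ℕ) : ℝ) < ((b : ℕ) : ℝ) := by exact_mod_cast h1
    rw [if_neg h1.not_gt, if_pos h1, abs_of_neg (by linarith)]
    ring
  · simp [h1]; ring
  · have : ((b : ℕ) : ℝ) < ((a : ℕ) : ℝ) := by exact_mod_cast h1
    rw [if_pos h1, abs_of_pos (by linarith)]
    ring

/-- The Toda vector field on the flag manifold. -/
noncomputable def flagField {n : ℕ} (c : Composition n) (lam : Fin c.length → ℝ) (ε : ℝ)
    (x : PartialFlag c) : Cell c :=
  mflag c (frame c x) ((ε • laxB (spec c lam x)) * frame c x)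

theorem flagField_eq {n : ℕ} (c : Composition n) (lam : Fin c.length → ℝ) (ε : ℝ)
    {g : Matrix (Fin n) (Fin n) ℝ} (hg : IsUnit g.det) :
    flagField c lam ε (flagOfMatrix c g)
      = mflag c g ((ε • laxB (spec c lam (flagOfMatrix c g))) * g) :=
  mflag_mul_left c (isUnit_det_of_transpose_mul (frame_orth c _)) hg (flagOfMatrix_frame c _) _

theorem dflag_todaField {n : ℕ} (c : Composition n) (lam : Fin c.length → ℝ) (ε : ℝ)
    {Ψ : Matrix (Fin n) (Fin n) ℝ} (hΨ : Ψ.transpose * Ψ = 1) :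
    (dflag c Ψ (ε • todaField (eigMatrix c lam) Ψ) : Cell c)
      = flagField c lam ε (flagOfMatrix c Ψ) := by
  have hu := isUnit_det_of_transpose_mul hΨ
  rw [dflag_eq_mflag c hu, flagField_eq c lam ε hu, spec_flagOfMatrix c lam hΨ, Matrix.smul_mul]
  rfl

/-- `laxB` as a continuous linear map. -/
noncomputable def laxBL (n : ℕ) : Matrix (Fin n) (Fin n) ℝ →L[ℝ] Matrix (Fin n) (Fin n) ℝ :=
  LinearMap.toContinuousLinearMap
    { toFun := laxB
      map_add' := fun A B => by
        ext a b
        simp only [laxB, Matrix.of_apply, Matrix.add_apply]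
        split_ifs <;> ring
      map_smul' := fun r A => by
        ext a b
        simp only [laxB, Matrix.of_apply, Matrix.smul_apply, smul_eq_mul, RingHom.id_apply]
        split_ifs <;> ring }

/-- `frame` need not be continuous; by `flagField_eq` it may be replaced by the smooth local section
that comes from a chart. -/
theorem contMDiff_flagField {n : ℕ} (c : Composition n) (lam : Fin c.length → ℝ) (ε : ℝ) :
    ContMDiff 𝓘(ℝ, Cell c) 𝓘(ℝ, Cell c).tangent ∞
      (fun x => (⟨x, flagField c lam ε x⟩ : TangentBundle 𝓘(ℝ, Cell c) (PartialFlag c))) := by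
  intro x₀
  have hs := contMDiffAt_chartSection c x₀
  have hB : ContMDiffAt 𝓘(ℝ, Cell c) 𝓘(ℝ, Matrix (Fin n) (Fin n) ℝ) ∞
      (fun x => ε • laxBL n (spec c lam x)) x₀ :=
    (ε • laxBL n).contDiff.contMDiff.contMDiffAt.comp x₀ (contMDiff_spec c lam x₀)
  have hW : ContMDiffAt 𝓘(ℝ, Cell c) 𝓘(ℝ, Matrix (Fin n) (Fin n) ℝ) ∞
      (fun x => (ε • laxBL n (spec c lam x)) * chartSection c x₀ x) x₀ :=
    (((ContinuousLinearMap.mul ℝ (Matrix (Fin n) (Fin n) ℝ)).contDiff.contMDiff.contMDiffAt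
      (x := ε • laxBL n (spec c lam x₀))).comp x₀ hB).clm_apply hs
  refine contMDiffAt_pushforward (contMDiffAt_flagOfMatrix c (isUnit_chartSection c x₀ x₀)) hs hW
    (eventually_flagOfMatrix_chartSection c x₀) _ ?_
  filter_upwards [eventually_flagOfMatrix_chartSection c x₀] with y hy
  have := flagField_eq c lam ε (isUnit_chartSection c x₀ y)
  rw [hy] at this
  exact this

/-- The Morse function on the flag manifold. -/
noncomputable def flagF {n : ℕ} (c : Composition n) (lam : Fin c.length → ℝ) (ε : ℝ)
    (x : PartialFlag c) : ℝ := (ε • frob n (levelMatrix n)) (spec c lam x)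

theorem flagF_flagOfMatrix {n : ℕ} (c : Composition n) (lam : Fin c.length → ℝ) (ε : ℝ)
    {Ψ : Matrix (Fin n) (Fin n) ℝ} (hΨ : Ψ.transpose * Ψ = 1) :
    flagF c lam ε (flagOfMatrix c Ψ) = ε * todaF (eigMatrix c lam) Ψ := by
  rw [flagF, spec_flagOfMatrix c lam hΨ, smul_apply, smul_eq_mul, frob_apply,
    Matrix.diagonal_transpose, Matrix.trace_mul_comm]
  rfl

theorem hasMFDerivAt_flagF {n : ℕ} (c : Composition n) (lam : Fin c.length → ℝ) (ε : ℝ)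
    (x : PartialFlag c) :
    HasMFDerivAt 𝓘(ℝ, Cell c) 𝓘(ℝ, ℝ) (flagF c lam ε) x
      ((ε • frob n (levelMatrix n)).comp (dspec c lam x)) :=
  (ε • frob n (levelMatrix n)).hasFDerivAt.hasMFDerivAt.comp x (hasMFDerivAt_spec c lam x)

theorem contMDiff_flagF {n : ℕ} (c : Composition n) (lam : Fin c.length → ℝ) (ε : ℝ) :
    ContMDiff 𝓘(ℝ, Cell c) 𝓘(ℝ, ℝ) ∞ (flagF c lam ε) :=
  (ε • frob n (levelMatrix n)).contDiff.contMDiff.comp (contMDiff_spec c lam)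

theorem dspec_flagField {n : ℕ} (c : Composition n) (lam : Fin c.length → ℝ) (ε : ℝ)
    (x : PartialFlag c) :
    dspec c lam x (flagField c lam ε x) = ε • ad (spec c lam x) (laxB (spec c lam x)) := by
  have hu := isUnit_det_of_transpose_mul (frame_orth c x)
  have h := dspec_mflag_skew_eq_ad c lam hu (isSkew_laxB (spec_transpose c lam x))
  rw [flagOfMatrix_frame] at h
  rw [flagField, Matrix.smul_mul, map_smul, map_smul, h]

/-- The Toda field is the gradient of the Morse function. -/
theorem flagMetric_flagField {n : ℕ} (c : Composition n) {lam : Fin c.length → ℝ}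
    (hlam : Function.Injective lam) (ε : ℝ) (x : PartialFlag c) (v : Cell c) :
    (flagMetric c hlam).inner x (flagField c lam ε x) v
      = (mfderiv 𝓘(ℝ, Cell c) 𝓘(ℝ, ℝ) (flagF c lam ε) x : Cell c →L[ℝ] ℝ) v := by
  rw [(hasMFDerivAt_flagF c lam ε x).mfderiv]
  refine (flagMetric_inner c hlam x _ v).trans ?_
  change _ = ε * frob n (levelMatrix n) (dspec c lam x v)
  set N := levelMatrix n
  -- The potential of B(L) is N with its centralizer part removed. The removed part does not change
  -- the bracket with L, and it is orthogonal to every dL v.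
  have h1 : ad (spec c lam x) (N - centProj c x N) = invJ (laxB (spec c lam x)) := by
    rw [map_sub, ad_centProj, sub_zero, invJ_laxB]
  have h2 : rOp c lam x (ad (spec c lam x) (laxB (spec c lam x))) = N - centProj c x N :=
    rOp_ad c hlam (by rw [h1, jOp_invJ (isSkew_laxB (spec_transpose c lam x))])
      (by rw [map_sub, centProj_centProj, sub_self])
  rw [← frob_rOp c hlam, dspec_flagField, map_smul, h2, map_smul, map_sub, smul_apply, sub_apply,
    frob_centProj, centProj_dspec, map_zero, sub_zero, smul_eq_mul]

/-! ### The Hessian of the Morse function -/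

/-- Differentiating dh(w) along v gives D²h(v, w) + dh(Dw·v), and the second term vanishes at a
critical point. The Hessian is thus obtained from the action of a vector field on h. -/
theorem hessian_apply_of_fderiv_apply {E : Type*} [NormedAddCommGroup E] [NormedSpace ℝ E]
    {h : E → ℝ} {x : E} (hh : DifferentiableAt ℝ (fderiv ℝ h) x) (h0 : fderiv ℝ h x = 0)
    {w : E → E} (hw : DifferentiableAt ℝ w x) {q : E → ℝ} {q' : E →L[ℝ] ℝ}
    (hq : HasFDerivAt q q' x) (he : ∀ y, fderiv ℝ h y (w y) = q y) (v : E) :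
    fderiv ℝ (fderiv ℝ h) x v (w x) = q' v := by
  have h1 := hh.hasFDerivAt.clm_apply hw.hasFDerivAt
  simp only [he] at h1
  have h2 := congrArg (fun T : E →L[ℝ] ℝ => T v) (h1.unique hq)
  simpa [h0] using h2

/-- If `s` is a section of `κ`, then the vector field `g ↦ T g` pushes forward along `κ` to a
differentiable vector field whose action on `ρ` is read off from a function that agrees with
`ρ ∘ κ` near the section. -/
theorem exists_vectorField_of_section {E V W : Type*} [NormedAddCommGroup E] [NormedSpace ℝ E]
    [NormedAddCommGroup V] [NormedSpace ℝ V] [NormedAddCommGroup W] [NormedSpace ℝ W]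
    {κ : V → E} {ρ : E → W} {τ : V → W} {s : E → V} (T : V →L[ℝ] V) {q : E → W} (x : E)
    (hκ : ∀ y, ContDiffAt ℝ ∞ κ (s y)) (hs : DifferentiableAt ℝ s x) (hκs : ∀ y, κ (s y) = y)
    (hρ : Differentiable ℝ ρ) (he : ∀ y, ρ ∘ κ =ᶠ[𝓝 (s y)] τ)
    (hτ : ∀ y, ∃ τ' : V →L[ℝ] W, HasFDerivAt τ τ' (s y) ∧ τ' (T (s y)) = q y) :
    ∃ w : E → E, DifferentiableAt ℝ w x ∧ ∀ y, fderiv ℝ ρ y (w y) = q y := by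
  refine ⟨fun y => fderiv ℝ κ (s y) (T (s y)), ?_, fun y => ?_⟩
  · have h1 : DifferentiableAt ℝ (fderiv ℝ κ) (s x) :=
      ((hκ x).fderiv_right (m := 1) (by norm_cast)).differentiableAt (by simp)
    exact (h1.comp x hs).clm_apply (T.differentiableAt.comp x hs)
  · obtain ⟨τ', h2, h3⟩ := hτ y
    have h1 := (hρ (κ (s y))).hasFDerivAt.comp (s y)
      ((hκ y).differentiableAt (by simp)).hasFDerivAt
    have h4 := congrArg (fun T' : V →L[ℝ] W => T' (T (s y)))
      ((h1.congr_of_eventuallyEq (he y).symm).unique h2)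
    rw [← h3, ← h4, hκs]
    rfl

theorem contDiff_spec_chart {n : ℕ} (c : Composition n) (f : Fin c.length → ℝ)
    (x : PartialFlag c) : ContDiff ℝ ∞ fun X => spec c f ((chartAt (Cell c) x).symm X) := by
  rw [contDiff_iff_contDiffAt]
  intro X
  have h2 : ContDiff ℝ ∞ fun X : Cell c => chartBase c x * unip c X :=
    contDiff_const.mul (contDiff_unip c)
  exact (contDiffAt_spec c f (isUnit_det_mul_unip c (isUnit_chartBase c x) X)).comp X
    h2.contDiffAt

theorem hasFDerivAt_spec_flagOfMatrix {n : ℕ} (c : Composition n) (f : Fin c.length → ℝ)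
    {g : Matrix (Fin n) (Fin n) ℝ} (hg : IsUnit g.det) :
    HasFDerivAt (fun h => spec c f (flagOfMatrix c h))
      ((dspec c f (flagOfMatrix c g)).comp (mflag c g)) g :=
  ((hasMFDerivAt_spec c f (flagOfMatrix c g)).comp g (hasMFDerivAt_flagOfMatrix c hg)).hasFDerivAt

/-- The vector field on a chart that is generated by a skew-symmetric matrix. -/
theorem exists_vectorField_skew {n : ℕ} (c : Composition n) (f : Fin c.length → ℝ)
    (x : PartialFlag c) {A : Matrix (Fin n) (Fin n) ℝ} (hA : IsSkew A) :
    ∃ w : Cell c → Cell c, DifferentiableAt ℝ w (chartAt (Cell c) x x) ∧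
      ∀ X, fderiv ℝ (fun X => spec c f ((chartAt (Cell c) x).symm X)) X (w X)
        = ad (spec c f ((chartAt (Cell c) x).symm X)) A := by
  have hs : ContDiff ℝ ∞ fun X : Cell c => chartBase c x * unip c X :=
    contDiff_const.mul (contDiff_unip c)
  have hu := fun X => isUnit_det_mul_unip c (isUnit_chartBase c x) X
  have hsrc : ∀ X : Cell c,
      flagOfMatrix c (chartBase c x * unip c X) ∈ (chartAt (Cell c) x).source := fun X =>
    (chartAt (Cell c) x).map_target (Set.mem_univ X)
  refine exists_vectorField_of_section
    (κ := fun g => chartAt (Cell c) x (flagOfMatrix c g))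
    (τ := fun g => spec c f (flagOfMatrix c g))
    (s := fun X => chartBase c x * unip c X)
    (ContinuousLinearMap.mul ℝ (Matrix (Fin n) (Fin n) ℝ) A) _ ?_ ?_ ?_ ?_ ?_ ?_
  · intro X
    exact (isSmoothChart_cellChart c _ (isUnit_chartBase c x)).1 _ (hu X) (hsrc X)
  · exact hs.contDiffAt.differentiableAt (by simp)
  · exact fun X => (chartAt (Cell c) x).right_inv (Set.mem_univ X)
  · exact (contDiff_spec_chart c f x).differentiable (by simp)
  -- Off the chart domain the chart map is arbitrary, so the two functions are compared only as
  -- germs along the section.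
  · intro X
    have h1 := (contMDiffAt_flagOfMatrix c (hu X)).continuousAt.eventually
      ((chartAt (Cell c) x).open_source.mem_nhds (hsrc X))
    filter_upwards [h1] with g hg
    exact congrArg (spec c f) ((chartAt (Cell c) x).left_inv hg)
  · exact fun X => ⟨_, hasFDerivAt_spec_flagOfMatrix c f (hu X),
      dspec_mflag_skew_eq_ad c f (hu X) hA⟩

theorem isSkew_ad {n : ℕ} {L S : Matrix (Fin n) (Fin n) ℝ} (hL : L.transpose = L)
    (hS : S.transpose = S) : IsSkew (ad L S) := by
  rw [IsSkew, ad_apply, Matrix.transpose_sub, Matrix.transpose_mul, Matrix.transpose_mul, hL, hS,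
    neg_sub]

/-- The commutator [N, S] is itself skew; testing with it gives its own squared norm. -/
theorem ad_levelMatrix_eq_zero {n : ℕ} {S : Matrix (Fin n) (Fin n) ℝ} (hS : S.transpose = S)
    (h : ∀ A, IsSkew A → frob n (levelMatrix n) (ad S A) = 0) : ad S (levelMatrix n) = 0 := by
  apply eq_zero_of_frob_self
  have h1 := h _ (isSkew_ad hS (Matrix.diagonal_transpose _ : (levelMatrix n).transpose = _))
  rw [← frob_ad hS] at h1
  exact h1.le

theorem isDiag_of_ad_levelMatrix {n : ℕ} {S : Matrix (Fin n) (Fin n) ℝ}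
    (h : ad S (levelMatrix n) = 0) {a b : Fin n} (hab : a ≠ b) : S a b = 0 := by
  have h1 := congrFun (congrFun h a) b
  rw [ad_apply, Matrix.sub_apply, Matrix.diagonal_mul, Matrix.mul_diagonal, Matrix.zero_apply] at h1
  have h2 : (((a : ℕ) : ℝ) - ((b : ℕ) : ℝ)) * S a b = 0 := by linarith
  refine (mul_eq_zero.mp h2).resolve_left (sub_ne_zero.mpr fun h => hab (Fin.ext ?_))
  exact_mod_cast h

theorem ad_eq_zero_of_isDiag {n : ℕ} {L S : Matrix (Fin n) (Fin n) ℝ}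
    (hL : ∀ a b, a ≠ b → L a b = 0) (hS : ∀ a b, a ≠ b → S a b = 0) : ad L S = 0 := by
  have key : ∀ T : Matrix (Fin n) (Fin n) ℝ, (∀ a b, a ≠ b → T a b = 0) →
      T = Matrix.diagonal fun a => T a a := by
    intro T hT
    ext a b
    by_cases hab : a = b
    · subst hab; simp
    · rw [Matrix.diagonal_apply_ne _ hab, hT a b hab]
  rw [ad_apply, key L hL, key S hS, Matrix.diagonal_mul_diagonal, Matrix.diagonal_mul_diagonal,
    sub_eq_zero]
  simp only [mul_comm]

theorem isMorse_flagF {n : ℕ} (c : Composition n) {lam : Fin c.length → ℝ}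
    (hlam : Function.Injective lam) {ε : ℝ} (hε : ε ≠ 0) :
    IsMorse (E := Cell c) (flagF c lam ε) := by
  refine ⟨contMDiff_flagF c lam ε, fun x hx v hv => ?_⟩
  have hx' : ∀ w : Cell c, ε * frob n (levelMatrix n) (dspec c lam x w) = 0 := by
    rw [(hasMFDerivAt_flagF c lam ε x).mfderiv] at hx
    exact fun w => congrArg (fun T : Cell c →L[ℝ] ℝ => T w) hx
  set ρ : Cell c → Matrix (Fin n) (Fin n) ℝ := fun X => spec c lam ((chartAt (Cell c) x).symm X)
    with hρ_def
  set X₀ := chartAt (Cell c) x x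
  have hρ₀ : ρ X₀ = spec c lam x := congrArg (spec c lam) (chartAt_symm_chartAt c x)
  have hρ : ContDiff ℝ ∞ ρ := contDiff_spec_chart c lam x
  have hdρ : fderiv ℝ ρ X₀ = dspec c lam x := (hasFDerivAt_spec c lam x).fderiv
  set φ := ε • frob n (levelMatrix n) with hφ
  have hdf : ∀ X, fderiv ℝ (flagF c lam ε ∘ (chartAt (Cell c) x).symm) X
      = φ.comp (fderiv ℝ ρ X) := fun X =>
    (φ.hasFDerivAt.comp X (hρ.differentiable (by simp) X).hasFDerivAt).fderiv
  have hf : ContDiff ℝ ∞ (flagF c lam ε ∘ (chartAt (Cell c) x).symm) := φ.contDiff.comp hρ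
  set S := dspec c lam x v
  have hSt : S.transpose = S := dspec_transpose c lam x v
  have hLt := spec_transpose c lam x
  -- Criticality, tested on the vectors generated by skew matrices, makes L commute with N.
  have hL : ad (spec c lam x) (levelMatrix n) = 0 := by
    refine ad_levelMatrix_eq_zero hLt fun A hA => ?_
    obtain ⟨w, -, hw⟩ := exists_vectorField_skew c lam x hA
    have h1 := hw X₀
    rw [← hρ_def, hdρ, chartAt_symm_chartAt] at h1
    rw [← h1]
    exact (mul_eq_zero.mp (hx' _)).resolve_left hε
  -- Along the field generated by A, the derivative of F is ε⟨N, [A, L]⟩. Its derivative in the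
  -- direction `v` replaces L by S, so degeneracy of the Hessian makes S commute with N as well.
  have hS : ad S (levelMatrix n) = 0 := by
    refine ad_levelMatrix_eq_zero hSt fun A hA => ?_
    obtain ⟨w, hwd, hw⟩ := exists_vectorField_skew c lam x hA
    let B : Matrix (Fin n) (Fin n) ℝ →L[ℝ] Matrix (Fin n) (Fin n) ℝ :=
      ContinuousLinearMap.mul ℝ _ A - (ContinuousLinearMap.mul ℝ _).flip A
    have hB : ∀ T, B T = ad T A := fun T => rfl
    have h1 : HasFDerivAt (fun X => φ (B (ρ X))) ((φ.comp B).comp (dspec c lam x)) X₀ :=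
      (φ.comp B).hasFDerivAt.comp X₀ (hasFDerivAt_spec c lam x)
    have h2 := hessian_apply_of_fderiv_apply
      ((hf.fderiv_right (m := 1) (by norm_cast)).differentiable (by simp) X₀)
      (by rw [hdf, hdρ]; exact ContinuousLinearMap.ext hx') hwd h1
      (fun X => by rw [hdf]; exact congrArg φ (hw X)) v
    rw [hv] at h2
    have h3 : ε * frob n (levelMatrix n) (ad S A) = 0 := h2.symm
    exact (mul_eq_zero.mp h3).resolve_left hε
  -- N has distinct diagonal entries, so L and S are both diagonal and commute. Since S also has no
  -- centralizer part, it is zero.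
  exact dspec_injective c hlam (eq_zero_of_ad_of_centProj c hlam
    (ad_eq_zero_of_isDiag (fun a b => isDiag_of_ad_levelMatrix hL)
      (fun a b => isDiag_of_ad_levelMatrix hS)) (centProj_dspec c lam x v))

/-! ### Global solutions of ordinary differential equations -/

theorem exists_hasDerivAt_of_lipschitz {E : Type*} [NormedAddCommGroup E] [NormedSpace ℝ E]
    [CompleteSpace E] {v : E → E} {K C : NNReal} (hK : LipschitzWith K v) (hC : ∀ x, ‖v x‖ ≤ C)
    (x : E) : ∃ γ : ℝ → E, γ 0 = x ∧ ∀ t, HasDerivAt γ (v (γ t)) t := by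
  have h : ∀ T : ℝ, 0 < T → ∃ γ : ℝ → E, γ 0 = x ∧
      ∀ t ∈ Set.Ioo (-T) T, HasDerivAt γ (v (γ t)) t := by
    intro T hT
    -- With speed at most `C`, a solution on [−T, T] cannot leave the ball of radius CT, which is
    -- the radius Picard–Lindelöf asks for.
    have hP : IsPicardLindelof (fun _ => v) (tmin := -T) (tmax := T)
        ⟨0, by simp [hT.le]⟩ x (C * T.toNNReal) 0 C K :=
      .of_time_independent (fun y _ => hC y) hK.lipschitzOnWith (by simp [hT.le])
    obtain ⟨γ, h0, h1⟩ := hP.exists_eq_forall_mem_Icc_hasDerivWithinAt₀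
    exact ⟨γ, h0, fun t ht => (h1 t (Set.Ioo_subset_Icc_self ht)).hasDerivAt
      (Icc_mem_nhds ht.1 ht.2)⟩
  have h' : ∀ T : ℝ, ∃ γ : ℝ → E, γ 0 = x ∧
      (0 < T → ∀ t ∈ Set.Ioo (-T) T, HasDerivAt γ (v (γ t)) t) := by
    intro T
    by_cases hT : 0 < T
    · obtain ⟨γ, h0, h1⟩ := h T hT
      exact ⟨γ, h0, fun _ => h1⟩
    · exact ⟨fun _ => x, rfl, fun h => absurd h hT⟩
  choose γ hγ0 hγ using h'
  have heq : ∀ a b : ℝ, 0 < a → a ≤ b → Set.EqOn (γ a) (γ b) (Set.Ioo (-a) a) := by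
    intro a b ha hab
    refine ODE_solution_unique_of_mem_Ioo (v := fun _ => v) (s := fun _ => Set.univ) (t₀ := 0)
      (fun t _ => hK.lipschitzOnWith) ⟨by linarith, ha⟩ (fun t ht => ⟨hγ a ha t ht, trivial⟩)
      (fun t ht => ⟨hγ b (ha.trans_le hab) t ⟨by linarith [ht.1], by linarith [ht.2]⟩, trivial⟩) ?_
    rw [hγ0, hγ0]
  -- At time t the solution on the interval of half-length |t| + 1 is read off, so t is always
  -- interior; by uniqueness the pieces agree.
  refine ⟨fun t => γ (|t| + 1) t, hγ0 _, fun t => ?_⟩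
  have ht : |t| < |t| + 1 := lt_add_one _
  refine (hγ (|t| + 1) (by positivity) t (abs_lt.mp ht)).congr_of_eventuallyEq ?_
  filter_upwards [Ioo_mem_nhds (abs_lt.mp ht).1 (abs_lt.mp ht).2] with s hs
  rcases le_total (|s| + 1) (|t| + 1) with h1 | h1
  · exact heq _ _ (by positivity) h1 (abs_lt.mp (lt_add_one _))
  · exact (heq _ _ (by positivity) h1 hs).symm

/-- The equation `γ' = v(γ)` has global solutions once `v` is cut off outside of a ball. -/
theorem exists_cutoff_hasDerivAt {E : Type*} [NormedAddCommGroup E] [NormedSpace ℝ E]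
    [FiniteDimensional ℝ E] {v : E → E} (hv : ContDiff ℝ 1 v) (R : ℝ) :
    ∃ χ : E → ℝ, (∀ x, ‖x‖ ≤ R → χ x = 1) ∧
      ∀ x, ∃ γ : ℝ → E, γ 0 = x ∧ ∀ t, HasDerivAt γ (χ (γ t) • v (γ t)) t := by
  have : CompleteSpace E := FiniteDimensional.complete ℝ E
  -- The maximum with 1 only ensures a positive inner radius when `R` is not positive.
  let χ : ContDiffBump (0 : E) := ⟨max R 1, max R 1 + 1, by positivity, by linarith⟩
  have hw : ContDiff ℝ 1 fun x => χ x • v x := χ.contDiff.smul hv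
  have hs : HasCompactSupport fun x => χ x • v x := χ.hasCompactSupport.smul_right
  obtain ⟨K, hK⟩ := hw.lipschitzWith_of_hasCompactSupport hs (by simp)
  obtain ⟨C, hC⟩ := hs.exists_bound_of_continuous hw.continuous
  refine ⟨χ, fun x hx => χ.one_of_mem_closedBall ?_, exists_hasDerivAt_of_lipschitz hK
    (C := C.toNNReal) fun x => (hC x).trans (Real.le_coe_toNNReal C)⟩
  rw [mem_closedBall_zero_iff]
  exact hx.trans (le_max_left _ _)

theorem exists_lipschitzOnWith_closedBall {E : Type*} [NormedAddCommGroup E] [NormedSpace ℝ E]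
    [FiniteDimensional ℝ E] {v : E → E} (hv : ContDiff ℝ 1 v) (R : ℝ) :
    ∃ K, LipschitzOnWith K v (Metric.closedBall 0 R) := by
  have : ProperSpace E := FiniteDimensional.proper ℝ E
  obtain ⟨C, hC⟩ := (isCompact_closedBall (0 : E) R).exists_bound_of_continuousOn
    (hv.continuous_fderiv (by simp)).continuousOn
  refine ⟨C.toNNReal, (convex_closedBall _ _).lipschitzOnWith_of_nnnorm_fderiv_le (𝕜 := ℝ)
    (fun x _ => hv.differentiable (by simp) x) fun x hx => ?_⟩
  rw [← NNReal.coe_le_coe, coe_nnnorm]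
  exact (hC x hx).trans (Real.le_coe_toNNReal C)

/-- A C¹ field is Lipschitz only on balls, so uniqueness is applied on a bounded time interval,
where both curves stay in a common ball. -/
theorem eq_of_hasDerivAt {E : Type*} [NormedAddCommGroup E] [NormedSpace ℝ E]
    [FiniteDimensional ℝ E] {v : E → E} (hv : ContDiff ℝ 1 v) {f g : ℝ → E}
    (hf : ∀ t, HasDerivAt f (v (f t)) t) (hg : ∀ t, HasDerivAt g (v (g t)) t) (h0 : f 0 = g 0) :
    f = g := by
  funext t
  have hcf : Continuous f := continuous_iff_continuousAt.mpr fun t => (hf t).continuousAt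
  have hcg : Continuous g := continuous_iff_continuousAt.mpr fun t => (hg t).continuousAt
  let T := |t| + 1
  obtain ⟨A, hA⟩ := (isCompact_Icc (a := -T) (b := T)).exists_bound_of_continuousOn
    hcf.continuousOn
  obtain ⟨B, hB⟩ := (isCompact_Icc (a := -T) (b := T)).exists_bound_of_continuousOn
    hcg.continuousOn
  obtain ⟨K, hK⟩ := exists_lipschitzOnWith_closedBall hv (max A B)
  refine ODE_solution_unique_of_mem_Ioo (v := fun _ => v) (t₀ := 0) (a := -T) (b := T)
    (s := fun _ => Metric.closedBall 0 (max A B)) (fun _ _ => hK)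
    ⟨by simp only [T]; linarith [abs_nonneg t], by positivity⟩ (fun s hs => ⟨hf s, ?_⟩)
    (fun s hs => ⟨hg s, ?_⟩) h0 (abs_lt.mp (lt_add_one _))
  · rw [mem_closedBall_zero_iff]
    exact (hA s (Set.Ioo_subset_Icc_self hs)).trans (le_max_left _ _)
  · rw [mem_closedBall_zero_iff]
    exact (hB s (Set.Ioo_subset_Icc_self hs)).trans (le_max_right _ _)

theorem dist_le_of_hasDerivAt {E : Type*} [NormedAddCommGroup E] [NormedSpace ℝ E] {v : E → E}
    {s : Set E} {K : NNReal} (hv : LipschitzOnWith K v s) {f g : ℝ → E}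
    (hf : ∀ t, HasDerivAt f (v (f t)) t) (hg : ∀ t, HasDerivAt g (v (g t)) t)
    (hfs : ∀ t, f t ∈ s) (hgs : ∀ t, g t ∈ s) (t : ℝ) :
    dist (f t) (g t) ≤ dist (f 0) (g 0) * Real.exp (K * |t|) := by
  have key : ∀ {v : E → E} {f g : ℝ → E}, LipschitzOnWith K v s →
      (∀ t, HasDerivAt f (v (f t)) t) → (∀ t, HasDerivAt g (v (g t)) t) → (∀ t, f t ∈ s) →
      (∀ t, g t ∈ s) → ∀ {t : ℝ}, 0 ≤ t →
      dist (f t) (g t) ≤ dist (f 0) (g 0) * Real.exp (K * t) := by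
    intro v f g hv hf hg hfs hgs t ht
    have := dist_le_of_trajectories_ODE_of_mem (v := fun _ => v) (s := fun _ => s) (a := 0)
      (b := t) (fun _ _ => hv) (fun t _ => (hf t).continuousAt.continuousWithinAt)
      (fun t _ => (hf t).hasDerivWithinAt) (fun t _ => hfs t)
      (fun t _ => (hg t).continuousAt.continuousWithinAt) (fun t _ => (hg t).hasDerivWithinAt)
      (fun t _ => hgs t) le_rfl t ⟨ht, le_rfl⟩
    simpa using this
  rcases le_total 0 t with ht | ht
  · rw [abs_of_nonneg ht]
    exact key hv hf hg hfs hgs ht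
  -- Negative times reduce to positive ones: the reversed curves solve the equation of −v, which has
  -- the same Lipschitz constant.
  · have hneg : ∀ {f : ℝ → E}, (∀ t, HasDerivAt f (v (f t)) t) →
        ∀ t, HasDerivAt (fun t => f (-t)) (-v (f (-t))) t := by
      intro f hf t
      exact ((hf (-t)).scomp t (hasDerivAt_neg t)).congr_deriv (neg_one_smul ℝ _)
    have := key (v := fun x => -v x) (LipschitzOnWith.neg hv) (hneg hf) (hneg hg)
      (fun t => hfs (-t)) (fun t => hgs (-t)) (neg_nonneg.mpr ht)
    rw [abs_of_nonpos ht]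
    simpa using this

/-- Solutions depend continuously on time and on the initial value. -/
theorem continuous_uncurry_of_hasDerivAt {E X : Type*} [NormedAddCommGroup E] [NormedSpace ℝ E]
    [TopologicalSpace X] {v : E → E} {s : Set E} {K : NNReal} (hv : LipschitzOnWith K v s)
    {α : ℝ → X → E} (hα : ∀ x t, HasDerivAt (fun t => α t x) (v (α t x)) t)
    (hs : ∀ t x, α t x ∈ s) (h0 : Continuous (α 0)) : Continuous (Function.uncurry α) := by
  rw [continuous_iff_continuousAt]
  rintro ⟨t₀, x₀⟩
  -- The initial value is changed at fixed time, at the cost given by Grönwall; then time is changed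
  -- along the single trajectory of `x₀`.
  have h1 : ∀ p : ℝ × X, dist (Function.uncurry α p) (α t₀ x₀)
      ≤ dist (α 0 p.2) (α 0 x₀) * Real.exp (K * |p.1|) + dist (α p.1 x₀) (α t₀ x₀) := fun p =>
    (dist_triangle _ (α p.1 x₀) _).trans (add_le_add_left (dist_le_of_hasDerivAt hv (hα p.2)
      (hα x₀) (fun t => hs t _) (fun t => hs t _) p.1) _)
  have hc : Continuous fun t => α t x₀ :=
    continuous_iff_continuousAt.mpr fun t => (hα x₀ t).continuousAt
  have h2 : Continuous fun p : ℝ × X =>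
      dist (α 0 p.2) (α 0 x₀) * Real.exp (K * |p.1|) + dist (α p.1 x₀) (α t₀ x₀) := by
    have := h0.comp (continuous_snd (X := ℝ) (Y := X))
    have := hc.comp (continuous_fst (X := ℝ) (Y := X))
    fun_prop
  refine tendsto_iff_dist_tendsto_zero.mpr (squeeze_zero (fun _ => dist_nonneg) h1 ?_)
  simpa using h2.tendsto (t₀, x₀)

/-! ### Compactness -/

theorem abs_apply_le_one_of_orth {n : ℕ} {Ψ : Matrix (Fin n) (Fin n) ℝ}
    (h : Ψ.transpose * Ψ = 1) (a b : Fin n) : |Ψ a b| ≤ 1 := by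
  have h1 := congrFun (congrFun h b) b
  rw [Matrix.mul_apply, Matrix.one_apply_eq] at h1
  have h2 : Ψ.transpose b a * Ψ a b ≤ ∑ j, Ψ.transpose b j * Ψ j b :=
    Finset.single_le_sum (f := fun j => Ψ.transpose b j * Ψ j b)
      (fun j _ => mul_self_nonneg (Ψ j b)) (Finset.mem_univ a)
  rw [h1, Matrix.transpose_apply] at h2
  exact abs_le_one_iff_mul_self_le_one.mpr h2

/-- The norm is the maximal row sum, and each of the n entries of a row has absolute value at most
1. -/
theorem norm_le_of_orth {n : ℕ} {Ψ : Matrix (Fin n) (Fin n) ℝ} (h : Ψ.transpose * Ψ = 1) :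
    ‖Ψ‖ ≤ n := by
  have h1 : ‖Ψ‖₊ ≤ n := by
    rw [Matrix.linfty_opNNNorm_def]
    refine Finset.sup_le fun a _ => ?_
    calc ∑ b, ‖Ψ a b‖₊ ≤ ∑ _b : Fin n, 1 :=
          Finset.sum_le_sum fun b _ => abs_apply_le_one_of_orth h a b
      _ = n := by simp
  exact_mod_cast h1

theorem isCompact_orth (n : ℕ) :
    IsCompact {Ψ : Matrix (Fin n) (Fin n) ℝ | Ψ.transpose * Ψ = 1} := by
  have : ProperSpace (Matrix (Fin n) (Fin n) ℝ) := FiniteDimensional.proper ℝ _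
  refine Metric.isCompact_of_isClosed_isBounded ?_ ?_
  · have h1 : Continuous fun Ψ : Matrix (Fin n) (Fin n) ℝ => Ψ.transpose * Ψ :=
      (contDiff_transpose.mul contDiff_id).continuous
    exact isClosed_singleton.preimage h1
  · refine Metric.isBounded_closedBall.subset (t := Metric.closedBall 0 (n : ℝ)) fun Ψ hΨ => ?_
    rw [mem_closedBall_zero_iff]
    exact norm_le_of_orth hΨ

theorem compactSpace_partialFlag {n : ℕ} (c : Composition n) : CompactSpace (PartialFlag c) := by
  constructor
  have h1 := (isCompact_orth n).image_of_continuousOn (f := flagOfMatrix c)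
    fun Ψ (hΨ : Ψ.transpose * Ψ = 1) => (contMDiffAt_flagOfMatrix c
      (isUnit_det_of_transpose_mul hΨ)).continuousAt.continuousWithinAt
  rwa [Set.eq_univ_of_forall fun x =>
    (Set.mem_image _ _ x).mpr ⟨frame c x, frame_orth c x, flagOfMatrix_frame c x⟩] at h1

theorem continuous_spec {n : ℕ} (c : Composition n) (f : Fin c.length → ℝ) :
    Continuous (spec c f) := (contMDiff_spec c f).continuous

/-- A continuous injection from a compact space into a Hausdorff space is a closed embedding;
compactness comes from the orthogonal frames. -/
theorem isClosedEmbedding_spec {n : ℕ} (c : Composition n) {lam : Fin c.length → ℝ}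
    (hlam : StrictMono lam) : Topology.IsClosedEmbedding (spec c lam) :=
  have := compactSpace_partialFlag c
  (continuous_spec c lam).isClosedEmbedding (spec_injective c hlam)

/-! ### The flow -/

/-- The Toda equation on symmetric matrices. -/
noncomputable def todaLax {n : ℕ} (ε : ℝ) (L : Matrix (Fin n) (Fin n) ℝ) :
    Matrix (Fin n) (Fin n) ℝ := ε • (laxB L * L - L * laxB L)

theorem contDiff_todaLax {n : ℕ} (ε : ℝ) : ContDiff ℝ 1 (todaLax (n := n) ε) :=
  (((laxBL n).contDiff.mul contDiff_id).sub (contDiff_id.mul (laxBL n).contDiff)).const_smul ε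

theorem conj_diagonal_transpose {n : ℕ} (d : Fin n → ℝ) (Ψ : Matrix (Fin n) (Fin n) ℝ) :
    (Ψ * Matrix.diagonal d * Ψ.transpose).transpose = Ψ * Matrix.diagonal d * Ψ.transpose := by
  simp [Matrix.transpose_mul, Matrix.mul_assoc]

/-- The Toda field on the orthogonal group is complete. -/
theorem exists_todaCurve {n : ℕ} (d : Fin n → ℝ) (ε : ℝ) {Ψ₀ : Matrix (Fin n) (Fin n) ℝ}
    (hΨ₀ : Ψ₀.transpose * Ψ₀ = 1) :
    ∃ Ψ : ℝ → Matrix (Fin n) (Fin n) ℝ, Ψ 0 = Ψ₀ ∧ ∀ t, (Ψ t).transpose * Ψ t = 1 ∧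
      HasDerivAt Ψ ((ε • laxB (Ψ t * Matrix.diagonal d * (Ψ t).transpose)) * Ψ t) t := by
  have hv : ContDiff ℝ 1 fun Ψ : Matrix (Fin n) (Fin n) ℝ =>
      (ε • laxB (Ψ * Matrix.diagonal d * Ψ.transpose)) * Ψ :=
    (((laxBL n).contDiff.comp ((contDiff_id.mul contDiff_const).mul
      (transposeL n).contDiff)).const_smul ε).mul contDiff_id
  -- The cut-off radius `n` bounds the norm of every orthogonal matrix.
  obtain ⟨χ, hχ, hex⟩ := exists_cutoff_hasDerivAt hv n
  obtain ⟨Ψ, h0, hΨ⟩ := hex Ψ₀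
  -- The cut-off field is still a skew matrix times Ψ, so ΨᵀΨ is conserved before anything is known
  -- about the size of Ψ. Orthogonality then keeps the curve where the cut-off equals 1.
  have hd : ∀ t, HasDerivAt (fun t => (Ψ t).transpose * Ψ t) 0 t := by
    intro t
    have h1 : HasDerivAt (fun t => (Ψ t).transpose) _ t :=
      (transposeL n).hasFDerivAt.comp_hasDerivAt t (hΨ t)
    refine (h1.mul (hΨ t)).congr_deriv ?_
    have h2 : (laxB (Ψ t * Matrix.diagonal d * (Ψ t).transpose)).transpose = _ :=
      isSkew_laxB (conj_diagonal_transpose d (Ψ t))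
    rw [transposeL_apply, Matrix.transpose_smul, Matrix.transpose_mul, Matrix.transpose_smul, h2]
    simp [Matrix.mul_assoc]
  have horth : ∀ t, (Ψ t).transpose * Ψ t = 1 := by
    intro t
    refine (is_const_of_deriv_eq_zero (fun t => (hd t).differentiableAt)
      (fun t => (hd t).deriv) t 0).trans ?_
    rw [h0, hΨ₀]
  refine ⟨Ψ, h0, fun t => ⟨horth t, ?_⟩⟩
  have := hΨ t
  rwa [hχ _ (norm_le_of_orth (horth t)), one_smul] at this

/-- The lift of the flow to the orthogonal group. -/
noncomputable def liftedFlow {n : ℕ} (c : Composition n) (lam : Fin c.length → ℝ) (ε : ℝ)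
    (x : PartialFlag c) : ℝ → Matrix (Fin n) (Fin n) ℝ :=
  (exists_todaCurve (fun a => lam (c.index a)) ε (frame_orth c x)).choose

theorem liftedFlow_zero {n : ℕ} (c : Composition n) (lam : Fin c.length → ℝ) (ε : ℝ)
    (x : PartialFlag c) : liftedFlow c lam ε x 0 = frame c x :=
  (exists_todaCurve (fun a => lam (c.index a)) ε (frame_orth c x)).choose_spec.1

theorem liftedFlow_orth {n : ℕ} (c : Composition n) (lam : Fin c.length → ℝ) (ε : ℝ)
    (x : PartialFlag c) (t : ℝ) :
    (liftedFlow c lam ε x t).transpose * liftedFlow c lam ε x t = 1 :=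
  ((exists_todaCurve (fun a => lam (c.index a)) ε (frame_orth c x)).choose_spec.2 t).1

theorem hasDerivAt_liftedFlow {n : ℕ} (c : Composition n) (lam : Fin c.length → ℝ) (ε : ℝ)
    (x : PartialFlag c) (t : ℝ) :
    HasDerivAt (liftedFlow c lam ε x)
      ((ε • laxB (spec c lam (flagOfMatrix c (liftedFlow c lam ε x t)))) *
        liftedFlow c lam ε x t) t := by
  rw [spec_flagOfMatrix c lam (liftedFlow_orth c lam ε x t)]
  exact ((exists_todaCurve (fun a => lam (c.index a)) ε (frame_orth c x)).choose_spec.2 t).2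

theorem hasDerivAt_spec_liftedFlow {n : ℕ} (c : Composition n) (lam : Fin c.length → ℝ) (ε : ℝ)
    (x : PartialFlag c) (t : ℝ) :
    HasDerivAt (fun t => spec c lam (flagOfMatrix c (liftedFlow c lam ε x t)))
      (todaLax ε (spec c lam (flagOfMatrix c (liftedFlow c lam ε x t)))) t := by
  have hu := isUnit_det_of_transpose_mul (liftedFlow_orth c lam ε x t)
  refine (hasDerivAt_spec_comp c lam (hasDerivAt_liftedFlow c lam ε x t) hu).congr_deriv ?_
  rw [Matrix.smul_mul, map_smul, map_smul, dspec_mflag_skew c lam hu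
    (isSkew_laxB (spec_transpose c lam _)), todaLax]

/-- The flow of the Toda field on the flag manifold. -/
noncomputable def flagFlow {n : ℕ} (c : Composition n) {lam : Fin c.length → ℝ}
    (hlam : StrictMono lam) (ε : ℝ) : Flow ℝ (PartialFlag c) where
  toFun t x := flagOfMatrix c (liftedFlow c lam ε x t)
  cont' := by
    have := compactSpace_partialFlag c
    obtain ⟨R, hR⟩ := isCompact_univ.exists_bound_of_continuousOn
      (continuous_spec c lam).continuousOn
    obtain ⟨K, hK⟩ := exists_lipschitzOnWith_closedBall (contDiff_todaLax (n := n) ε) R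
    -- Continuity is tested after embedding by L, where the trajectories solve the Toda equation
    -- inside one ball on which its field is Lipschitz. The lifts themselves start at the possibly
    -- discontinuous `frame`.
    rw [(isClosedEmbedding_spec c hlam).isInducing.continuous_iff]
    refine continuous_uncurry_of_hasDerivAt
      (α := fun t x => spec c lam (flagOfMatrix c (liftedFlow c lam ε x t))) hK
      (hasDerivAt_spec_liftedFlow c lam ε)
      (fun t x => by rw [mem_closedBall_zero_iff]; exact hR _ trivial) ?_
    simpa only [liftedFlow_zero, flagOfMatrix_frame] using continuous_spec c lam
  map_zero' x := by rw [liftedFlow_zero, flagOfMatrix_frame]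
  map_add' s t x := by
    -- The group law holds for the matrices L, since both sides solve the same autonomous equation
    -- with the same initial value.
    apply spec_injective c hlam
    have h1 := eq_of_hasDerivAt (contDiff_todaLax ε)
      (f := fun s => spec c lam (flagOfMatrix c (liftedFlow c lam ε x (s + t))))
      (fun s => (hasDerivAt_spec_liftedFlow c lam ε x (s + t)).comp_add_const s t)
      (hasDerivAt_spec_liftedFlow c lam ε (flagOfMatrix c (liftedFlow c lam ε x t)))
      (by rw [zero_add, liftedFlow_zero, flagOfMatrix_frame])
    exact congrFun h1 s

theorem isMIntegralCurve_flagFlow {n : ℕ} (c : Composition n) {lam : Fin c.length → ℝ}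
    (hlam : StrictMono lam) (ε : ℝ) (x : PartialFlag c) :
    IsMIntegralCurve (I := 𝓘(ℝ, Cell c)) (fun t => flagFlow c hlam ε t x)
      (flagField c lam ε) := by
  intro t
  have hu := isUnit_det_of_transpose_mul (liftedFlow_orth c lam ε x t)
  refine (hasMFDerivAt_flagOfMatrix_comp c (hasDerivAt_liftedFlow c lam ε x t) hu).congr_mfderiv ?_
  exact congrArg (fun v : Cell c => (1 : ℝ →L[ℝ] ℝ).smulRight v) (flagField_eq c lam ε hu).symm

theorem hasDerivAt_spec_flagFlow {n : ℕ} (c : Composition n) {lam : Fin c.length → ℝ}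
    (hlam : StrictMono lam) (ε : ℝ) (x : PartialFlag c) (t : ℝ) :
    HasDerivAt (fun t => spec c lam (flagFlow c hlam ε t x))
      (todaLax ε (spec c lam (flagFlow c hlam ε t x))) t :=
  hasDerivAt_spec_liftedFlow c lam ε x t

/-- Each solution of the Toda equation that starts at an isospectral matrix is the image of an orbit
of the flow. -/
theorem eq_spec_flagFlow {n : ℕ} (c : Composition n) {lam : Fin c.length → ℝ}
    (hlam : StrictMono lam) (ε : ℝ) (x : PartialFlag c) {L : ℝ → Matrix (Fin n) (Fin n) ℝ}
    (h0 : L 0 = spec c lam x) (hL : ∀ t, HasDerivAt L (todaLax ε (L t)) t) (t : ℝ) :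
    L t = spec c lam (flagFlow c hlam ε t x) := by
  refine congrFun (eq_of_hasDerivAt (contDiff_todaLax ε) hL
    (hasDerivAt_spec_flagFlow c hlam ε x) ?_) t
  rw [h0, Flow.map_zero_apply]

end FSToda

/-! ### The main theorem -/

open FSToda in
theorem mainTheorem3 {n : ℕ} (c : Composition n) (lam : Fin c.length → ℝ) (hlam : StrictMono lam)
    (ε : ℝ) (hε : ε = 1 ∨ ε = -1) :
    -- isospectral symmetric matrices are identified with partial flags,
    -- compatibly with the projection of `SO(n)`
    Function.Bijective (eigenFlag c hlam) ∧
    (∀ Ψ ∈ Matrix.specialOrthogonalGroup (Fin n) ℝ,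
      ∃ h : Ψ * eigMatrix c lam * Ψ.transpose ∈ IsospectralSymm c lam,
        eigenFlag c hlam ⟨Ψ * eigMatrix c lam * Ψ.transpose, h⟩ = flagOfMatrix c Ψ) ∧
    ∃ (M : (x : PartialFlag c) → TangentSpace 𝓘(ℝ, Cell c) x)
      (F : PartialFlag c → ℝ)
      (g : Bundle.ContMDiffRiemannianMetric 𝓘(ℝ, Cell c) ∞ (Cell c)
        (fun x : PartialFlag c => TangentSpace 𝓘(ℝ, Cell c) x))
      (φ : Flow ℝ (PartialFlag c)),
      -- `M` is a smooth vector field, induced from the Toda field on `SO(n)`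
      ContMDiff 𝓘(ℝ, Cell c) (𝓘(ℝ, Cell c).tangent) ∞
        (fun x => (⟨x, M x⟩ : TangentBundle 𝓘(ℝ, Cell c) (PartialFlag c))) ∧
      (∀ Ψ ∈ Matrix.specialOrthogonalGroup (Fin n) ℝ,
        dflag c Ψ (ε • todaField (eigMatrix c lam) Ψ) = M (flagOfMatrix c Ψ)) ∧
      -- `φ` is its flow, and it is the Toda system on the isospectral symmetric matrices
      (∀ x, IsMIntegralCurve (fun t => φ t x) M) ∧
      (∀ L₀ : IsospectralSymm c lam,
        (∃ L : ℝ → Matrix (Fin n) (Fin n) ℝ, L 0 = L₀ ∧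
          ∀ t, HasDerivAt L (ε • (laxB (L t) * L t - L t * laxB (L t))) t) ∧
        ∀ L : ℝ → Matrix (Fin n) (Fin n) ℝ, L 0 = L₀ →
          (∀ t, HasDerivAt L (ε • (laxB (L t) * L t - L t * laxB (L t))) t) →
          ∀ t, ∃ h : L t ∈ IsospectralSymm c lam,
            eigenFlag c hlam ⟨L t, h⟩ = φ t (eigenFlag c hlam L₀)) ∧
      -- `F` is a Morse function, induced from the function on `SO(n)`
      (∀ Ψ ∈ Matrix.specialOrthogonalGroup (Fin n) ℝ,
        F (flagOfMatrix c Ψ) = ε * todaF (eigMatrix c lam) Ψ) ∧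
      IsMorse (E := Cell c) F ∧
      -- `g` is induced from the metric of `SO(n)`
      (∀ Ψ ∈ Matrix.specialOrthogonalGroup (Fin n) ℝ, ∀ A C : Matrix (Fin n) (Fin n) ℝ,
        IsHorizontal c Ψ A → IsHorizontal c Ψ C →
        g.inner (flagOfMatrix c Ψ)
          (dflag c Ψ (A * Ψ)) (dflag c Ψ (C * Ψ))
          = innerJ A C) ∧
      -- `M` is the gradient of `F` with respect to `g`
      ∀ (x : PartialFlag c) (v : TangentSpace 𝓘(ℝ, Cell c) x),
        g.inner x (M x) v = mfderiv 𝓘(ℝ, Cell c) 𝓘(ℝ, ℝ) F x v := by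
  have hinj := hlam.injective
  refine ⟨eigenFlag_bijective c hlam, fun Ψ hΨ => ?_, flagField c lam ε, flagF c lam ε,
    flagMetric c hinj, flagFlow c hlam ε, contMDiff_flagField c lam ε,
    fun Ψ hΨ => dflag_todaField c lam ε (transpose_mul_self_of_mem hΨ),
    isMIntegralCurve_flagFlow c hlam ε, fun L₀ => ⟨?_, fun L h0 hL t => ?_⟩,
    fun Ψ hΨ => flagF_flagOfMatrix c lam ε (transpose_mul_self_of_mem hΨ),
    isMorse_flagF c hinj (by rcases hε with rfl | rfl <;> norm_num),
    fun Ψ hΨ A C hA hC => flagMetric_horizontal c hinj (transpose_mul_self_of_mem hΨ) hA hC,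
    fun x v => flagMetric_flagField c hinj ε x v⟩
  · have h := transpose_mul_self_of_mem hΨ
    exact ⟨conj_mem_isospectralSymm c hinj h, eigenFlag_conj c hlam h _⟩
  · refine ⟨fun t => spec c lam (flagFlow c hlam ε t (eigenFlag c hlam L₀)), ?_, fun t =>
      hasDerivAt_spec_flagFlow c hlam ε (eigenFlag c hlam L₀) t⟩
    exact (congrArg (spec c lam) (Flow.map_zero_apply _ _)).trans (spec_eigenFlag c hlam L₀)
  · have h := eq_spec_flagFlow c hlam ε (eigenFlag c hlam L₀)
      (by rw [h0, spec_eigenFlag]) hL t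
    have hm : L t ∈ IsospectralSymm c lam := by
      rw [h]
      exact spec_mem_isospectralSymm c hinj _
    refine ⟨hm, ?_⟩
    have e : (⟨L t, hm⟩ : IsospectralSymm c lam)
        = ⟨_, spec_mem_isospectralSymm c hinj (flagFlow c hlam ε t (eigenFlag c hlam L₀))⟩ :=
      Subtype.ext h
    rw [e, eigenFlag_spec]
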